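/- Let $k$ be a commutative ring of characteristic $0$ and let $(A,\mu,\alpha)$ be a multiplicative hom-associative algebra over $k$: a $k$-module $A$ with a $k$-bilinear product $a\cdot b=\mu(a,b)$ and a $k$-linear map $\alpha:A\to A$ such that $(a\cdot b)\cdot\alpha(c)=\alpha(a)\cdot(b\cdot c)$ and $\alpha(a\cdot b)=\alpha(a)\cdot\alpha(b)$. **Cohomology.** For $n\ge 1$ let $C^n_\alpha(A)$ be the $k$-module of $k$-linear maps $f:A^{\otimes n}\to A$ with $\alpha\circ f=f\circ\alpha^{\otimes n}$, let $C^n_\alpha(A)=0$ for $n\le 0$, and let $$(\delta_\alpha f)(a_1,\dots,a_{n+1})=\alpha^{n-1}(a_1)\cdot f(a_2,\dots,a_{n+1})+(-1)^{n+1}f(a_1,\dots,a_n)\cdot\alpha^{n-1}(a_{n+1})+\sum_{i=1}^n(-1)^i f(\alpha(a_1),\dots,\alpha(a_{i-1}),a_i\cdot a_{i+1},\alpha(a_{i+2}),\dots,\alpha(a_{n+1})).$$ For $f\in C^p_\alpha(A)$, $g\in C^q_\alpha(A)$ and $1\le i\le p$ put $$(f\circ_i g)(a_1,\dots,a_{p+q-1})=f(\alpha^{q-1}(a_1),\dots,\alpha^{q-1}(a_{i-1}),g(a_i,\dots,a_{i+q-1}),\alpha^{q-1}(a_{i+q}),\dots,\alpha^{q-1}(a_{p+q-1})),$$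 $$f\cup g=(\mu\circ_2 f)\circ_1 g,\qquad [f,g]=\sum_{i=1}^p(-1)^{(q-1)(i-1)}f\circ_i g-(-1)^{(p-1)(q-1)}\sum_{i=1}^q(-1)^{(p-1)(i-1)}g\circ_i f.$$ **Homology.** For $n\ge 0$ let $C_n^\alpha(A)=A\otimes A^{\otimes n}$, and for $f\in C^p_\alpha(A)$ and $0\le i\le n-p+1$ let $$f\bullet_i(a_0\otimes\cdots\otimes a_n)=\alpha^{p-1}(a_0)\otimes\cdots\otimes\alpha^{p-1}(a_{i-1})\otimes f(a_i,\dots,a_{i+p-1})\otimes\alpha^{p-1}(a_{i+p})\otimes\cdots\otimes\alpha^{p-1}(a_n),$$ and $t(a_0\otimes\cdots\otimes a_n)=a_n\otimes a_0\otimes\cdots\otimes a_{n-1}$. The boundary $C_n^\alpha(A)\to C_{n-1}^\alpha(A)$, for $n\ge 1$, is $d^\alpha(x)=\sum_{i=0}^{n-1}(-1)^i\mu\bullet_i x+(-1)^n\mu\bullet_0 t(x)$. For $f\in C^p_\alpha(A)$ and $x\in C_n^\alpha(A)$ put $$i_f x=(\mu\circ_2 f)\bullet_0 x\ \ (p\le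 n),\qquad \mathcal L_f x=\sum_{i=1}^{n-p+1}(-1)^{(p-1)(i-1)}f\bullet_i x+\sum_{i=1}^p(-1)^{n(i-1)+p-1}f\bullet_0 t^{i-1}(x)\ \ (p\le n+1),$$ and $i_f x=0$ for $p>n$, $\mathcal L_f x=0$ for $p>n+1$. **Theorem.** $(C^\bullet_\alpha(A),\delta_\alpha)$ and $(C_\bullet^\alpha(A),d^\alpha)$ are complexes. Let $H^\bullet_\alpha(A)$ and $H_\bullet^\alpha(A)$ be their cohomology and homology. The operations $\cup$, $[\ ,\ ]$, $i$ and $\mathcal L$ take (co)cycles to (co)cycles and induce well-defined operations on $H^\bullet_\alpha(A)$ and $H_\bullet^\alpha(A)$, and with these the pair $(H^\bullet_\alpha(A),H_\bullet^\alpha(A))$ is a precalculus. That is, for all $f\in H^p_\alpha(A)$, $g\in H^q_\alpha(A)$, all $h\in H^\bullet_\alpha(A)$ and all $x\in H_\bullet^\alpha(A)$: 1. (Gerstenhaber algebra) $\cup$ has degree $0$, is associative, and $f\cup g=(-1)^{pq}g\cup f$; the bracket has degree $-1$, $[f,g]=-(-1)^{(p-1)(q-1)}[g,f]$ and $[f,[g,h]]=[[f,g],h]+(-1)^{(p-1)(q-1)}[g,[f,h]]$;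 and $[f,g\cup h]=[f,g]\cup h+(-1)^{(p-1)q}g\cup[f,h]$. 2. (module over the cup product) $i_f$ maps $H_n^\alpha(A)$ to $H_{n-p}^\alpha(A)$ and $i_{f\cup g}=i_f\circ i_g$. 3. (module over the Lie algebra) $\mathcal L_f$ maps $H_n^\alpha(A)$ to $H_{n-p+1}^\alpha(A)$ and $\mathcal L_{[f,g]}=\mathcal L_f\circ\mathcal L_g-(-1)^{(p-1)(q-1)}\mathcal L_g\circ\mathcal L_f$. 4. $i_{[f,g]}=[i_f,\mathcal L_g]=i_f\circ\mathcal L_g-(-1)^{p(q+1)}\mathcal L_g\circ i_f$. -/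

import Mathlib

open scoped TensorProduct DirectSum

/-! ### Gerstenhaber algebras and precalculi -/

/-- A Gerstenhaber algebra structure on the graded `k`-module `V = ⨁ p, 𝒜 p` (graded by `ℤ`). -/
structure GerstenhaberAlgebra (k : Type*) [CommRing k] {V : Type*} [AddCommGroup V] [Module k V]
    (𝒜 : ℤ → Submodule k V) where
  /-- `V` is the direct sum of the homogeneous pieces. -/
  isInternal : DirectSum.IsInternal 𝒜
  /-- the product `f ∪ g`, of degree `0` -/
  cup : V →ₗ[k] V →ₗ[k] V
  /-- the bracket `[f, g]`, of degree `-1` -/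
  bracket : V →ₗ[k] V →ₗ[k] V
  cup_mem : ∀ (p q : ℤ), ∀ f ∈ 𝒜 p, ∀ g ∈ 𝒜 q, cup f g ∈ 𝒜 (p + q)
  cup_comm : ∀ (p q : ℤ), ∀ f ∈ 𝒜 p, ∀ g ∈ 𝒜 q, cup f g = (p * q).negOnePow • cup g f
  cup_assoc : ∀ f g h : V, cup (cup f g) h = cup f (cup g h)
  bracket_mem : ∀ (p q : ℤ), ∀ f ∈ 𝒜 p, ∀ g ∈ 𝒜 q, bracket f g ∈ 𝒜 (p + q - 1)
  bracket_skew : ∀ (p q : ℤ), ∀ f ∈ 𝒜 p, ∀ g ∈ 𝒜 q,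
    bracket f g = -(((p - 1) * (q - 1)).negOnePow • bracket g f)
  jacobi : ∀ (p q : ℤ), ∀ f ∈ 𝒜 p, ∀ g ∈ 𝒜 q, ∀ h : V,
    bracket f (bracket g h) =
      bracket (bracket f g) h + ((p - 1) * (q - 1)).negOnePow • bracket g (bracket f h)
  leibniz : ∀ (p q : ℤ), ∀ f ∈ 𝒜 p, ∀ g ∈ 𝒜 q, ∀ h : V,
    bracket f (cup g h) = cup (bracket f g) h + ((p - 1) * q).negOnePow • cup g (bracket f h)

/-- A precalculus structure on the pair of graded `k`-modules `V = ⨁ p, 𝒜 p` and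
`W = ⨁ n, Ω n`: a Gerstenhaber algebra structure on `V`, together with a graded module structure
`i` on `W` over `(V, ∪)` and a graded Lie module structure `L` on `W` over the graded Lie algebra
`V` (with degrees shifted by one), related by `i_{[f, g]} = [i_f, L_g]`. -/
structure Precalculus (k : Type*) [CommRing k] {V : Type*} [AddCommGroup V] [Module k V]
    {W : Type*} [AddCommGroup W] [Module k W]
    (𝒜 : ℤ → Submodule k V) (Ω : ℤ → Submodule k W) extends GerstenhaberAlgebra k 𝒜 where
  /-- `W` is the direct sum of the homogeneous pieces. -/
  isInternal_module : DirectSum.IsInternal Ω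
  /-- `i f x = i_f x` -/
  i : V →ₗ[k] W →ₗ[k] W
  /-- `L f x = L_f x` -/
  L : V →ₗ[k] W →ₗ[k] W
  i_mem : ∀ (p n : ℤ), ∀ f ∈ 𝒜 p, ∀ x ∈ Ω n, i f x ∈ Ω (n - p)
  i_cup : ∀ (f g : V) (x : W), i (cup f g) x = i f (i g x)
  L_mem : ∀ (p n : ℤ), ∀ f ∈ 𝒜 p, ∀ x ∈ Ω n, L f x ∈ Ω (n - (p - 1))
  L_bracket : ∀ (p q : ℤ), ∀ f ∈ 𝒜 p, ∀ g ∈ 𝒜 q, ∀ x : W,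
    L (bracket f g) x = L f (L g x) - ((p - 1) * (q - 1)).negOnePow • L g (L f x)
  i_bracket : ∀ (p q : ℤ), ∀ f ∈ 𝒜 p, ∀ g ∈ 𝒜 q, ∀ x : W,
    i (bracket f g) x = i f (L g x) - (p * (q + 1)).negOnePow • L g (i f x)

/-- The `ℤ`-grading of `⨁ n : ℕ, X n`, with zero pieces in negative degrees. -/
def intGrading (k : Type*) [CommRing k] (X : ℕ → Type*) [∀ n, AddCommGroup (X n)]
    [∀ n, Module k (X n)] : ℤ → Submodule k (⨁ n, X n)
  | Int.ofNat n => LinearMap.range (DirectSum.lof k ℕ X n)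
  | Int.negSucc _ => ⊥

/-! ### Multiplicative hom-associative algebras -/

/-- A multiplicative hom-associative algebra structure `(A, μ, α)` on the `k`-module `A`. -/
structure HomAssocAlgebra (k A : Type*) [CommRing k] [AddCommGroup A] [Module k A] where
  /-- the product `μ` -/
  μ : A →ₗ[k] A →ₗ[k] A
  /-- the twisting map `α` -/
  α : A →ₗ[k] A
  hom_assoc : ∀ a b c : A, μ (μ a b) (α c) = μ (α a) (μ b c)
  multiplicative : ∀ a b : A, α (μ a b) = μ (α a) (α b)

namespace HomAssocAlgebra

variable {k A : Type*} [CommRing k] [AddCommGroup A] [Module k A] (H : HomAssocAlgebra k A)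

/-- The `k`-module of `k`-multilinear maps `A^n → A`, i.e. of linear maps `A^{⊗ n} → A`. -/
abbrev Multi (k A : Type*) [CommRing k] [AddCommGroup A] [Module k A] (n : ℕ) : Type _ :=
  MultilinearMap k (fun _ : Fin n => A) A

/-- The product as a multilinear map `(a₁, a₂) ↦ a₁ · a₂`. -/
def mulMulti : Multi k A 2 where
  toFun a := H.μ (a 0) (a 1)
  map_update_add' a i x y := by fin_cases i <;> simp
  map_update_smul' a i c x := by fin_cases i <;> simp

/-- For `f` with `p` arguments: the list with entries (positions counted from `0`)
`α^{p-1}(a_0), …, α^{p-1}(a_{i-1}), f(a_i, …, a_{i+p-1}), α^{p-1}(a_{i+p}), …, α^{p-1}(a_{N-1})`,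
which has length `M = N - p + 1`. -/
def insertAt {p N M : ℕ} (h : N + 1 = M + p) (f : Multi k A p) (i : Fin M) (a : Fin N → A) :
    Fin M → A := fun j =>
  if hlt : j.1 < i.1 then (H.α ^ (p - 1)) (a ⟨j.1, by omega⟩)
  else if heq : j.1 = i.1 then f (fun l => a ⟨i.1 + l.1, by omega⟩)
  else (H.α ^ (p - 1)) (a ⟨j.1 + p - 1, by omega⟩)

theorem insertAt_update {p N M : ℕ} (h : N + 1 = M + p) (f : Multi k A p) (i : Fin M)
    (a : Fin N → A) (m : Fin N) :
    ∃ (j : Fin M) (l : A →ₗ[k] A), ∀ x,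
      H.insertAt h f i (Function.update a m x) = Function.update (H.insertAt h f i a) j (l x) := by
  by_cases h1 : m.1 < i.1
  · refine ⟨⟨m.1, by omega⟩, H.α ^ (p - 1), fun x => ?_⟩
    funext j
    simp only [insertAt, Function.update_apply, Fin.ext_iff]
    split_ifs <;> first | rfl | omega | skip
    congr 1
    funext l
    rw [if_neg (by omega)]
  · by_cases h2 : m.1 < i.1 + p
    · refine ⟨i, f.toLinearMap (fun l => a ⟨i.1 + l.1, by omega⟩) ⟨m.1 - i.1, by omega⟩,
        fun x => ?_⟩
      funext j
      simp only [insertAt, Function.update_apply, Fin.ext_iff, MultilinearMap.toLinearMap_apply]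
      split_ifs <;> first | rfl | omega | skip
      congr 1
      funext l
      simp only [Function.update_apply, Fin.ext_iff]
      split_ifs <;> first | rfl | omega
    · refine ⟨⟨m.1 + 1 - p, by omega⟩, H.α ^ (p - 1), fun x => ?_⟩
      funext j
      simp only [insertAt, Function.update_apply, Fin.ext_iff]
      split_ifs <;> first | rfl | omega | skip
      congr 1
      funext l
      rw [if_neg (by omega)]

theorem insertAt_eq_update {p N M : ℕ} (h : N + 1 = M + p) (f : Multi k A p) (i : Fin M)
    (a : Fin N → A) :
    H.insertAt h f i a = Function.update (H.insertAt h 0 i a) i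
      (f (fun l => a ⟨i.1 + l.1, by omega⟩)) := by
  funext j
  simp only [insertAt, Function.update_apply, Fin.ext_iff]
  split_ifs <;> first | rfl | omega

/-- The multilinear map `a ↦ F (α^{p-1}(a_0), …, f(a_i, …, a_{i+p-1}), …, α^{p-1}(a_{N-1}))`. -/
def compAt {E : Type*} [AddCommGroup E] [Module k E] {p N M : ℕ} (h : N + 1 = M + p)
    (F : MultilinearMap k (fun _ : Fin M => A) E) (i : Fin M) (f : Multi k A p) :
    MultilinearMap k (fun _ : Fin N => A) E where
  toFun a := F (H.insertAt h f i a)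
  map_update_add' {inst} a m x y := by
    rw [Subsingleton.elim inst (instDecidableEqFin N)]
    obtain ⟨j, l, hl⟩ := H.insertAt_update h f i a m
    simp [hl]
  map_update_smul' {inst} a m c x := by
    rw [Subsingleton.elim inst (instDecidableEqFin N)]
    obtain ⟨j, l, hl⟩ := H.insertAt_update h f i a m
    simp [hl]

theorem compAt_add_right {E : Type*} [AddCommGroup E] [Module k E] {p N M : ℕ} (h : N + 1 = M + p)
    (F : MultilinearMap k (fun _ : Fin M => A) E) (i : Fin M) (f g : Multi k A p) :
    H.compAt h F i (f + g) = H.compAt h F i f + H.compAt h F i g := by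
  ext a
  simp only [compAt, _root_.add_apply, MultilinearMap.coe_mk]
  rw [H.insertAt_eq_update h (f + g), H.insertAt_eq_update h f, H.insertAt_eq_update h g]
  simp

theorem compAt_smul_right {E : Type*} [AddCommGroup E] [Module k E] {p N M : ℕ} (h : N + 1 = M + p)
    (F : MultilinearMap k (fun _ : Fin M => A) E) (i : Fin M) (c : k) (f : Multi k A p) :
    H.compAt h F i (c • f) = c • H.compAt h F i f := by
  ext a
  simp only [compAt, _root_.smul_apply, MultilinearMap.coe_mk]
  rw [H.insertAt_eq_update h (c • f), H.insertAt_eq_update h f]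
  simp

/-! ### Hochschild cohomology -/

/-- The Hochschild cochains `C^n_α(A)`: the multilinear `f : A^n → A` with
`α ∘ f = f ∘ α^{⊗ n}`, for `n ≥ 1`. The complex starts in degree `1`, so `C^0_α(A) = 0`. -/
def cochains (n : ℕ) : Submodule k (Multi k A n) where
  carrier := {f | (∀ a : Fin n → A, H.α (f a) = f (fun j => H.α (a j))) ∧ (n = 0 → f = 0)}
  add_mem' {f g} hf hg :=
    ⟨fun a => by simp [hf.1 a, hg.1 a], fun h => by rw [hf.2 h, hg.2 h, add_zero]⟩
  zero_mem' := ⟨fun a => by simp, fun _ => rfl⟩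
  smul_mem' c f hf := ⟨fun a => by simp [hf.1 a], fun h => by rw [hf.2 h, smul_zero]⟩

/-- The Hochschild coboundary
`(δ f)(a_1, …, a_{n+1}) = α^{n-1}(a_1) · f(a_2, …, a_{n+1})
  + (-1)^{n+1} f(a_1, …, a_n) · α^{n-1}(a_{n+1})
  + ∑_{i=1}^{n} (-1)^i f(α(a_1), …, α(a_{i-1}), a_i · a_{i+1}, α(a_{i+2}), …, α(a_{n+1}))`. -/
def delta (n : ℕ) : Multi k A n →ₗ[k] Multi k A (n + 1) where
  toFun f := H.compAt (by omega) H.mulMulti 1 f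
    + (-1 : k) ^ (n + 1) • H.compAt (by omega) H.mulMulti 0 f
    + ∑ i : Fin n, (-1 : k) ^ (i.1 + 1) • H.compAt (by omega) f i H.mulMulti
  map_add' f g := by
    have e : ∀ i : Fin n, H.compAt (N := n + 1) (by omega) (f + g) i H.mulMulti
        = H.compAt (by omega) f i H.mulMulti + H.compAt (by omega) g i H.mulMulti := fun i => rfl
    simp only [compAt_add_right, e, smul_add, Finset.sum_add_distrib]
    abel
  map_smul' c f := by
    have e : ∀ i : Fin n, H.compAt (N := n + 1) (by omega) (c • f) i H.mulMulti
        = c • H.compAt (by omega) f i H.mulMulti := fun i => rfl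
    simp only [compAt_smul_right, e, smul_add, Finset.smul_sum, RingHom.id_apply, smul_comm _ c]

/-- Hochschild `n`-cocycles. -/
def cocycles (n : ℕ) : Submodule k (Multi k A n) := H.cochains n ⊓ LinearMap.ker (H.delta n)

/-- Hochschild `n`-coboundaries. -/
def coboundaries : (n : ℕ) → Submodule k (Multi k A n)
  | 0 => ⊥
  | n + 1 => (H.cochains n).map (H.delta n)

/-- The Hochschild cohomology `H^n_α(A)`, which is zero for `n = 0`. -/
def Cohomology (n : ℕ) : Type _ := H.cocycles n ⧸ (H.coboundaries n).submoduleOf (H.cocycles n)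

instance (n : ℕ) : AddCommGroup (H.Cohomology n) :=
  inferInstanceAs (AddCommGroup (H.cocycles n ⧸ (H.coboundaries n).submoduleOf (H.cocycles n)))

instance (n : ℕ) : Module k (H.Cohomology n) :=
  inferInstanceAs (Module k (H.cocycles n ⧸ (H.coboundaries n).submoduleOf (H.cocycles n)))

/-- The class of a cocycle in `H^•_α(A) = ⨁ n, H^n_α(A)`. -/
def cohomologyClass {n : ℕ} (f : Multi k A n) (hf : f ∈ H.cocycles n) : ⨁ n, H.Cohomology n :=
  DirectSum.lof k ℕ H.Cohomology n
    (((H.coboundaries n).submoduleOf (H.cocycles n)).mkQ ⟨f, hf⟩)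

/-- The grading of `H^•_α(A)`. -/
abbrev cohomologyGrading : ℤ → Submodule k (⨁ n, H.Cohomology n) := intGrading k H.Cohomology

/-- The cup product `f ∪ g = (μ ∘₂ f) ∘₁ g`, that is,
`(f ∪ g)(a_1, …, a_{p+q}) = α^{p-1}(g(a_1, …, a_q)) · α^{q-1}(f(a_{q+1}, …, a_{p+q}))` for
cochains `f`, `g` of positive degree. -/
def cup {p q r : ℕ} (h : p + q = r) (f : Multi k A p) (g : Multi k A q) : Multi k A r :=
  H.compAt (by omega) (H.compAt (N := p + 1) (by omega) H.mulMulti 1 f) 0 g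

/-- The Gerstenhaber bracket `[f, g] = ∑_{i=1}^p (-1)^{(q-1)(i-1)} f ∘_i g
  - (-1)^{(p-1)(q-1)} ∑_{i=1}^q (-1)^{(p-1)(i-1)} g ∘_i f`, in degree `r = p + q - 1`. -/
def bracket {p q r : ℕ} (h : p + q = r + 1) (f : Multi k A p) (g : Multi k A q) : Multi k A r :=
  ∑ i : Fin p, (-1 : k) ^ ((q - 1) * i.1) • H.compAt (by omega) f i g
    - (-1 : k) ^ ((p - 1) * (q - 1)) •
      ∑ i : Fin q, (-1 : k) ^ ((p - 1) * i.1) • H.compAt (by omega) g i f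

/-! ### Hochschild homology -/

/-- The Hochschild chains `A ⊗ A^{⊗ n}`, with factors numbered `0, 1, …, n`. -/
abbrev Chains (k A : Type*) [CommRing k] [AddCommGroup A] [Module k A] (n : ℕ) : Type _ :=
  ⨂[k] _ : Fin (n + 1), A

/-- `f •_i x`, for `f` with `p` arguments and `x ∈ A ⊗ A^{⊗ n}`, in `A ⊗ A^{⊗ m}` with
`m = n - p + 1`: the linear map that sends `a_0 ⊗ ⋯ ⊗ a_n` to
`α^{p-1}(a_0) ⊗ ⋯ ⊗ α^{p-1}(a_{i-1}) ⊗ f(a_i, …, a_{i+p-1}) ⊗ α^{p-1}(a_{i+p}) ⊗ ⋯`. -/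
noncomputable def act {p n m : ℕ} (h : m + p = n + 1) (f : Multi k A p) (i : Fin (m + 1)) :
    Chains k A n →ₗ[k] Chains k A m :=
  PiTensorProduct.lift (H.compAt (by omega) (PiTensorProduct.tprod k) i f)

/-- The cyclic operator `a_0 ⊗ a_1 ⊗ ⋯ ⊗ a_n ↦ a_n ⊗ a_0 ⊗ ⋯ ⊗ a_{n-1}`. -/
noncomputable def cyc (k A : Type*) [CommRing k] [AddCommGroup A] [Module k A] (n : ℕ) :
    Chains k A n →ₗ[k] Chains k A n :=
  (PiTensorProduct.reindex k (fun _ : Fin (n + 1) => A) (finRotate (n + 1))).toLinearMap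

/-- The Hochschild boundary `A ⊗ A^{⊗ (n+1)} → A ⊗ A^{⊗ n}`, which sends
`a_0 ⊗ ⋯ ⊗ a_{n+1}` to `a_0 · a_1 ⊗ α(a_2) ⊗ ⋯ ⊗ α(a_{n+1})
  + ∑_{i=1}^{n} (-1)^i α(a_0) ⊗ ⋯ ⊗ a_i · a_{i+1} ⊗ ⋯ ⊗ α(a_{n+1})
  + (-1)^{n+1} a_{n+1} · a_0 ⊗ α(a_1) ⊗ ⋯ ⊗ α(a_n)`. -/
noncomputable def boundary (n : ℕ) : Chains k A (n + 1) →ₗ[k] Chains k A n :=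
  ∑ i : Fin (n + 1), (-1 : k) ^ i.1 • H.act (by omega) H.mulMulti i
    + (-1 : k) ^ (n + 1) • H.act (by omega) H.mulMulti 0 ∘ₗ cyc k A (n + 1)

/-- Hochschild `n`-cycles. -/
noncomputable def cycles : (n : ℕ) → Submodule k (Chains k A n)
  | 0 => ⊤
  | n + 1 => LinearMap.ker (H.boundary n)

/-- Hochschild `n`-boundaries. -/
noncomputable def boundaries (n : ℕ) : Submodule k (Chains k A n) :=
  LinearMap.range (H.boundary n)

/-- The Hochschild homology `H_n^α(A)`. -/
def Homology (n : ℕ) : Type _ := H.cycles n ⧸ (H.boundaries n).submoduleOf (H.cycles n)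

noncomputable instance (n : ℕ) : AddCommGroup (H.Homology n) :=
  inferInstanceAs (AddCommGroup (H.cycles n ⧸ (H.boundaries n).submoduleOf (H.cycles n)))

noncomputable instance (n : ℕ) : Module k (H.Homology n) :=
  inferInstanceAs (Module k (H.cycles n ⧸ (H.boundaries n).submoduleOf (H.cycles n)))

/-- The class of a cycle in `H_•^α(A) = ⨁ n, H_n^α(A)`. -/
noncomputable def homologyClass {n : ℕ} (x : Chains k A n) (hx : x ∈ H.cycles n) :
    ⨁ n, H.Homology n :=
  DirectSum.lof k ℕ H.Homology n
    (((H.boundaries n).submoduleOf (H.cycles n)).mkQ ⟨x, hx⟩)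

/-- The grading of `H_•^α(A)`. -/
noncomputable abbrev homologyGrading : ℤ → Submodule k (⨁ n, H.Homology n) :=
  intGrading k H.Homology

/-- The cap product `i_f x = (μ ∘₂ f) •_0 x`, that is,
`i_f (a_0 ⊗ ⋯ ⊗ a_n) = α^{p-1}(a_0) · f(a_1, …, a_p) ⊗ α^p(a_{p+1}) ⊗ ⋯ ⊗ α^p(a_n)` for `p ≥ 1`,
in degree `m = n - p`. -/
noncomputable def cap {p n m : ℕ} (h : m + p = n) (f : Multi k A p) :
    Chains k A n →ₗ[k] Chains k A m :=
  H.act (by omega) (H.compAt (N := p + 1) (by omega) H.mulMulti 1 f) 0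

/-- The Lie derivative `L_f x = ∑_{i=1}^{n-p+1} (-1)^{(p-1)(i-1)} f •_i x
  + ∑_{i=1}^{p} (-1)^{n(i-1)+p-1} f •_0 t^{i-1}(x)`, with `t` the cyclic operator, in degree
`m = n - p + 1` (the first sum is empty for `p = n + 1`). -/
noncomputable def lieDerivative {p n m : ℕ} (h : m + p = n + 1) (f : Multi k A p) :
    Chains k A n →ₗ[k] Chains k A m :=
  ∑ i : Fin m, (-1 : k) ^ ((p - 1) * i.1) • H.act h f i.succ
    + ∑ i : Fin p, (-1 : k) ^ (n * i.1 + (p - 1)) • H.act h f 0 ∘ₗ (cyc k A n) ^ i.1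

end HomAssocAlgebra

/-! Give a cochain with p + 1 arguments the degree p. The partial compositions twisted by powers of
α obey the two operad laws on α-equivariant cochains: disjoint insertions commute
(`plug_plug_of_lt`) and nested insertions associate (`plug_plug_add`). Signed sums of insertions are
Gerstenhaber's braces F{φ} (`circ`) and F{φ, ψ} (`brace`). Sorting the positions of the inserted
cochains yields their relations `circ_circ`, `circ_brace` and `brace_circ`. The outer F may take
values in any module, so the same relations apply to chains, with the tensor product as F.

Hom-associativity says μ{μ} = 0, the coboundary of φ is -[φ, μ], and the cup product is, up to sign,
a brace in μ. Thus δ² = 0, the Jacobi identity, associativity of the cup product and the derivation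
rules for δ hold for cochains. Graded commutativity and the Leibniz rule hold for cocycles up to
coboundaries, with homotopies φ{ψ} (`deltaSeq_circ`) and χ{φ, ψ} (`deltaSeq_brace`).

On chains the difficulty is that factor 0 is distinguished and that the operators wrap around it.
The remedy is to pass to the dual numbers A ⊕ Aε. `spreadOp` replaces a chain by the signed sum of
its rotations, with ε attached to the original factor 0. Conversely, a chain with exactly one ε that
is invariant under signed rotation is the spread of its component marked at 0 (`spreadOp_mixOp`).
Plain insertion sums, without cyclic terms, preserve this invariance (`cyc_circOp`). Hence
mark-preserving cochains of the dual algebra act on chains of A by `markedOp`, and brackets act as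
graded commutators (`markedOp_bracketSeq`). The boundary is the action of the product
(`boundary_eq`), L_f is up to sign the action of the ε-linear extension of f (`lieDerivative_eq`),
and i_f is the action of f ∪ e, where e is the Euler derivation a + bε ↦ bε (`cap_eq`).

The relations between d, L and i now follow from cochain identities of the dual algebra. In
particular the formula for i_[f,g] is the Leibniz rule for [g, f ∪ e]: the term with [g, e] vanishes
(`bracketSeq_eulerSeq`), and the coboundary of g{e, f} sends cycles to boundaries (`cap_bracket`).
Only i_{f ∪ g} = i_f i_g is checked directly, by hom-associativity (`cap_cup`). -/

namespace HomAssocAlgebra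

variable {k A E : Type*} [CommRing k] [AddCommGroup A] [Module k A] [AddCommGroup E] [Module k E]

/-! ### Multilinear maps as functions of infinite sequences -/

/-- A multilinear map in `n` variables as a function of the first `n` terms of a sequence. -/
def unc {n : ℕ} (f : MultilinearMap k (fun _ : Fin n => A) E) (s : ℕ → A) : E :=
  f fun j => s j

/-- A tuple extends to a sequence by zeros, so nothing is lost. Sequences avoid all casts between
`Fin n` for values of n that agree only propositionally. -/
theorem unc_injective {n : ℕ} :
    Function.Injective (unc : MultilinearMap k (fun _ : Fin n => A) E → (ℕ → A) → E) := by
  intro f g h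
  ext a
  have := congrFun h (fun j => if hj : j < n then a ⟨j, hj⟩ else 0)
  simpa [unc] using this

theorem unc_add {n : ℕ} (f g : MultilinearMap k (fun _ : Fin n => A) E) :
    unc (f + g) = unc f + unc g := rfl

theorem unc_sub {n : ℕ} (f g : MultilinearMap k (fun _ : Fin n => A) E) :
    unc (f - g) = unc f - unc g := rfl

theorem unc_zero {n : ℕ} : unc (0 : MultilinearMap k (fun _ : Fin n => A) E) = 0 := rfl

theorem unc_zsmul {n : ℕ} (c : ℤ) (f : MultilinearMap k (fun _ : Fin n => A) E) :
    unc (c • f) = c • unc f := by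
  funext s
  simp [unc]

theorem unc_sum {n : ℕ} {ι : Type*} (t : Finset ι)
    (f : ι → MultilinearMap k (fun _ : Fin n => A) E) :
    unc (∑ i ∈ t, f i) = ∑ i ∈ t, unc (f i) := by
  funext s
  simp [unc]

/-- Bridge between the signs in k of the definitions and the integer signs of the calculus with
sequences. -/
theorem neg_one_pow_smul_eq_zsmul (n : ℕ) (x : E) : (-1 : k) ^ n • x = (-1 : ℤ) ^ n • x := by
  rcases neg_one_pow_eq_or ℤ n with h | h <;> rcases Nat.even_or_odd n with h' | h' <;>
    simp [h'.neg_one_pow] at h ⊢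

/-- `F` is a multilinear function of the first `M` terms of a sequence. -/
def IsForm (k : Type*) [CommRing k] {A E : Type*} [AddCommGroup A] [Module k A]
    [AddCommGroup E] [Module k E] (M : ℕ) (F : (ℕ → A) → E) : Prop :=
  ∃ G : MultilinearMap k (fun _ : Fin M => A) E, unc G = F

theorem IsForm.add {M : ℕ} {F G : (ℕ → A) → E} (hF : IsForm k M F) (hG : IsForm k M G) :
    IsForm k M (F + G) := by
  obtain ⟨F, rfl⟩ := hF
  obtain ⟨G, rfl⟩ := hG
  exact ⟨F + G, rfl⟩

theorem IsForm.zsmul {M : ℕ} {F : (ℕ → A) → E} (c : ℤ) (hF : IsForm k M F) :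
    IsForm k M (c • F) := by
  obtain ⟨F, rfl⟩ := hF
  exact ⟨c • F, unc_zsmul c F⟩

theorem IsForm.zero {M : ℕ} : IsForm k M (0 : (ℕ → A) → E) := ⟨0, rfl⟩

theorem IsForm.sum {M : ℕ} {ι : Type*} {t : Finset ι} {F : ι → (ℕ → A) → E}
    (hF : ∀ i ∈ t, IsForm k M (F i)) : IsForm k M (∑ i ∈ t, F i) := by
  classical
  induction t using Finset.induction_on with
  | empty => simpa using IsForm.zero
  | insert a t ha ih =>
    rw [Finset.sum_insert ha]
    exact (hF a (by simp)).add (ih fun i hi => hF i (by simp [hi]))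

theorem IsForm.congr {M : ℕ} {F : (ℕ → A) → E} (hF : IsForm k M F) {s t : ℕ → A}
    (h : ∀ j < M, s j = t j) : F s = F t := by
  obtain ⟨F, rfl⟩ := hF
  exact congrArg F (funext fun j => h j j.2)

theorem IsForm.exists_linearMap {M : ℕ} {F : (ℕ → A) → E} (hF : IsForm k M F) {i : ℕ}
    (hi : i < M) (s : ℕ → A) : ∃ l : A →ₗ[k] E, ∀ x, F (Function.update s i x) = l x := by
  obtain ⟨F, rfl⟩ := hF
  refine ⟨F.toLinearMap (fun j => s j) ⟨i, hi⟩, fun x => ?_⟩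
  rw [MultilinearMap.toLinearMap_apply, unc]
  congr 1
  funext j
  simp [Function.update_apply, Fin.ext_iff]

/-! ### Partial compositions -/

variable (H : HomAssocAlgebra k A)

/-- The sequence `α^p(s_0), …, α^p(s_{i-1}), φ(s_i, …, s_{i+p}), α^p(s_{i+p+1}), …`. -/
def plug (p : ℕ) (φ : (ℕ → A) → A) (i : ℕ) (s : ℕ → A) : ℕ → A := fun j =>
  if j < i then (H.α ^ p) (s j)
  else if j = i then φ fun l => s (i + l)
  else (H.α ^ p) (s (j + p))

theorem plug_eq_update (p : ℕ) (φ : (ℕ → A) → A) (i : ℕ) (s : ℕ → A) :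
    H.plug p φ i s = Function.update (H.plug p 0 i s) i (φ fun l => s (i + l)) := by
  funext j
  rcases lt_trichotomy j i with h | rfl | h
  · simp [plug, h, h.ne]
  · simp [plug]
  · simp [plug, h.not_gt, h.ne']

variable {H}

/-- The inserted cochain affects the single term i of the sequence. All linearity in the inner
argument of insertions and braces comes from here. -/
theorem IsForm.exists_linearMap_plug {M : ℕ} {F : (ℕ → A) → E} (hF : IsForm k M F) {i : ℕ}
    (hi : i < M) (p : ℕ) (s : ℕ → A) :
    ∃ l : A →ₗ[k] E, ∀ φ, F (H.plug p φ i s) = l (φ fun l => s (i + l)) := by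
  obtain ⟨l, hl⟩ := hF.exists_linearMap hi (H.plug p 0 i s)
  exact ⟨l, fun φ => by rw [plug_eq_update, hl]⟩

/-- With arity written p + 1 the truncated subtractions in `insertAt` compute, so the two insertions
agree definitionally. -/
theorem unc_compAt {p N M : ℕ} (h : N + 1 = M + (p + 1))
    (F : MultilinearMap k (fun _ : Fin M => A) E) (i : Fin M) (f : Multi k A (p + 1)) :
    unc (H.compAt h F i f) = fun s => unc F (H.plug p (unc f) i s) := by
  funext s
  rfl

theorem IsForm.comp_plug {M p : ℕ} {F : (ℕ → A) → E} {φ : (ℕ → A) → A} (hF : IsForm k M F)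
    (hφ : IsForm k (p + 1) φ) {i : ℕ} (hi : i < M) :
    IsForm k (M + p) fun s => F (H.plug p φ i s) := by
  obtain ⟨F, rfl⟩ := hF
  obtain ⟨f, rfl⟩ := hφ
  exact ⟨H.compAt (by omega) F ⟨i, hi⟩ f, unc_compAt _ _ _ _⟩

variable (H)

/-- `φ` is a Hochschild cochain of arity `p + 1`, as a function of sequences. -/
structure IsCoch (p : ℕ) (φ : (ℕ → A) → A) : Prop where
  isForm : IsForm k (p + 1) φ
  map_α : ∀ s, H.α (φ s) = φ fun j => H.α (s j)

variable {H}

theorem isCoch_unc_iff {p : ℕ} {f : Multi k A (p + 1)} :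
    H.IsCoch p (unc f) ↔ f ∈ H.cochains (p + 1) := by
  constructor
  · rintro ⟨-, h⟩
    refine ⟨fun a => ?_, by simp⟩
    obtain ⟨s, rfl⟩ : ∃ s : ℕ → A, (fun j : Fin (p + 1) => s j) = a :=
      ⟨fun j => if hj : j < p + 1 then a ⟨j, hj⟩ else 0, funext fun j => dif_pos j.2⟩
    exact h s
  · rintro ⟨h, -⟩
    exact ⟨⟨f, rfl⟩, fun s => h _⟩

namespace IsCoch

variable {p q : ℕ} {φ ψ : (ℕ → A) → A}

theorem pow_apply (h : H.IsCoch p φ) (n : ℕ) (s : ℕ → A) :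
    (H.α ^ n) (φ s) = φ fun j => (H.α ^ n) (s j) := by
  induction n generalizing s with
  | zero => simp
  | succ n ih => simp only [pow_succ, Module.End.mul_apply, h.2, ih]

theorem add (h : H.IsCoch p φ) (h' : H.IsCoch p ψ) : H.IsCoch p (φ + ψ) :=
  ⟨h.1.add h'.1, fun s => by simp [h.2, h'.2]⟩

theorem zsmul (c : ℤ) (h : H.IsCoch p φ) : H.IsCoch p (c • φ) :=
  ⟨h.1.zsmul c, fun s => by simp [h.2]⟩

theorem neg (h : H.IsCoch p φ) : H.IsCoch p (-φ) := by
  simpa using h.zsmul (-1)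

theorem sub (h : H.IsCoch p φ) (h' : H.IsCoch p ψ) : H.IsCoch p (φ - ψ) := by
  rw [sub_eq_add_neg]
  exact h.add h'.neg

theorem sum {ι : Type*} {t : Finset ι} {F : ι → (ℕ → A) → A}
    (hF : ∀ i ∈ t, H.IsCoch p (F i)) : H.IsCoch p (∑ i ∈ t, F i) :=
  ⟨IsForm.sum fun i hi => (hF i hi).1, fun s => by
    simp only [Finset.sum_apply, map_sum]
    exact Finset.sum_congr rfl fun i hi => (hF i hi).2 s⟩

theorem comp_plug (h : H.IsCoch p φ) (h' : H.IsCoch q ψ) {i : ℕ} (hi : i ≤ p) :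
    H.IsCoch (p + q) fun s => φ (H.plug q ψ i s) := by
  refine ⟨?_, fun s => ?_⟩
  · have := h.1.comp_plug (H := H) h'.1 (Nat.lt_succ_of_le hi)
    rwa [Nat.add_right_comm] at this
  · rw [h.2]
    congr 1
    funext j
    simp only [plug]
    split_ifs
    · simp only [← Module.End.mul_apply, ← pow_succ, ← pow_succ']
    · exact h'.2 _
    · simp only [← Module.End.mul_apply, ← pow_succ, ← pow_succ']

end IsCoch

/-- Each inserted value is hit by the α-power of the other insertion, and equivariance carries that
power inside; this is why both maps must be cochains. The shift by q occurs because the q + 1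
arguments of ψ are still separate when φ is inserted first. -/
theorem plug_plug_of_lt {p q : ℕ} {φ ψ : (ℕ → A) → A} (hφ : H.IsCoch p φ) (hψ : H.IsCoch q ψ)
    {i j : ℕ} (hij : i < j) (s : ℕ → A) :
    H.plug p φ j (H.plug q ψ i s) = H.plug q ψ i (H.plug p φ (j + q) s) := by
  have e : ∀ x, (H.α ^ p) ((H.α ^ q) x) = (H.α ^ q) ((H.α ^ p) x) := fun x => by
    rw [← Module.End.mul_apply, ← Module.End.mul_apply, ← pow_add, ← pow_add, add_comm]
  funext m
  rcases lt_trichotomy m i with h | rfl | h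
  · rw [plug, if_pos (by omega), plug, if_pos h, plug, if_pos h, plug, if_pos (by omega), e]
  · rw [plug, if_pos (by omega), plug, if_neg (by omega), if_pos rfl, plug, if_neg (by omega),
      if_pos rfl, hψ.pow_apply]
    exact hψ.1.congr fun l hl => by rw [plug, if_pos (by omega)]
  · have h1 : H.plug q ψ i (H.plug p φ (j + q) s) m = (H.α ^ q) (H.plug p φ (j + q) s (m + q)) := by
      rw [plug, if_neg (by omega), if_neg (by omega)]
    rw [h1]
    rcases lt_trichotomy m j with h' | rfl | h'
    · rw [plug, if_pos h', plug, if_neg (by omega), if_neg (by omega), plug, if_pos (by omega), e]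
    · rw [plug, if_neg (by omega), if_pos rfl, plug, if_neg (by omega), if_pos rfl, hφ.pow_apply]
      congr 1
      funext l
      rw [plug, if_neg (by omega), if_neg (by omega)]
      congr 2
      omega
    · rw [plug, if_neg (by omega), if_neg (by omega), plug, if_neg (by omega), if_neg (by omega),
        plug, if_neg (by omega), if_neg (by omega), e, Nat.add_right_comm]

/-- For nested insertions the exponents of α merely add up, so no equivariance is needed. -/
theorem plug_plug_add {p q : ℕ} (φ ψ : (ℕ → A) → A) (j : ℕ) {l : ℕ} (hl : l ≤ p) (s : ℕ → A) :
    H.plug p φ j (H.plug q ψ (j + l) s) =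
      H.plug (p + q) (fun s => φ (H.plug q ψ l s)) j s := by
  have e : ∀ x, (H.α ^ p) ((H.α ^ q) x) = (H.α ^ (p + q)) x := fun x => by
    rw [← Module.End.mul_apply, ← pow_add]
  funext m
  rcases lt_trichotomy m j with h | rfl | h
  · rw [plug, if_pos h, plug, if_pos (by omega), plug, if_pos h, e]
  · rw [plug, if_neg (by omega), if_pos rfl, plug, if_neg (by omega), if_pos rfl]
    congr 1
    funext n
    simp only [plug, add_lt_add_iff_left, add_right_inj, add_assoc]
  · rw [plug, if_neg (by omega), if_neg (by omega), plug, if_neg (by omega), if_neg (by omega),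
      plug, if_neg (by omega), if_neg (by omega), e, add_assoc]

end HomAssocAlgebra

namespace HomAssocAlgebra

variable {k A E : Type*} [CommRing k] [AddCommGroup A] [Module k A] [AddCommGroup E] [Module k E]

/-! ### Sums over intervals -/

/-- The three ranges are the positions left of, inside and right of a cochain with p + 1 arguments
inserted in slot j. -/
theorem sum_Ico_split {a j M : ℕ} (p : ℕ) (ha : a ≤ j) (h : j < M) (f : ℕ → E) :
    ∑ i ∈ Finset.Ico a (M + p), f i =
      ∑ i ∈ Finset.Ico a j, f i + ∑ l ∈ Finset.range (p + 1), f (j + l) +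
        ∑ i ∈ Finset.Ico (j + 1) M, f (i + p) := by
  rw [← Finset.sum_Ico_consecutive f ha (show j ≤ M + p by omega),
    ← Finset.sum_Ico_consecutive f (show j ≤ j + 1 + p by omega) (show j + 1 + p ≤ M + p by omega),
    Finset.sum_Ico_add' f (j + 1) M p, ← add_assoc]
  congr 2
  rw [Finset.sum_Ico_eq_sum_range]
  congr 2
  omega

theorem sum_range_split {j M : ℕ} (p : ℕ) (h : j < M) (f : ℕ → E) :
    ∑ i ∈ Finset.range (M + p), f i =
      ∑ i ∈ Finset.range j, f i + ∑ l ∈ Finset.range (p + 1), f (j + l) +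
        ∑ i ∈ Finset.Ico (j + 1) M, f (i + p) := by
  simp only [Finset.range_eq_Ico, sum_Ico_split p (Nat.zero_le j) h]

theorem sum_range_Ico_comm (M : ℕ) (f : ℕ → ℕ → E) :
    ∑ j ∈ Finset.range M, ∑ i ∈ Finset.Ico (j + 1) M, f j i =
      ∑ i ∈ Finset.range M, ∑ j ∈ Finset.range i, f j i :=
  Finset.sum_comm' fun j i => by simp only [Finset.mem_range, Finset.mem_Ico]; omega

/-! ### Insertions and braces -/

variable (H : HomAssocAlgebra k A)

/-- The signed sum of all insertions of `φ`, of degree `p`, into `F`, with `M` arguments. -/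
def circ (M : ℕ) (F : (ℕ → A) → E) (p : ℕ) (φ : (ℕ → A) → A) (s : ℕ → A) : E :=
  ∑ i ∈ Finset.range M, (-1 : ℤ) ^ (p * i) • F (H.plug p φ i s)

/-- The signed sum of all insertions of `φ` and `ψ`, in this order, into `F`. -/
def brace (M : ℕ) (F : (ℕ → A) → E) (p : ℕ) (φ : (ℕ → A) → A) (q : ℕ) (ψ : (ℕ → A) → A)
    (s : ℕ → A) : E :=
  ∑ j' ∈ Finset.range M, ∑ j ∈ Finset.range j',
    (-1 : ℤ) ^ (p * j + q * j') • F (H.plug q ψ j' (H.plug p φ j s))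

/-- The signed sum of all insertions of `φ`, `ψ` and `χ`, in this order, into `F`. -/
def brace₃ (M : ℕ) (F : (ℕ → A) → E) (p : ℕ) (φ : (ℕ → A) → A) (q : ℕ) (ψ : (ℕ → A) → A)
    (r : ℕ) (χ : (ℕ → A) → A) (s : ℕ → A) : E :=
  ∑ l ∈ Finset.range M, ∑ j' ∈ Finset.range l, ∑ j ∈ Finset.range j',
    (-1 : ℤ) ^ (p * j + q * j' + r * l) •
      F (H.plug r χ l (H.plug q ψ j' (H.plug p φ j s)))

variable {H} {M p q r : ℕ} {F : (ℕ → A) → E} {φ ψ χ : (ℕ → A) → A}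

theorem IsForm.apply_plug_circ (hF : IsForm k M F) {j : ℕ} (hj : j < M) (φ ψ : (ℕ → A) → A)
    (s : ℕ → A) :
    F (H.plug (p + q) (H.circ (p + 1) φ q ψ) j s) =
      ∑ l ∈ Finset.range (p + 1),
        (-1 : ℤ) ^ (q * l) • F (H.plug p φ j (H.plug q ψ (j + l) s)) := by
  obtain ⟨L, hL⟩ := hF.exists_linearMap_plug (H := H) hj (p + q) s
  rw [hL, circ, map_sum]
  refine Finset.sum_congr rfl fun l hl => ?_
  rw [map_zsmul, plug_plug_add φ ψ j (Nat.lt_succ_iff.1 (Finset.mem_range.1 hl)), hL]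

theorem IsForm.apply_plug_brace (hF : IsForm k M F) {j : ℕ} (hj : j < M) (φ ψ χ : (ℕ → A) → A)
    (s : ℕ → A) :
    F (H.plug (r + p + q) (H.brace (r + 1) χ p φ q ψ) j s) =
      ∑ l' ∈ Finset.range (r + 1), ∑ l ∈ Finset.range l', (-1 : ℤ) ^ (p * l + q * l') •
        F (H.plug r χ j (H.plug q ψ (j + l') (H.plug p φ (j + l) s))) := by
  obtain ⟨L, hL⟩ := hF.exists_linearMap_plug (H := H) hj (r + q + p) s
  rw [Nat.add_right_comm, hL, brace, map_sum]
  refine Finset.sum_congr rfl fun l' hl' => ?_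
  rw [map_sum]
  refine Finset.sum_congr rfl fun l hl => ?_
  rw [Finset.mem_range] at hl hl'
  rw [map_zsmul, plug_plug_add χ ψ j (by omega), plug_plug_add _ φ j (by omega), hL]

/-- The pre-Lie relation. ψ lands inside φ, left of it or right of it; in the last case moving ψ
past φ costs (-1)^(pq). -/
theorem circ_circ (hF : IsForm k M F) (hφ : H.IsCoch p φ) (hψ : H.IsCoch q ψ) :
    H.circ (M + p) (H.circ M F p φ) q ψ =
      H.circ M F (p + q) (H.circ (p + 1) φ q ψ) + H.brace M F q ψ p φ +
        (-1 : ℤ) ^ (p * q) • H.brace M F p φ q ψ := by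
  funext s
  simp only [circ.eq_1 H (M + p), circ.eq_1 H M, Finset.smul_sum, smul_smul]
  rw [Finset.sum_comm]
  simp only [Pi.add_apply, Pi.smul_apply, brace]
  rw [← sum_range_Ico_comm M (fun j i => (-1 : ℤ) ^ (p * j + q * i) • _), Finset.smul_sum]
  simp only [circ.eq_1 H M, ← Finset.sum_add_distrib]
  refine Finset.sum_congr rfl fun j hj => ?_
  rw [Finset.mem_range] at hj
  rw [sum_range_split p hj, hF.apply_plug_circ hj, add_comm (∑ i ∈ Finset.range j, _),
    Finset.smul_sum, Finset.smul_sum]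
  congr 1
  congr 1
  · refine Finset.sum_congr rfl fun l _ => ?_
    rw [smul_smul]
    congr 1
    ring
  · refine Finset.sum_congr rfl fun i _ => ?_
    congr 1
    ring
  · refine Finset.sum_congr rfl fun i hi => ?_
    rw [Finset.mem_Ico] at hi
    rw [plug_plug_of_lt hψ hφ (by omega), smul_smul]
    congr 1
    ring

/-- The five terms are the places for χ: before φ, inside φ, between φ and ψ, inside ψ, after ψ. The
sign records the cochains that χ has to pass. -/
theorem circ_brace (hF : IsForm k M F) (hφ : H.IsCoch p φ) (hψ : H.IsCoch q ψ)
    (hχ : H.IsCoch r χ) :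
    H.circ (M + p + q) (H.brace M F p φ q ψ) r χ =
      H.brace₃ M F r χ p φ q ψ + H.brace M F (p + r) (H.circ (p + 1) φ r χ) q ψ
        + (-1 : ℤ) ^ (r * p) • H.brace₃ M F p φ r χ q ψ
        + (-1 : ℤ) ^ (r * p) • H.brace M F p φ (q + r) (H.circ (q + 1) ψ r χ)
        + (-1 : ℤ) ^ (r * p + r * q) • H.brace₃ M F p φ q ψ r χ := by
  funext s
  simp only [Pi.add_apply, Pi.smul_apply]
  -- `e5` and `e3` reorder the triple sums so that the slots of φ and ψ are outermost, as they are
  -- on the left side; then the slots can be fixed and only the position of χ varies.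
  have e5 : H.brace₃ M F p φ q ψ r χ s =
      ∑ j' ∈ Finset.range M, ∑ j ∈ Finset.range j', ∑ i ∈ Finset.Ico (j' + 1) M,
        (-1 : ℤ) ^ (p * j + q * j' + r * i) •
          F (H.plug r χ i (H.plug q ψ j' (H.plug p φ j s))) := by
    rw [brace₃, ← sum_range_Ico_comm M]
    exact Finset.sum_congr rfl fun j' _ => Finset.sum_comm
  have e3 : H.brace₃ M F p φ r χ q ψ s =
      ∑ j' ∈ Finset.range M, ∑ j ∈ Finset.range j', ∑ i ∈ Finset.Ico (j + 1) j',
        (-1 : ℤ) ^ (p * j + r * i + q * j') •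
          F (H.plug q ψ j' (H.plug r χ i (H.plug p φ j s))) := by
    rw [brace₃]
    exact Finset.sum_congr rfl fun j' _ => (sum_range_Ico_comm j' _).symm
  rw [e3, e5]
  simp only [circ.eq_1 H (M + p + q), brace, brace₃, Finset.smul_sum, smul_smul]
  rw [Finset.sum_comm]
  simp only [← Finset.sum_add_distrib]
  refine Finset.sum_congr rfl fun j' hj' => ?_
  rw [Finset.sum_comm]
  refine Finset.sum_congr rfl fun j hj => ?_
  rw [Finset.mem_range] at hj hj'
  rw [Nat.add_right_comm, sum_range_split p (show j < M + q by omega),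
    sum_Ico_split q (show j + 1 ≤ j' by omega) hj',
    (hF.comp_plug hψ.1 hj').apply_plug_circ (by omega), hF.apply_plug_circ hj',
    ← add_assoc, ← add_assoc, Finset.smul_sum, Finset.smul_sum]
  congr 1
  congr 1
  congr 1
  congr 1
  · refine Finset.sum_congr rfl fun i _ => ?_
    congr 1
    ring
  · refine Finset.sum_congr rfl fun l _ => ?_
    rw [smul_smul]
    congr 1
    ring
  · refine Finset.sum_congr rfl fun i hi => ?_
    rw [Finset.mem_Ico] at hi
    rw [plug_plug_of_lt hχ hφ (by omega)]
    congr 1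
    ring
  · refine Finset.sum_congr rfl fun l _ => ?_
    rw [smul_smul, plug_plug_of_lt hχ hφ (by omega)]
    congr 1
    ring
  · refine Finset.sum_congr rfl fun i hi => ?_
    rw [Finset.mem_Ico] at hi
    rw [plug_plug_of_lt hχ hψ (by omega), plug_plug_of_lt hχ hφ (by omega)]
    congr 1
    ring

/-- Now χ sits in F first and each of φ, ψ falls left of, inside or right of it. As φ precedes ψ,
six of the nine combinations remain; both inside gives χ{φ, ψ}. -/
theorem brace_circ (hF : IsForm k M F) (hφ : H.IsCoch p φ) (hψ : H.IsCoch q ψ)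
    (hχ : H.IsCoch r χ) :
    H.brace (M + r) (H.circ M F r χ) p φ q ψ =
      H.brace₃ M F p φ q ψ r χ + H.brace M F p φ (r + q) (H.circ (r + 1) χ q ψ)
        + H.circ M F (r + p + q) (H.brace (r + 1) χ p φ q ψ)
        + (-1 : ℤ) ^ (q * r) • H.brace₃ M F p φ r χ q ψ
        + (-1 : ℤ) ^ (q * r) • H.brace M F (r + p) (H.circ (r + 1) χ p φ) q ψ
        + (-1 : ℤ) ^ (p * r + q * r) • H.brace₃ M F r χ p φ q ψ := by
  funext s
  simp only [Pi.add_apply, Pi.smul_apply]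
  -- `e4`, `e5` and `e6` make the slot of χ the outermost summation variable.
  have e4 : H.brace₃ M F p φ r χ q ψ s =
      ∑ i ∈ Finset.range M, ∑ j' ∈ Finset.Ico (i + 1) M, ∑ j ∈ Finset.range i,
        (-1 : ℤ) ^ (p * j + r * i + q * j') •
          F (H.plug q ψ j' (H.plug r χ i (H.plug p φ j s))) :=
    (sum_range_Ico_comm M _).symm
  have e5 : H.brace M F (r + p) (H.circ (r + 1) χ p φ) q ψ s =
      ∑ i ∈ Finset.range M, ∑ j' ∈ Finset.Ico (i + 1) M, (-1 : ℤ) ^ ((r + p) * i + q * j') •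
        F (H.plug q ψ j' (H.plug (r + p) (H.circ (r + 1) χ p φ) i s)) :=
    (sum_range_Ico_comm M _).symm
  have e6 : H.brace₃ M F r χ p φ q ψ s =
      ∑ i ∈ Finset.range M, ∑ j' ∈ Finset.Ico (i + 1) M, ∑ j ∈ Finset.Ico (i + 1) j',
        (-1 : ℤ) ^ (r * i + p * j + q * j') •
          F (H.plug q ψ j' (H.plug p φ j (H.plug r χ i s))) := by
    rw [brace₃, sum_range_Ico_comm M]
    exact Finset.sum_congr rfl fun j' _ => (sum_range_Ico_comm j' _).symm
  rw [e4, e5, e6]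
  simp only [brace.eq_1 H (M + r), brace.eq_1 H M, brace₃, circ.eq_1 H M, Finset.smul_sum,
    smul_smul]
  have e0 : ∀ f : ℕ → ℕ → ℕ → E,
      ∑ j' ∈ Finset.range (M + r), ∑ j ∈ Finset.range j', ∑ i ∈ Finset.range M, f j' j i =
        ∑ i ∈ Finset.range M, ∑ j' ∈ Finset.range (M + r), ∑ j ∈ Finset.range j', f j' j i := by
    intro f
    rw [Finset.sum_comm (s := Finset.range M)]
    exact Finset.sum_congr rfl fun j' _ => Finset.sum_comm
  rw [e0]
  simp only [← Finset.sum_add_distrib]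
  refine Finset.sum_congr rfl fun i hi => ?_
  rw [Finset.mem_range] at hi
  rw [sum_range_split r hi]
  have e1 : ∀ f : ℕ → ℕ → E,
      ∑ j' ∈ Finset.Ico (i + 1) M, ∑ j ∈ Finset.range (j' + r), f j' j =
        ∑ j' ∈ Finset.Ico (i + 1) M, ∑ j ∈ Finset.range i, f j' j +
        ∑ j' ∈ Finset.Ico (i + 1) M, ∑ l ∈ Finset.range (r + 1), f j' (i + l) +
        ∑ j' ∈ Finset.Ico (i + 1) M, ∑ j ∈ Finset.Ico (i + 1) j', f j' (j + r) := by
    intro f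
    simp only [← Finset.sum_add_distrib]
    refine Finset.sum_congr rfl fun j' hj' => ?_
    rw [Finset.mem_Ico] at hj'
    exact sum_range_split r (by omega) _
  have e2 : ∀ f : ℕ → ℕ → E,
      ∑ l ∈ Finset.range (r + 1), ∑ j ∈ Finset.range (i + l), f l j =
        ∑ l ∈ Finset.range (r + 1), ∑ j ∈ Finset.range i, f l j +
        ∑ l ∈ Finset.range (r + 1), ∑ j ∈ Finset.range l, f l (i + j) := by
    intro f
    simp only [← Finset.sum_add_distrib]
    exact Finset.sum_congr rfl fun l _ => Finset.sum_range_add _ _ _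
  rw [e1, e2]
  simp only [Finset.sum_add_distrib]
  rw [← add_assoc, ← add_assoc, ← add_assoc]
  refine congr_arg₂ _ (congr_arg₂ _ (congr_arg₂ _ (congr_arg₂ _ (congr_arg₂ _ ?_ ?_) ?_) ?_) ?_) ?_
  · refine Finset.sum_congr rfl fun j' _ => Finset.sum_congr rfl fun j _ => ?_
    congr 1
    ring
  · rw [Finset.sum_comm]
    refine Finset.sum_congr rfl fun j hj => ?_
    rw [hF.apply_plug_circ hi, Finset.smul_sum]
    refine Finset.sum_congr rfl fun l hl => ?_
    rw [smul_smul]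
    congr 1
    ring
  · rw [hF.apply_plug_brace hi, Finset.smul_sum]
    refine Finset.sum_congr rfl fun l' _ => ?_
    rw [Finset.smul_sum]
    refine Finset.sum_congr rfl fun l _ => ?_
    rw [smul_smul]
    congr 1
    ring
  · refine Finset.sum_congr rfl fun j' hj' => Finset.sum_congr rfl fun j _ => ?_
    rw [Finset.mem_Ico] at hj'
    rw [← plug_plug_of_lt hψ hχ (by omega)]
    congr 1
    ring
  · refine Finset.sum_congr rfl fun j' hj' => ?_
    rw [Finset.mem_Ico] at hj'
    rw [(hF.comp_plug hψ.1 hj'.2).apply_plug_circ (by omega), Finset.smul_sum]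
    refine Finset.sum_congr rfl fun l _ => ?_
    rw [smul_smul, ← plug_plug_of_lt hψ hχ (by omega)]
    congr 1
    ring
  · refine Finset.sum_congr rfl fun j' hj' => Finset.sum_congr rfl fun j hj => ?_
    rw [Finset.mem_Ico] at hj' hj
    rw [← plug_plug_of_lt hψ hχ (by omega), ← plug_plug_of_lt hφ hχ (by omega)]
    congr 1
    ring

end HomAssocAlgebra

namespace HomAssocAlgebra

section left

/-! ### Linearity of insertions and braces -/

variable {k A E : Type*} [CommRing k] [AddCommGroup A] [Module k A] [AddCommGroup E]
variable (H : HomAssocAlgebra k A) (M p q : ℕ) (F G : (ℕ → A) → E) (c : ℤ) (φ ψ : (ℕ → A) → A)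

theorem circ_add_left : H.circ M (F + G) p φ = H.circ M F p φ + H.circ M G p φ := by
  funext s
  simp [circ, smul_add, Finset.sum_add_distrib]

theorem circ_zsmul_left : H.circ M (c • F) p φ = c • H.circ M F p φ := by
  funext s
  simp [circ, Finset.smul_sum, smul_comm c]

theorem circ_zero_left : H.circ M (0 : (ℕ → A) → E) p φ = 0 := by
  funext s
  simp [circ]

theorem circ_neg_left : H.circ M (-F) p φ = -H.circ M F p φ := by
  simpa using H.circ_zsmul_left M p F (-1) φ

theorem circ_sub_left : H.circ M (F - G) p φ = H.circ M F p φ - H.circ M G p φ := by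
  rw [sub_eq_add_neg, circ_add_left, circ_neg_left, sub_eq_add_neg]

theorem brace_zsmul_left : H.brace M (c • F) p φ q ψ = c • H.brace M F p φ q ψ := by
  funext s
  simp [brace, Finset.smul_sum, smul_comm c]

theorem brace_zero_left : H.brace M (0 : (ℕ → A) → E) p φ q ψ = 0 := by
  funext s
  simp [brace]

end left

variable {k A E : Type*} [CommRing k] [AddCommGroup A] [Module k A] [AddCommGroup E] [Module k E]
variable {H : HomAssocAlgebra k A} {M p q r : ℕ} {F : (ℕ → A) → E} {φ φ' ψ χ : (ℕ → A) → A}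

namespace IsForm

theorem circ_add (hF : IsForm k M F) (φ φ' : (ℕ → A) → A) :
    H.circ M F p (φ + φ') = H.circ M F p φ + H.circ M F p φ' := by
  funext s
  simp only [HomAssocAlgebra.circ, Pi.add_apply, ← Finset.sum_add_distrib]
  refine Finset.sum_congr rfl fun i hi => ?_
  obtain ⟨l, hl⟩ := hF.exists_linearMap_plug (H := H) (Finset.mem_range.1 hi) p s
  simp [hl]

theorem circ_zsmul (hF : IsForm k M F) (c : ℤ) (φ : (ℕ → A) → A) :
    H.circ M F p (c • φ) = c • H.circ M F p φ := by
  funext s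
  simp only [HomAssocAlgebra.circ, Pi.smul_apply, Finset.smul_sum]
  refine Finset.sum_congr rfl fun i hi => ?_
  obtain ⟨l, hl⟩ := hF.exists_linearMap_plug (H := H) (Finset.mem_range.1 hi) p s
  rw [hl, hl, Pi.smul_apply, map_zsmul, smul_comm]

theorem circ_zero (hF : IsForm k M F) : H.circ M F p 0 = 0 := by
  simpa using hF.circ_zsmul (H := H) (p := p) 0 0

theorem circ_neg (hF : IsForm k M F) (φ : (ℕ → A) → A) :
    H.circ M F p (-φ) = -H.circ M F p φ := by
  simpa using hF.circ_zsmul (H := H) (p := p) (-1) φ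

theorem circ_sub (hF : IsForm k M F) (φ φ' : (ℕ → A) → A) :
    H.circ M F p (φ - φ') = H.circ M F p φ - H.circ M F p φ' := by
  rw [sub_eq_add_neg, hF.circ_add, hF.circ_neg, sub_eq_add_neg]

theorem brace_zsmul_fst (hF : IsForm k M F) (hψ : IsForm k (q + 1) ψ) (c : ℤ)
    (φ : (ℕ → A) → A) : H.brace M F p (c • φ) q ψ = c • H.brace M F p φ q ψ := by
  funext s
  simp only [brace, Pi.smul_apply, Finset.smul_sum]
  refine Finset.sum_congr rfl fun i hi => Finset.sum_congr rfl fun j hj => ?_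
  rw [Finset.mem_range] at hi hj
  obtain ⟨l, hl⟩ := (hF.comp_plug (H := H) hψ hi).exists_linearMap_plug (H := H)
    (show j < M + q by omega) p s
  rw [hl, hl, Pi.smul_apply, map_zsmul, smul_comm]

theorem brace_zsmul_snd (hF : IsForm k M F) (c : ℤ) (ψ : (ℕ → A) → A) :
    H.brace M F p φ q (c • ψ) = c • H.brace M F p φ q ψ := by
  funext s
  simp only [brace, Pi.smul_apply, Finset.smul_sum]
  refine Finset.sum_congr rfl fun i hi => Finset.sum_congr rfl fun j hj => ?_
  rw [Finset.mem_range] at hi hj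
  obtain ⟨l, hl⟩ := hF.exists_linearMap_plug (H := H) hi q (H.plug p φ j s)
  rw [hl, hl, Pi.smul_apply, map_zsmul, smul_comm]

end IsForm

theorem sum_fun_apply {X Y ι : Type*} [AddCommMonoid Y] (t : Finset ι) (f : ι → X → Y) :
    (fun s => ∑ i ∈ t, f i s) = ∑ i ∈ t, f i := by
  funext s
  simp

namespace IsCoch

theorem circ (hφ : H.IsCoch p φ) (hψ : H.IsCoch q ψ) :
    H.IsCoch (p + q) (H.circ (p + 1) φ q ψ) := by
  unfold HomAssocAlgebra.circ
  rw [sum_fun_apply]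
  exact IsCoch.sum fun i hi =>
    (hφ.comp_plug hψ (Nat.lt_succ_iff.1 (Finset.mem_range.1 hi))).zsmul _

theorem brace (hχ : H.IsCoch r χ) (hφ : H.IsCoch p φ) (hψ : H.IsCoch q ψ) :
    H.IsCoch (r + p + q) (H.brace (r + 1) χ p φ q ψ) := by
  unfold HomAssocAlgebra.brace
  rw [sum_fun_apply]
  refine IsCoch.sum fun i hi => ?_
  rw [sum_fun_apply]
  refine IsCoch.sum fun j hj => ?_
  rw [Finset.mem_range] at hi hj
  rw [Nat.add_right_comm]
  exact ((hχ.comp_plug hψ (show i ≤ r by omega)).comp_plug hφ (by omega)).zsmul _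

end IsCoch

/-! ### Product, bracket, coboundary -/

variable (H)

/-- The product as a function of sequences. -/
def mulSeq : (ℕ → A) → A := unc H.mulMulti

/-- The cup product of `φ`, of degree `p`, and `ψ`, of degree `q`. -/
def cupSeq (p : ℕ) (φ : (ℕ → A) → A) (q : ℕ) (ψ : (ℕ → A) → A) (s : ℕ → A) : A :=
  H.mulSeq (H.plug p φ 1 (H.plug q ψ 0 s))

/-- The Gerstenhaber bracket of `φ`, of degree `p`, and `ψ`, of degree `q`. -/
def bracketSeq (p : ℕ) (φ : (ℕ → A) → A) (q : ℕ) (ψ : (ℕ → A) → A) : (ℕ → A) → A :=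
  H.circ (p + 1) φ q ψ - (-1 : ℤ) ^ (p * q) • H.circ (q + 1) ψ p φ

/-- The Hochschild coboundary of `φ`, of degree `p`. -/
def deltaSeq (p : ℕ) (φ : (ℕ → A) → A) : (ℕ → A) → A :=
  (-1 : ℤ) ^ p • H.circ 2 H.mulSeq p φ - H.circ (p + 1) φ 1 H.mulSeq

theorem mulSeq_apply (s : ℕ → A) : H.mulSeq s = H.μ (s 0) (s 1) := rfl

theorem mulSeq_isCoch : H.IsCoch 1 H.mulSeq :=
  ⟨⟨H.mulMulti, rfl⟩, fun _ => H.multiplicative _ _⟩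

theorem cupSeq_apply (s : ℕ → A) :
    H.cupSeq p φ q ψ s = H.μ ((H.α ^ p) (ψ s)) (φ fun l => (H.α ^ q) (s (1 + l + q))) := by
  simp [cupSeq, mulSeq_apply, plug]

/-- Two slots leave one ordered placement: φ in slot 0 and ψ in slot 1, the latter giving the sign.
-/
theorem brace_mulSeq : H.brace 2 H.mulSeq p φ q ψ = (-1 : ℤ) ^ q • H.cupSeq q ψ p φ := by
  funext s
  simp [brace, Finset.sum_range_succ, cupSeq]

theorem brace₃_mulSeq : H.brace₃ 2 H.mulSeq p φ q ψ r χ = 0 := by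
  funext s
  simp [brace₃, Finset.sum_range_succ]

/-- The two placements are the two sides of hom-associativity with opposite signs. -/
theorem circ_mulSeq_mulSeq : H.circ 2 H.mulSeq 1 H.mulSeq = 0 := by
  funext s
  simp [circ, Finset.sum_range_succ, mulSeq_apply, plug, H.hom_assoc]

variable {H}

theorem IsCoch.deltaSeq (hφ : H.IsCoch p φ) : H.IsCoch (p + 1) (H.deltaSeq p φ) := by
  have := H.mulSeq_isCoch.circ hφ
  rw [add_comm] at this
  exact (this.zsmul _).sub (hφ.circ H.mulSeq_isCoch)

theorem IsCoch.cupSeq (hφ : H.IsCoch p φ) (hψ : H.IsCoch q ψ) :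
    H.IsCoch (p + q + 1) (H.cupSeq p φ q ψ) := by
  have := ((H.mulSeq_isCoch.comp_plug hφ le_rfl).comp_plug hψ (Nat.zero_le _))
  rwa [show 1 + p + q = p + q + 1 by omega] at this

theorem IsCoch.bracketSeq (hφ : H.IsCoch p φ) (hψ : H.IsCoch q ψ) :
    H.IsCoch (p + q) (H.bracketSeq p φ q ψ) := by
  have := hψ.circ hφ
  rw [add_comm] at this
  exact (hφ.circ hψ).sub (this.zsmul _)

theorem cupSeq_add_left (φ φ' ψ : (ℕ → A) → A) :
    H.cupSeq p (φ + φ') q ψ = H.cupSeq p φ q ψ + H.cupSeq p φ' q ψ := by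
  funext s
  simp [cupSeq_apply]

theorem cupSeq_add_right (φ ψ ψ' : (ℕ → A) → A) :
    H.cupSeq p φ q (ψ + ψ') = H.cupSeq p φ q ψ + H.cupSeq p φ q ψ' := by
  funext s
  simp [cupSeq_apply]

theorem cupSeq_zsmul_left (c : ℤ) (φ ψ : (ℕ → A) → A) :
    H.cupSeq p (c • φ) q ψ = c • H.cupSeq p φ q ψ := by
  funext s
  simp [cupSeq_apply]

theorem cupSeq_zsmul_right (c : ℤ) (φ ψ : (ℕ → A) → A) :
    H.cupSeq p φ q (c • ψ) = c • H.cupSeq p φ q ψ := by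
  funext s
  simp [cupSeq_apply]

theorem cupSeq_neg_left (φ ψ : (ℕ → A) → A) :
    H.cupSeq p (-φ) q ψ = -H.cupSeq p φ q ψ := by
  simpa using cupSeq_zsmul_left (H := H) (-1) φ ψ

theorem cupSeq_neg_right (φ ψ : (ℕ → A) → A) :
    H.cupSeq p φ q (-ψ) = -H.cupSeq p φ q ψ := by
  simpa using cupSeq_zsmul_right (H := H) (-1) φ ψ

theorem cupSeq_sub_left (φ φ' ψ : (ℕ → A) → A) :
    H.cupSeq p (φ - φ') q ψ = H.cupSeq p φ q ψ - H.cupSeq p φ' q ψ := by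
  rw [sub_eq_add_neg, cupSeq_add_left, cupSeq_neg_left, sub_eq_add_neg]

theorem cupSeq_sub_right (φ ψ ψ' : (ℕ → A) → A) :
    H.cupSeq p φ q (ψ - ψ') = H.cupSeq p φ q ψ - H.cupSeq p φ q ψ' := by
  rw [sub_eq_add_neg, cupSeq_add_right, cupSeq_neg_right, sub_eq_add_neg]

theorem bracketSeq_skew (p q : ℕ) (φ ψ : (ℕ → A) → A) :
    H.bracketSeq p φ q ψ = -((-1 : ℤ) ^ (p * q) • H.bracketSeq q ψ p φ) := by
  rw [bracketSeq, bracketSeq, mul_comm q p]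
  rcases neg_one_pow_eq_or ℤ (p * q) with h | h <;> simp only [h] <;> abel

theorem deltaSeq_eq_neg_bracketSeq (p : ℕ) (φ : (ℕ → A) → A) :
    H.deltaSeq p φ = -H.bracketSeq p φ 1 H.mulSeq := by
  rw [deltaSeq, bracketSeq, mul_one, neg_sub]

/-- Insertion of a bracket is the graded commutator of insertions. -/
theorem IsForm.circ_bracketSeq (hF : IsForm k M F) (hφ : H.IsCoch p φ) (hψ : H.IsCoch q ψ) :
    H.circ M F (p + q) (H.bracketSeq p φ q ψ) =
      H.circ (M + p) (H.circ M F p φ) q ψ -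
        (-1 : ℤ) ^ (p * q) • H.circ (M + q) (H.circ M F q ψ) p φ := by
  -- F{φ, ψ} and F{ψ, φ} occur in both pre-Lie expansions and cancel in the commutator.
  rw [circ_circ hF hφ hψ, circ_circ hF hψ hφ, bracketSeq, hF.circ_sub, hF.circ_zsmul,
    mul_comm q p, add_comm q p]
  rcases neg_one_pow_eq_or ℤ (p * q) with h | h <;> simp only [h] <;> abel

/-- The product has odd degree 1, so its two braces with itself cancel, and μ{μ} = 0 kills the
remaining term. This yields both δ² = 0 and d² = 0. -/
theorem circ_circ_mulSeq (hF : IsForm k M F) :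
    H.circ (M + 1) (H.circ M F 1 H.mulSeq) 1 H.mulSeq = 0 := by
  rw [circ_circ hF H.mulSeq_isCoch H.mulSeq_isCoch, H.circ_mulSeq_mulSeq, hF.circ_zero]
  simp

/-- Inserting a bracket is a commutator of insertions, so every term becomes an iterated insertion
such as φ{ψ}{χ}. These cancel, with signs that depend only on parities. -/
theorem bracketSeq_jacobi (hφ : H.IsCoch p φ) (hψ : H.IsCoch q ψ) (hχ : H.IsCoch r χ) :
    H.bracketSeq p φ (q + r) (H.bracketSeq q ψ r χ) =
      H.bracketSeq (p + q) (H.bracketSeq p φ q ψ) r χ +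
        (-1 : ℤ) ^ (p * q) • H.bracketSeq q ψ (p + r) (H.bracketSeq p φ r χ) := by
  rw [bracketSeq.eq_1 H p φ (q + r), bracketSeq.eq_1 H (p + q), bracketSeq.eq_1 H q ψ (p + r),
    hφ.1.circ_bracketSeq hψ hχ, hψ.1.circ_bracketSeq hφ hχ, hχ.1.circ_bracketSeq hφ hψ]
  simp only [bracketSeq, circ_sub_left, circ_zsmul_left, Nat.add_right_comm _ 1, add_comm q p,
    add_comm r p, add_comm r q]
  by_cases hp : Even p <;> by_cases hq : Even q <;> by_cases hr : Even r <;>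
    simp only [neg_one_pow_eq_ite, Nat.even_add, Nat.even_mul, hp, hq, hr, or_true, or_false,
      or_self, if_true, if_false, iff_true, iff_false, not_true] <;> abel

/-- Both μ{μ} and φ{μ}{μ} vanish, and the two occurrences of μ{φ}{μ} cancel. -/
theorem deltaSeq_deltaSeq (hφ : H.IsCoch p φ) : H.deltaSeq (p + 1) (H.deltaSeq p φ) = 0 := by
  have h1 := H.mulSeq_isCoch.1.circ_bracketSeq hφ H.mulSeq_isCoch
  have h2 := circ_circ_mulSeq (H := H) hφ.1
  rw [H.circ_mulSeq_mulSeq, circ_zero_left] at h1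
  rw [deltaSeq, deltaSeq_eq_neg_bracketSeq, H.mulSeq_isCoch.1.circ_neg, h1, circ_neg_left,
    bracketSeq, circ_sub_left, circ_zsmul_left, h2, add_comm 2 p]
  by_cases hp : Even p <;>
    simp [neg_one_pow_eq_ite, Nat.even_add, hp]

/-- The Jacobi identity with μ as third entry. -/
theorem deltaSeq_bracketSeq (hφ : H.IsCoch p φ) (hψ : H.IsCoch q ψ) :
    H.deltaSeq (p + q) (H.bracketSeq p φ q ψ) =
      H.bracketSeq p φ (q + 1) (H.deltaSeq q ψ) +
        (-1 : ℤ) ^ q • H.bracketSeq (p + 1) (H.deltaSeq p φ) q ψ := by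
  have h := bracketSeq_jacobi hφ hψ H.mulSeq_isCoch
  have h1 : ∀ {p q φ ψ}, H.IsCoch p φ → H.bracketSeq p φ q (-ψ) = -H.bracketSeq p φ q ψ := by
    intro p q φ ψ h
    simp only [bracketSeq, h.1.circ_neg, circ_neg_left, smul_neg]
    abel
  rw [bracketSeq_skew (p + 1), deltaSeq_eq_neg_bracketSeq, deltaSeq_eq_neg_bracketSeq,
    deltaSeq_eq_neg_bracketSeq, h1 hφ, h1 hψ, h]
  by_cases hp : Even p <;> by_cases hq : Even q <;>
    simp [neg_one_pow_eq_ite, Nat.even_add, Nat.even_mul, hp, hq]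

end HomAssocAlgebra

/-! ### Associativity of the cup product, derivation rules, and the homotopies for commutativity and
Leibniz -/

namespace HomAssocAlgebra

variable {k A E : Type*} [CommRing k] [AddCommGroup A] [Module k A] [AddCommGroup E] [Module k E]
variable {H : HomAssocAlgebra k A} {M p q r : ℕ} {F : (ℕ → A) → E} {φ φ' ψ χ : (ℕ → A) → A}

/-- Once the powers of α are distributed, a single use of hom-associativity remains; equivariance of
φ exposes the α it needs. -/
theorem cupSeq_assoc (hφ : H.IsCoch p φ) (hψ : H.IsCoch q ψ) (χ : (ℕ → A) → A) :
    H.cupSeq (p + q + 1) (H.cupSeq p φ q ψ) r χ =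
      H.cupSeq p φ (q + r + 1) (H.cupSeq q ψ r χ) := by
  funext s
  have hα : ∀ n x y, (H.α ^ n) (H.μ x y) = H.μ ((H.α ^ n) x) ((H.α ^ n) y) := by
    intro n
    induction n with
    | zero => simp
    | succ n ih => intro x y; rw [pow_succ', Module.End.mul_apply, ih, H.multiplicative]; rfl
  have hpow : ∀ m n x, (H.α ^ m) ((H.α ^ n) x) = (H.α ^ (m + n)) x := fun m n x => by
    rw [pow_add, Module.End.mul_apply]
  have hα1 : ∀ n x, (H.α ^ (n + 1)) x = H.α ((H.α ^ n) x) := fun n x => by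
    rw [pow_succ', Module.End.mul_apply]
  simp only [cupSeq_apply, hα, hpow, hα1]
  rw [← hφ.2, ← H.hom_assoc, hψ.pow_apply p]
  simp only [show ∀ l, 1 + (1 + l + q) + r = 1 + l + (q + r + 1) by omega]

/-- Insertion on the right distributes over the cup product. -/
theorem circ_cupSeq (hφ : H.IsCoch p φ) (hψ : H.IsCoch q ψ) (hχ : H.IsCoch r χ) :
    H.circ (p + q + 2) (H.cupSeq p φ q ψ) r χ =
      H.cupSeq p φ (q + r) (H.circ (q + 1) ψ r χ) +
        (-1 : ℤ) ^ (r * (q + 1)) • H.cupSeq (p + r) (H.circ (p + 1) φ r χ) q ψ := by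
  -- Take F = μ: with only two slots the triple braces vanish and the double braces are cup
  -- products.
  have h := circ_brace H.mulSeq_isCoch.1 hψ hφ hχ
  rw [brace_mulSeq, brace_mulSeq, brace_mulSeq, brace₃_mulSeq, brace₃_mulSeq, brace₃_mulSeq,
    circ_zsmul_left] at h
  rw [show 1 + 1 + q + p = p + q + 2 by omega] at h
  by_cases hp : Even p <;> by_cases hq : Even q <;> by_cases hr : Even r <;>
    simp [neg_one_pow_eq_ite, Nat.even_add, Nat.even_mul, hp, hq, hr, neg_eq_iff_eq_neg] at h ⊢ <;>
    rw [h] <;> abel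

/-- This is `brace_circ` with F and χ both the product: its left side vanishes because μ{μ} = 0, and
so do the triple braces. -/
theorem circ_mulSeq_cupSeq (hφ : H.IsCoch p φ) (hψ : H.IsCoch q ψ) :
    H.circ 2 H.mulSeq (p + q + 1) (H.cupSeq p φ q ψ) =
      H.cupSeq (p + 1) (H.circ 2 H.mulSeq p φ) q ψ -
        (-1 : ℤ) ^ p • H.cupSeq p φ (q + 1) (H.circ 2 H.mulSeq q ψ) := by
  have h := brace_circ H.mulSeq_isCoch.1 hψ hφ H.mulSeq_isCoch
  rw [H.circ_mulSeq_mulSeq, brace_zero_left, brace₃_mulSeq, brace₃_mulSeq, brace₃_mulSeq,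
    brace_mulSeq, brace_mulSeq, brace_mulSeq, H.mulSeq_isCoch.1.circ_zsmul,
    show 1 + q + p = p + q + 1 by omega, add_comm 1 p, add_comm 1 q] at h
  rw [← sub_eq_zero]
  by_cases hp : Even p <;>
    simp [neg_one_pow_eq_ite, Nat.even_add, hp] at h ⊢
  · rw [h]; abel
  · rw [← neg_eq_zero, h]; abel

/-- The coboundary is a derivation of the cup product. -/
theorem deltaSeq_cupSeq (hφ : H.IsCoch p φ) (hψ : H.IsCoch q ψ) :
    H.deltaSeq (p + q + 1) (H.cupSeq p φ q ψ) =
      H.cupSeq p φ (q + 1) (H.deltaSeq q ψ) +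
        (-1 : ℤ) ^ (q + 1) • H.cupSeq (p + 1) (H.deltaSeq p φ) q ψ := by
  rw [deltaSeq.eq_1 H (p + q + 1), circ_cupSeq hφ hψ H.mulSeq_isCoch, circ_mulSeq_cupSeq hφ hψ]
  simp only [deltaSeq, cupSeq_sub_left, cupSeq_sub_right, cupSeq_zsmul_left, cupSeq_zsmul_right]
  by_cases hp : Even p <;> by_cases hq : Even q <;>
    simp [neg_one_pow_eq_ite, Nat.even_add, hp, hq] <;> abel

theorem circ_eq_of_deltaSeq_eq_zero (h : H.deltaSeq p φ = 0) :
    H.circ (p + 1) φ 1 H.mulSeq = (-1 : ℤ) ^ p • H.circ 2 H.mulSeq p φ :=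
  (sub_eq_zero.1 h).symm

/-- The homotopy for graded commutativity. φ{ψ}{μ} and φ{μ}{ψ} expand into the same braces of φ with
μ and ψ. Eliminating these, and trading φ{μ}, ψ{μ} for μ{φ}, μ{ψ} by the cocycle conditions, leaves
μ{φ, ψ} and μ{ψ, φ}. -/
theorem deltaSeq_circ (hφ : H.IsCoch p φ) (hψ : H.IsCoch q ψ) (hφ0 : H.deltaSeq p φ = 0)
    (hψ0 : H.deltaSeq q ψ = 0) :
    H.deltaSeq (p + q) (H.circ (p + 1) φ q ψ) =
      -((-1 : ℤ) ^ q • (H.cupSeq p φ q ψ -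
        (-1 : ℤ) ^ ((p + 1) * (q + 1)) • H.cupSeq q ψ p φ)) := by
  have h1 := circ_circ H.mulSeq_isCoch.1 hφ hψ
  have h2 := circ_circ hφ.1 hψ H.mulSeq_isCoch
  have h3 := circ_circ hφ.1 H.mulSeq_isCoch hψ
  rw [circ_eq_of_deltaSeq_eq_zero hψ0, hφ.1.circ_zsmul] at h2
  rw [circ_eq_of_deltaSeq_eq_zero hφ0, circ_zsmul_left, show p + 1 + 1 = 1 + 1 + p by omega, h1,
    brace_mulSeq, brace_mulSeq, add_comm 1 q] at h3
  rw [deltaSeq, Nat.add_right_comm p q 1, h2]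
  by_cases hp : Even p <;> by_cases hq : Even q <;>
    simp [neg_one_pow_eq_ite, Nat.even_add, Nat.even_mul, hp, hq] at h3 ⊢ <;>
    first | linear_combination (norm := module) h3 | linear_combination (norm := module) -h3

/-- The homotopy for the Leibniz rule. The triple braces of χ with μ, φ, ψ occur in both χ{φ, ψ}{μ}
and χ{μ}{φ, ψ} and cancel; the cocycle conditions turn the other insertions of μ into cup products.
-/
theorem deltaSeq_brace (hφ : H.IsCoch p φ) (hψ : H.IsCoch q ψ) (hχ : H.IsCoch r χ)
    (hφ0 : H.deltaSeq p φ = 0) (hψ0 : H.deltaSeq q ψ = 0) (hχ0 : H.deltaSeq r χ = 0) :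
    H.deltaSeq (r + p + q) (H.brace (r + 1) χ p φ q ψ) =
      (-1 : ℤ) ^ p • (H.circ (r + 1) χ (q + p + 1) (H.cupSeq q ψ p φ)
        - H.cupSeq (r + q) (H.circ (r + 1) χ q ψ) p φ
        - (-1 : ℤ) ^ (r * (q + 1)) • H.cupSeq q ψ (r + p) (H.circ (r + 1) χ p φ)) := by
  have h1 := circ_brace hχ.1 hφ hψ H.mulSeq_isCoch
  have h2 := brace_circ hχ.1 hφ hψ H.mulSeq_isCoch
  have h3 := brace_circ H.mulSeq_isCoch.1 hφ hψ hχ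
  rw [circ_eq_of_deltaSeq_eq_zero hφ0, circ_eq_of_deltaSeq_eq_zero hψ0,
    hχ.1.brace_zsmul_fst hψ.1, hχ.1.brace_zsmul_snd] at h1
  rw [circ_eq_of_deltaSeq_eq_zero hχ0, brace_zsmul_left, show r + 1 + 1 = 1 + 1 + r by omega, h3,
    brace₃_mulSeq, brace₃_mulSeq, brace₃_mulSeq, brace_mulSeq, brace_mulSeq, brace_mulSeq,
    hχ.1.circ_zsmul, add_comm 1 p, add_comm 1 q, show p + 1 + q = q + p + 1 by omega] at h2
  rw [deltaSeq, show r + p + q + 1 = r + 1 + p + q by omega, h1]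
  by_cases hp : Even p <;> by_cases hq : Even q <;> by_cases hr : Even r <;>
    simp [neg_one_pow_eq_ite, Nat.even_add, Nat.even_mul, hp, hq, hr] at h2 ⊢ <;>
    first | linear_combination (norm := module) h2 | linear_combination (norm := module) -h2

/-- The Leibniz rule, up to a coboundary. -/
theorem bracketSeq_cupSeq (hφ : H.IsCoch p φ) (hψ : H.IsCoch q ψ) (hχ : H.IsCoch r χ)
    (hφ0 : H.deltaSeq p φ = 0) (hψ0 : H.deltaSeq q ψ = 0) (hχ0 : H.deltaSeq r χ = 0) :
    H.bracketSeq r χ (q + p + 1) (H.cupSeq q ψ p φ) =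
      H.cupSeq (r + q) (H.bracketSeq r χ q ψ) p φ +
        (-1 : ℤ) ^ (r * (q + 1)) • H.cupSeq q ψ (r + p) (H.bracketSeq r χ p φ) +
        (-1 : ℤ) ^ p • H.deltaSeq (r + p + q) (H.brace (r + 1) χ p φ q ψ) := by
  -- The half of the bracket that inserts χ into the cup product distributes exactly, by
  -- `circ_cupSeq`; only the half that inserts the cup product into χ needs the homotopy.
  rw [deltaSeq_brace hφ hψ hχ hφ0 hψ0 hχ0, bracketSeq.eq_1 H r χ (q + p + 1),
    circ_cupSeq hψ hφ hχ]
  simp only [bracketSeq, cupSeq_sub_left, cupSeq_sub_right, cupSeq_zsmul_left, cupSeq_zsmul_right,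
    add_comm q r, add_comm p r]
  by_cases hp : Even p <;> by_cases hq : Even q <;> by_cases hr : Even r <;>
    simp [neg_one_pow_eq_ite, Nat.even_add, Nat.even_mul, hp, hq, hr] <;> abel

end HomAssocAlgebra

namespace HomAssocAlgebra

variable {k A E : Type*} [CommRing k] [AddCommGroup A] [Module k A] [AddCommGroup E] [Module k E]

/-! ### Extension of scalars to the dual numbers

`A × A` is viewed as `A ⊗ k[ε] = A ⊕ A ε`. -/

/-- The extension of scalars of a hom-associative algebra to the dual numbers. -/
def dual (H : HomAssocAlgebra k A) : HomAssocAlgebra k (A × A) where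
  μ := LinearMap.mk₂ k (fun x y => (H.μ x.1 y.1, H.μ x.2 y.1 + H.μ x.1 y.2))
    (fun x x' y => by
      ext <;> simp
      abel)
    (fun c x y => by ext <;> simp)
    (fun x y y' => by
      ext <;> simp
      abel)
    (fun c x y => by ext <;> simp)
  α := H.α.prodMap H.α
  hom_assoc a b c := by
    ext <;> simp [H.hom_assoc]
    abel
  multiplicative a b := by ext <;> simp [H.multiplicative]

/-- Take the coefficient of `ε` in the term `m` of a sequence, and the constant coefficient in
all other terms. -/
def mix {X : Type*} (m : ℕ) (s : ℕ → X × X) (j : ℕ) : X := if j = m then (s j).2 else (s j).1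

/-- The extension to the dual numbers of a multilinear function of `M` arguments. -/
def dualExt {X Y : Type*} [AddCommMonoid Y] (M : ℕ) (F : (ℕ → X) → Y) (s : ℕ → X × X) : Y × Y :=
  (F fun j => (s j).1, ∑ m ∈ Finset.range M, F (mix m s))

section

variable {X Y : Type*} [AddCommGroup Y]

theorem dualExt_zsmul (M : ℕ) (c : ℤ) (F : (ℕ → X) → Y) :
    dualExt M (c • F) = c • dualExt M F := by
  funext s
  ext <;> simp [dualExt, Finset.smul_sum]

theorem dualExt_sub (M : ℕ) (F G : (ℕ → X) → Y) :
    dualExt M (F - G) = dualExt M F - dualExt M G := by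
  funext s
  ext <;> simp [dualExt]

theorem dualExt_sum (M : ℕ) {ι : Type*} (t : Finset ι) (F : ι → (ℕ → X) → Y) :
    dualExt M (∑ i ∈ t, F i) = ∑ i ∈ t, dualExt M (F i) := by
  funext s
  ext
  · simp [dualExt, Prod.fst_sum]
  · simp only [dualExt, Finset.sum_apply, Prod.snd_sum]
    exact Finset.sum_comm

end

theorem IsForm.dualExt {M : ℕ} {F : (ℕ → A) → E} (hF : IsForm k M F) :
    IsForm k M (HomAssocAlgebra.dualExt M F) := by
  obtain ⟨F, rfl⟩ := hF
  refine ⟨(F.compLinearMap fun _ => LinearMap.fst k A A).prod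
    (∑ m : Fin M, F.compLinearMap fun j => if j = m then LinearMap.snd k A A
      else LinearMap.fst k A A), ?_⟩
  funext s
  ext
  · rfl
  · simp only [unc, MultilinearMap.prod_apply, sum_apply, HomAssocAlgebra.dualExt,
      MultilinearMap.compLinearMap_apply, Finset.sum_range]
    refine Finset.sum_congr rfl fun m _ => ?_
    congr 1
    funext j
    simp only [mix, Fin.ext_iff]
    split_ifs <;> rfl

variable {H : HomAssocAlgebra k A} {M p q r : ℕ} {F : (ℕ → A) → E} {φ ψ χ : (ℕ → A) → A}

theorem dual_α (x : A × A) : H.dual.α x = (H.α x.1, H.α x.2) := rfl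

theorem dual_α_pow (n : ℕ) (x : A × A) :
    (H.dual.α ^ n) x = ((H.α ^ n) x.1, (H.α ^ n) x.2) := by
  induction n with
  | zero => simp
  | succ n ih =>
    simp only [pow_succ', Module.End.mul_apply, ih]
    rfl

theorem plug_dual_fst (M : ℕ) (φ : (ℕ → A) → A) (i : ℕ) (s : ℕ → A × A) :
    (fun j => (H.dual.plug p (dualExt M φ) i s j).1) = H.plug p φ i fun j => (s j).1 := by
  funext j
  simp only [plug, dual_α_pow]
  split_ifs <;> rfl

/-- The ε-coefficient is a sum over the argument that carries ε. This argument lies before, among or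
after the arguments of φ, and the middle block adds up to the ε-coefficient of the value of φ. -/
theorem dualExt_plug (hF : IsForm k M F) (hφ : IsForm k (p + 1) φ) {i : ℕ} (hi : i < M) :
    dualExt (M + p) (fun s => F (H.plug p φ i s)) =
      fun s => dualExt M F (H.dual.plug p (dualExt (p + 1) φ) i s) := by
  funext s
  ext
  · simp only [dualExt]
    rw [← plug_dual_fst (p + 1)]
  · have h := sum_range_split 0 hi fun m => F (mix m (H.dual.plug p (dualExt (p + 1) φ) i s))
    simp only [add_zero, zero_add, Finset.sum_range_one] at h
    simp only [dualExt] at h ⊢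
    rw [sum_range_split p hi, h]
    refine congr_arg₂ _ (congr_arg₂ _ ?_ ?_) ?_
    · refine Finset.sum_congr rfl fun m hm => ?_
      rw [Finset.mem_range] at hm
      congr 1
      funext j
      rcases lt_trichotomy j i with hj | rfl | hj
      · simp only [plug, mix, hj, if_true, dual_α_pow]
        split_ifs <;> rfl
      · simp only [plug, mix, lt_irrefl, if_true, if_false, hm.ne',
          show ∀ l, j + l ≠ m by omega]
        rfl
      · simp only [plug, mix, hj.not_gt, hj.ne', if_false, dual_α_pow,
          show j ≠ m by omega, show j + p ≠ m by omega]
    · obtain ⟨L, hL⟩ := hF.exists_linearMap hi (H.plug p 0 i fun j => (s j).1)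
      have e : mix i (H.dual.plug p (dualExt (p + 1) φ) i s) =
          Function.update (H.plug p 0 i fun j => (s j).1) i
            (∑ l ∈ Finset.range (p + 1), φ (mix l fun j => s (i + j))) := by
        funext j
        rcases lt_trichotomy j i with hj | rfl | hj
        · simp [plug, mix, hj, hj.ne, dual_α_pow]
        · simp [plug, mix, dualExt]
        · simp [plug, mix, hj.not_gt, hj.ne', dual_α_pow]
      change _ = F (mix i (H.dual.plug p (dualExt (p + 1) φ) i s))
      rw [e, hL, map_sum]
      refine Finset.sum_congr rfl fun l hl => ?_
      rw [Finset.mem_range] at hl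
      rw [← hL]
      congr 1
      funext j
      rcases lt_trichotomy j i with hj | rfl | hj
      · simp [plug, mix, hj, hj.ne, show j ≠ i + l by omega]
      · simp only [plug, mix, lt_irrefl, if_true, if_false, Function.update_self, add_right_inj]
        rfl
      · simp [plug, mix, hj.not_gt, hj.ne', show j + p ≠ i + l by omega]
    · refine Finset.sum_congr rfl fun m hm => ?_
      rw [Finset.mem_Ico] at hm
      congr 1
      funext j
      rcases lt_trichotomy j i with hj | rfl | hj
      · simp only [plug, mix, hj, if_true, dual_α_pow, show j ≠ m by omega,
          show j ≠ m + p by omega, if_false]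
      · simp only [plug, mix, lt_irrefl, if_true, if_false, show j ≠ m by omega]
        exact hφ.congr fun l hl => if_neg (by omega)
      · simp only [plug, mix, hj.not_gt, hj.ne', if_false, dual_α_pow, add_left_inj]
        split_ifs <;> rfl

theorem IsCoch.dualExt (hφ : H.IsCoch p φ) : H.dual.IsCoch p (dualExt (p + 1) φ) := by
  refine ⟨hφ.1.dualExt, fun s => ?_⟩
  ext
  · exact hφ.2 _
  · simp only [HomAssocAlgebra.dualExt]
    rw [dual_α, map_sum]
    dsimp only
    refine Finset.sum_congr rfl fun m _ => ?_
    rw [hφ.2]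
    congr 1
    funext j
    simp only [mix]
    split_ifs <;> rfl

theorem dual_mulSeq : H.dual.mulSeq = dualExt 2 H.mulSeq := by
  funext s
  ext <;> simp [dualExt, mulSeq_apply, dual, Finset.sum_range_succ, mix]

theorem dualExt_circ (hF : IsForm k M F) (hφ : IsForm k (p + 1) φ) :
    dualExt (M + p) (H.circ M F p φ) = H.dual.circ M (dualExt M F) p (dualExt (p + 1) φ) := by
  unfold circ
  rw [sum_fun_apply, sum_fun_apply, dualExt_sum]
  refine Finset.sum_congr rfl fun i hi => ?_
  have h := dualExt_plug (H := H) hF hφ (Finset.mem_range.1 hi)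
  exact (dualExt_zsmul _ _ _).trans (congrArg _ h)

theorem dualExt_deltaSeq (hφ : H.IsCoch p φ) :
    dualExt (p + 2) (H.deltaSeq p φ) = H.dual.deltaSeq p (dualExt (p + 1) φ) := by
  rw [deltaSeq, deltaSeq, dualExt_sub, dualExt_zsmul, dual_mulSeq, add_comm p 2,
    dualExt_circ H.mulSeq_isCoch.1 hφ.1, show 2 + p = p + 1 + 1 by omega,
    dualExt_circ hφ.1 H.mulSeq_isCoch.1]

theorem dualExt_bracketSeq (hφ : H.IsCoch p φ) (hψ : H.IsCoch q ψ) :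
    dualExt (p + q + 1) (H.bracketSeq p φ q ψ) =
      H.dual.bracketSeq p (dualExt (p + 1) φ) q (dualExt (q + 1) ψ) := by
  rw [bracketSeq, bracketSeq, dualExt_sub, dualExt_zsmul, Nat.add_right_comm,
    dualExt_circ hφ.1 hψ.1, show p + 1 + q = q + 1 + p by omega, dualExt_circ hψ.1 hφ.1]

variable (H)

/-- The derivation `a + b ε ↦ b ε` of the dual numbers. -/
def eulerSeq (A : Type*) [AddCommGroup A] (s : ℕ → A × A) : A × A := (0, (s 0).2)

theorem eulerSeq_isCoch : H.dual.IsCoch 0 (eulerSeq A) := by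
  refine ⟨⟨(LinearMap.inr k A A ∘ₗ LinearMap.snd k A A).compMultilinearMap
    (MultilinearMap.ofSubsingleton k (A × A) (A × A) (0 : Fin 1) LinearMap.id), rfl⟩, fun s => ?_⟩
  ext
  · exact map_zero H.α
  · rfl

variable {H}

/-- Extended cochains preserve the degree in ε that `eulerSeq` measures. Concretely, `eulerSeq` in
slot i keeps only the ε-term of slot i, and the sum over i is the ε-part of the value. -/
theorem bracketSeq_eulerSeq (hφ : H.IsCoch p φ) :
    H.dual.bracketSeq p (dualExt (p + 1) φ) 0 (eulerSeq A) = 0 := by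
  funext s
  have h0 : ∀ {t : ℕ → A} {j : ℕ}, j < p + 1 → t j = 0 → φ t = 0 := by
    intro t j hj ht
    obtain ⟨L, hL⟩ := hφ.1.exists_linearMap hj t
    rw [← Function.update_eq_self j t, hL, ht, map_zero]
  have e : ∀ i j, H.dual.plug 0 (eulerSeq A) i s j = if j = i then (0, (s i).2) else s j := by
    intro i j
    simp only [plug, pow_zero, Module.End.one_apply, add_zero, eulerSeq]
    split_ifs <;> first | rfl | omega
  simp only [bracketSeq, circ, Pi.sub_apply, mul_zero, zero_mul, pow_zero, one_smul,
    zero_add,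
    Finset.sum_range_one, Pi.zero_apply, sub_eq_zero]
  ext
  · simp only [dualExt, Prod.fst_sum, eulerSeq]
    exact Finset.sum_eq_zero fun i hi => h0 (Finset.mem_range.1 hi) (by simp [e])
  · rw [Prod.snd_sum, eulerSeq, plug, if_neg (lt_irrefl 0), if_pos rfl]
    simp only [dualExt, zero_add]
    refine Finset.sum_congr rfl fun i hi => ?_
    rw [Finset.sum_eq_single i]
    · congr 1
      funext j
      simp only [mix, e]
      split_ifs with h
      · rw [h]
      · rfl
    · intro m _ hm
      refine h0 (Finset.mem_range.1 hi) ?_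
      rw [mix, if_neg hm.symm, e, if_pos rfl]
    · exact fun h => absurd hi h

end HomAssocAlgebra

namespace HomAssocAlgebra

variable {k A E : Type*} [CommRing k] [AddCommGroup A] [Module k A] [AddCommGroup E] [Module k E]

/-! ### Operators on chains -/

variable (k) in
/-- The elementary chain `s_0 ⊗ ⋯ ⊗ s_n`. -/
noncomputable def chain (n : ℕ) : (ℕ → A) → Chains k A n := unc (PiTensorProduct.tprod k)

theorem isForm_chain (n : ℕ) : IsForm k (n + 1) (chain k n : (ℕ → A) → Chains k A n) :=
  ⟨PiTensorProduct.tprod k, rfl⟩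

theorem chain_congr {n : ℕ} {s t : ℕ → A} (h : ∀ j ≤ n, s j = t j) : chain k n s = chain k n t :=
  (isForm_chain n).congr fun j hj => h j (Nat.lt_succ_iff.1 hj)

theorem chain_eq_zero {n j : ℕ} {s : ℕ → A} (hj : j ≤ n) (h : s j = 0) : chain k n s = 0 := by
  obtain ⟨L, hL⟩ := (isForm_chain (k := k) (A := A) n).exists_linearMap (Nat.lt_succ_of_le hj) s
  rw [← Function.update_eq_self j s, hL, h, map_zero]

theorem linearMap_ext_chain {n : ℕ} {f g : Chains k A n →ₗ[k] E}
    (h : ∀ s : ℕ → A, f (chain k n s) = g (chain k n s)) : f = g := by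
  refine PiTensorProduct.ext (MultilinearMap.ext fun a => ?_)
  obtain ⟨s, rfl⟩ : ∃ s : ℕ → A, (fun j : Fin (n + 1) => s j) = a :=
    ⟨fun j => if hj : j < n + 1 then a ⟨j, hj⟩ else 0, funext fun j => dif_pos j.2⟩
  exact h s

/-- The linear map on chains defined by a multilinear function. -/
noncomputable def seqLift {n : ℕ} {F : (ℕ → A) → E} (hF : IsForm k (n + 1) F) :
    Chains k A n →ₗ[k] E :=
  PiTensorProduct.lift hF.choose

theorem seqLift_chain {n : ℕ} {F : (ℕ → A) → E} (hF : IsForm k (n + 1) F) (s : ℕ → A) :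
    seqLift hF (chain k n s) = F s := by
  rw [seqLift, chain, unc, PiTensorProduct.lift.tprod]
  exact congrFun hF.choose_spec s

/-- Cyclic rotation of the first `n + 1` terms of a sequence. -/
def rot {X : Type*} (n : ℕ) (s : ℕ → X) (j : ℕ) : X := if j = 0 then s n else s (j - 1)

/-- Terms beyond n are shifted too, not fixed; this is harmless because `chain k n` reads only the
first n + 1 terms. -/
theorem rot_iterate {X : Type*} {n c : ℕ} (hc : c ≤ n + 1) (s : ℕ → X) (j : ℕ) :
    (rot n)^[c] s j = if j < c then s (j + n + 1 - c) else s (j - c) := by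
  induction c generalizing j with
  | zero => simp
  | succ c ih =>
    rw [Function.iterate_succ_apply', rot, ih (by omega), ih (by omega)]
    split_ifs <;> first | omega | (congr 1; omega)

theorem cyc_chain (n : ℕ) (s : ℕ → A) : cyc k A n (chain k n s) = chain k n (rot n s) := by
  rw [cyc, chain, unc, LinearEquiv.coe_coe, PiTensorProduct.reindex_tprod]
  change _ = PiTensorProduct.tprod k _
  congr 1
  funext j
  obtain ⟨i, rfl⟩ := (finRotate (n + 1)).surjective j
  rw [Equiv.symm_apply_apply]
  rcases (Nat.lt_succ_iff.1 i.2).lt_or_eq with h | h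
  · rw [finRotate_of_lt h]
    simp [rot]
  · rw [show i = Fin.last n from Fin.ext h, finRotate_last]
    simp [rot]

theorem cyc_pow_chain (n c : ℕ) (s : ℕ → A) :
    (cyc k A n ^ c) (chain k n s) = chain k n ((rot n)^[c] s) := by
  induction c generalizing s with
  | zero => rfl
  | succ c ih => rw [pow_succ, Module.End.mul_apply, cyc_chain, ih]; rfl

theorem cyc_pow_succ_self (n : ℕ) : cyc k A n ^ (n + 1) = 1 := by
  refine linearMap_ext_chain fun s => ?_
  rw [cyc_pow_chain]
  refine chain_congr fun j hj => ?_
  rw [rot_iterate le_rfl, if_pos (by omega)]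
  congr 1
  omega

variable (H : HomAssocAlgebra k A) {n m p q : ℕ} {φ ψ : (ℕ → A) → A}

/-- The insertion of `φ` at position `i`, as a map of chains. -/
noncomputable def insertOp (h : m + p = n) (hφ : IsForm k (p + 1) φ) (i : Fin (m + 1)) :
    Chains k A n →ₗ[k] Chains k A m :=
  seqLift (F := fun s => chain k m (H.plug p φ i s)) <| by
    have := (isForm_chain m).comp_plug (H := H) hφ i.2
    rwa [Nat.add_right_comm, h] at this

theorem insertOp_chain (h : m + p = n) (hφ : IsForm k (p + 1) φ) (i : Fin (m + 1)) (s : ℕ → A) :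
    H.insertOp h hφ i (chain k n s) = chain k m (H.plug p φ i s) :=
  seqLift_chain _ s

/-- The signed sum of all insertions of `φ`, as a map of chains. -/
noncomputable def circOp (h : m + p = n) (hφ : IsForm k (p + 1) φ) :
    Chains k A n →ₗ[k] Chains k A m :=
  ∑ i : Fin (m + 1), (-1 : k) ^ (p * i) • H.insertOp h hφ i

theorem circOp_chain (h : m + p = n) (hφ : IsForm k (p + 1) φ) (s : ℕ → A) :
    H.circOp h hφ (chain k n s) = H.circ (m + 1) (chain k m) p φ s := by
  simp [circOp, insertOp_chain, circ, Finset.sum_range, neg_one_pow_smul_eq_zsmul]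

theorem circOp_circOp {n' : ℕ} (h : m + p = n) (h' : n + q = n') (hφ : IsForm k (p + 1) φ)
    (hψ : IsForm k (q + 1) ψ) (s : ℕ → A) :
    H.circOp h hφ (H.circOp h' hψ (chain k n' s)) =
      H.circ (m + 1 + p) (H.circ (m + 1) (chain k m) p φ) q ψ s := by
  rw [circOp_chain, circ, circ, map_sum, Nat.add_right_comm, h]
  exact Finset.sum_congr rfl fun i _ => by rw [map_zsmul, circOp_chain]

-- `IsForm.circ_bracketSeq` with the tensor product itself as outer form.
variable {H} in
theorem circOp_bracketSeq {n' n₁ n₂ : ℕ} (h : m + (p + q) = n') (h₁ : m + p = n₁)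
    (h₁' : n₁ + q = n') (h₂ : m + q = n₂) (h₂' : n₂ + p = n') (hφ : H.IsCoch p φ)
    (hψ : H.IsCoch q ψ) :
    H.circOp h (hφ.bracketSeq hψ).1 =
      H.circOp h₁ hφ.1 ∘ₗ H.circOp h₁' hψ.1 -
        (-1 : k) ^ (p * q) • H.circOp h₂ hψ.1 ∘ₗ H.circOp h₂' hφ.1 := by
  refine linearMap_ext_chain fun s => ?_
  rw [circOp_chain, (isForm_chain m).circ_bracketSeq hφ hψ, LinearMap.sub_apply,
    LinearMap.smul_apply, LinearMap.comp_apply, LinearMap.comp_apply, circOp_circOp, circOp_circOp,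
    neg_one_pow_smul_eq_zsmul (k := k), Pi.sub_apply, Pi.smul_apply]

/-! ### Signed cyclic invariance -/

theorem cyc_insertOp_of_lt (h : m + p = n) (hφ : IsForm k (p + 1) φ) {i : ℕ} (hi : i < m) :
    cyc k A m ∘ₗ H.insertOp h hφ ⟨i, by omega⟩ =
      H.insertOp h hφ ⟨i + 1, by omega⟩ ∘ₗ cyc k A n := by
  refine linearMap_ext_chain fun s => ?_
  simp only [LinearMap.comp_apply, insertOp_chain, cyc_chain]
  congr 1
  funext j
  rcases Nat.eq_zero_or_pos j with rfl | hj
  · simp [rot, plug, hi.not_gt, hi.ne', h]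
  · obtain ⟨j, rfl⟩ := Nat.exists_eq_add_of_le' hj
    simp [rot, plug, show ∀ l, i + 1 + l - 1 = i + l by omega,
      show j + 1 + p - 1 = j + p by omega]

/-- The last insertion consumes the final p + 1 factors; bringing these to the front takes p + 1
rotations before the insertion, but only one after it. -/
theorem cyc_insertOp_last (h : m + p = n) (hφ : IsForm k (p + 1) φ) :
    cyc k A m ∘ₗ H.insertOp h hφ (Fin.last m) =
      H.insertOp h hφ 0 ∘ₗ (cyc k A n) ^ (p + 1) := by
  refine linearMap_ext_chain fun s => ?_
  simp only [LinearMap.comp_apply, insertOp_chain, cyc_chain, cyc_pow_chain]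
  refine chain_congr fun j hj => ?_
  rcases Nat.eq_zero_or_pos j with rfl | hj'
  · simp only [rot, plug, Fin.val_last, lt_irrefl, if_true, if_false, Fin.val_zero, zero_add]
    refine hφ.congr fun l hl => ?_
    rw [rot_iterate (by omega), if_pos hl]
    congr 1
    omega
  · obtain ⟨j, rfl⟩ := Nat.exists_eq_add_of_le' hj'
    simp [rot, plug, rot_iterate (show p + 1 ≤ n + 1 by omega), show j < m by omega,
      show ¬ j + 1 + p < p + 1 by omega, show j + 1 + p - (p + 1) = j by omega]

/-- Rotation permutes the insertion positions cyclically, i to i + 1 and m to 0, and the signs fit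
because n = m + p. -/
theorem cyc_circOp (h : m + p = n) (hφ : IsForm k (p + 1) φ) {y : Chains k A n}
    (hy : cyc k A n y = (-1 : k) ^ n • y) :
    cyc k A m (H.circOp h hφ y) = (-1 : k) ^ m • H.circOp h hφ y := by
  have hy' : ∀ c, (cyc k A n ^ c) y = (-1 : k) ^ (n * c) • y := by
    intro c
    induction c with
    | zero => simp
    | succ c ih => rw [pow_succ, Module.End.mul_apply, hy, map_smul, ih, smul_smul]; ring_nf
  have e1 : ∀ i : Fin m, cyc k A m (H.insertOp h hφ i.castSucc y) =
      (-1 : k) ^ n • H.insertOp h hφ i.succ y := by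
    intro i
    have := LinearMap.congr_fun (H.cyc_insertOp_of_lt h hφ i.2) y
    rwa [LinearMap.comp_apply, LinearMap.comp_apply, hy, map_smul] at this
  have e2 := LinearMap.congr_fun (H.cyc_insertOp_last h hφ) y
  rw [LinearMap.comp_apply, LinearMap.comp_apply, hy', map_smul] at e2
  simp only [circOp, LinearMap.sum_apply, LinearMap.smul_apply, map_sum, map_smul,
    Finset.smul_sum, smul_smul]
  rw [Fin.sum_univ_castSucc, Fin.sum_univ_succ, add_comm, e2]
  subst h
  congr 1
  · rw [smul_smul, ← pow_add, ← pow_add, neg_one_pow_congr]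
    simp only [Nat.even_add, Nat.even_mul, Nat.not_even_one, iff_false]
    tauto
  · refine Finset.sum_congr rfl fun i _ => ?_
    rw [e1, smul_smul, ← pow_add, ← pow_add, neg_one_pow_congr]
    simp only [Nat.even_add, Nat.even_mul, Fin.val_castSucc, Fin.val_succ, Nat.not_even_one,
      iff_false]
    tauto

end HomAssocAlgebra

namespace HomAssocAlgebra

variable {k A E : Type*} [CommRing k] [AddCommGroup A] [Module k A] [AddCommGroup E] [Module k E]

/-! ### Marked chains

A chain of `A × A = A ⊕ A ε` is marked at `c` if its factor number `c` lies in `A ε` and all other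
factors lie in `A`. -/

/-- Multiply the term `c` of a sequence by `ε`. -/
def mark (c : ℕ) (s : ℕ → A) (j : ℕ) : A × A := if j = c then (0, s j) else (s j, 0)

/-- Among the first `n + 1` terms of the sequence exactly the term `c` is a multiple of `ε`. -/
structure IsMarked (n c : ℕ) (s : ℕ → A × A) : Prop where
  fst_eq_zero : (s c).1 = 0
  snd_eq_zero : ∀ j ≤ n, j ≠ c → (s j).2 = 0

theorem isMarked_mark (n c : ℕ) (s : ℕ → A) : IsMarked n c (mark c s) :=
  ⟨by simp [mark], fun j _ hj => by simp [mark, hj]⟩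

theorem mix_mark (c : ℕ) (s : ℕ → A) : mix c (mark c s) = s := by
  funext j
  simp only [mix, mark]
  split_ifs <;> rfl

theorem isForm_chain_mark (n c : ℕ) :
    IsForm k (n + 1) fun s : ℕ → A => chain k n (mark c s) := by
  refine ⟨(PiTensorProduct.tprod k).compLinearMap fun j : Fin (n + 1) =>
    if j.1 = c then LinearMap.inr k A A else LinearMap.inl k A A, ?_⟩
  funext s
  simp only [unc, chain, MultilinearMap.compLinearMap_apply]
  congr 1
  funext j
  simp only [mark]
  split_ifs <;> rfl

theorem isForm_chain_mix (n c : ℕ) :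
    IsForm k (n + 1) fun s : ℕ → A × A => chain k n (mix c s) := by
  refine ⟨(PiTensorProduct.tprod k).compLinearMap fun j : Fin (n + 1) =>
    if j.1 = c then LinearMap.snd k A A else LinearMap.fst k A A, ?_⟩
  funext s
  simp only [unc, chain, MultilinearMap.compLinearMap_apply]
  congr 1
  funext j
  simp only [mix]
  split_ifs <;> rfl

variable (k A) in
/-- Mark the factor `c` of a chain. -/
noncomputable def markOp (n c : ℕ) : Chains k A n →ₗ[k] Chains k (A × A) n :=
  seqLift (isForm_chain_mark n c)

variable (k A) in
/-- The component of a chain that is marked at `c`. -/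
noncomputable def mixOp (n c : ℕ) : Chains k (A × A) n →ₗ[k] Chains k A n :=
  seqLift (isForm_chain_mix n c)

theorem markOp_chain (n c : ℕ) (s : ℕ → A) :
    markOp k A n c (chain k n s) = chain k n (mark c s) :=
  seqLift_chain _ s

theorem mixOp_chain (n c : ℕ) (s : ℕ → A × A) :
    mixOp k A n c (chain k n s) = chain k n (mix c s) :=
  seqLift_chain _ s

variable (k A) in
/-- The projection onto the marked chains. -/
noncomputable def markedProj (n : ℕ) : Chains k (A × A) n →ₗ[k] Chains k (A × A) n :=
  ∑ c : Fin (n + 1), markOp k A n c ∘ₗ mixOp k A n c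

theorem IsMarked.markedProj_chain {n c : ℕ} (hc : c ≤ n) {s : ℕ → A × A} (hs : IsMarked n c s) :
    markedProj k A n (chain k n s) = chain k n s := by
  rw [markedProj, LinearMap.sum_apply, Finset.sum_eq_single ⟨c, Nat.lt_succ_of_le hc⟩]
  · rw [LinearMap.comp_apply, mixOp_chain, markOp_chain]
    refine chain_congr fun j hj => ?_
    simp only [mark, mix]
    split_ifs with h
    · ext
      · rw [h, hs.fst_eq_zero]
      · rfl
    · ext
      · rfl
      · exact (hs.snd_eq_zero j hj h).symm
  · intro c' _ hc'
    have hc'' : c ≠ c' := fun h => hc' (Fin.ext h.symm)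
    rw [LinearMap.comp_apply, mixOp_chain,
      chain_eq_zero hc (by rw [mix, if_neg hc'', hs.fst_eq_zero]), map_zero]
  · simp

variable (k A) in
/-- The signed sum of all rotations of a chain, with the factor `0` marked. -/
noncomputable def spreadOp (n : ℕ) : Chains k A n →ₗ[k] Chains k (A × A) n :=
  ∑ c : Fin (n + 1), (-1 : k) ^ (n * c) • markOp k A n c ∘ₗ cyc k A n ^ c.1

theorem cyc_markOp_of_lt {n c : ℕ} (hc : c < n) :
    cyc k (A × A) n ∘ₗ markOp k A n c = markOp k A n (c + 1) ∘ₗ cyc k A n := by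
  refine linearMap_ext_chain fun s => ?_
  simp only [LinearMap.comp_apply, markOp_chain, cyc_chain]
  congr 1
  funext j
  rcases Nat.eq_zero_or_pos j with rfl | hj
  · simp [rot, mark, hc.ne']
  · obtain ⟨j, rfl⟩ := Nat.exists_eq_add_of_le' hj
    simp [rot, mark]

theorem cyc_markOp_last (n : ℕ) :
    cyc k (A × A) n ∘ₗ markOp k A n n = markOp k A n 0 ∘ₗ cyc k A n := by
  refine linearMap_ext_chain fun s => ?_
  simp only [LinearMap.comp_apply, markOp_chain, cyc_chain]
  refine chain_congr fun j hj => ?_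
  rcases Nat.eq_zero_or_pos j with rfl | hj'
  · simp [rot, mark]
  · obtain ⟨j, rfl⟩ := Nat.exists_eq_add_of_le' hj'
    simp [rot, mark, show j ≠ n by omega]

/-- Rotation carries summand c to summand c + 1, and the last to the first since n + 1 rotations are
the identity. -/
theorem cyc_spreadOp (n : ℕ) (x : Chains k A n) :
    cyc k (A × A) n (spreadOp k A n x) = (-1 : k) ^ n • spreadOp k A n x := by
  have e1 : ∀ (i : Fin n) (y : Chains k A n), cyc k (A × A) n (markOp k A n i y) =
      markOp k A n (i + 1) (cyc k A n y) := fun i y =>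
    LinearMap.congr_fun (cyc_markOp_of_lt i.2) y
  have e2 : ∀ y : Chains k A n, cyc k (A × A) n (markOp k A n n y) =
      markOp k A n 0 (cyc k A n y) := fun y => LinearMap.congr_fun (cyc_markOp_last n) y
  simp only [spreadOp, LinearMap.sum_apply, LinearMap.smul_apply, LinearMap.comp_apply, map_sum,
    map_smul, Finset.smul_sum, smul_smul]
  rw [Fin.sum_univ_castSucc, Fin.sum_univ_succ, add_comm]
  simp only [Fin.val_castSucc, Fin.val_last, Fin.val_zero, Fin.val_succ, e1, e2]
  congr 1
  · rw [← Module.End.mul_apply (cyc k A n), ← pow_succ', cyc_pow_succ_self, pow_zero, ← pow_add,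
      neg_one_pow_congr]
    simp only [Nat.even_add, Nat.even_mul]
    simp
  · refine Finset.sum_congr rfl fun i _ => ?_
    rw [← Module.End.mul_apply (cyc k A n), ← pow_succ', ← pow_add, neg_one_pow_congr]
    simp only [Nat.even_add, Nat.even_mul, Nat.not_even_one, iff_false]
    tauto

theorem mixOp_cyc {n c : ℕ} (hc : c < n) :
    mixOp k A n (c + 1) ∘ₗ cyc k (A × A) n = cyc k A n ∘ₗ mixOp k A n c := by
  refine linearMap_ext_chain fun s => ?_
  simp only [LinearMap.comp_apply, mixOp_chain, cyc_chain]
  congr 1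
  funext j
  rcases Nat.eq_zero_or_pos j with rfl | hj
  · simp [rot, mix, hc.ne']
  · obtain ⟨j, rfl⟩ := Nat.exists_eq_add_of_le' hj
    simp [rot, mix]

/-- A marked chain is the sum of its components, and signed invariance determines each of them from
the one marked at 0. -/
theorem spreadOp_mixOp {n : ℕ} {y : Chains k (A × A) n}
    (hy : cyc k (A × A) n y = (-1 : k) ^ n • y) (hy' : markedProj k A n y = y) :
    spreadOp k A n (mixOp k A n 0 y) = y := by
  have h : ∀ c ≤ n, mixOp k A n c y = (-1 : k) ^ (n * c) • (cyc k A n ^ c) (mixOp k A n 0 y) := by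
    intro c hc
    induction c with
    | zero => simp
    | succ c ih =>
      have := LinearMap.congr_fun (mixOp_cyc (k := k) (A := A) (show c < n by omega)) y
      rw [LinearMap.comp_apply, LinearMap.comp_apply, hy, map_smul, ih (by omega), map_smul,
        ← Module.End.mul_apply, ← pow_succ'] at this
      rw [mul_add, mul_one, pow_add, mul_comm, mul_smul, ← this, smul_smul, ← pow_add,
        Even.neg_one_pow ⟨n, rfl⟩, one_smul]
  conv_rhs => rw [← hy']
  simp only [spreadOp, markedProj, LinearMap.sum_apply, LinearMap.smul_apply, LinearMap.comp_apply]
  refine Finset.sum_congr rfl fun c _ => ?_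
  rw [h c (Nat.lt_succ_iff.1 c.2), map_smul]

/-- `φ` takes values in `A` on unmarked sequences and values in `A ε` on marked sequences. -/
structure PreservesMarks (p : ℕ) (φ : (ℕ → A × A) → A × A) : Prop where
  snd_eq_zero : ∀ s, (∀ j ≤ p, (s j).2 = 0) → (φ s).2 = 0
  fst_eq_zero : ∀ s, ∀ c ≤ p, IsMarked p c s → (φ s).1 = 0

variable {H : HomAssocAlgebra k A} {n m p q : ℕ} {φ ψ : (ℕ → A × A) → A × A}

/-- The mark stays in place, is absorbed into the value at i, or moves left by p, according to
whether c lies before, among or after the arguments of φ. -/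
theorem PreservesMarks.plug (hφ : PreservesMarks p φ) {i c : ℕ} (hi : i ≤ m) (hc : c ≤ m + p)
    {s : ℕ → A × A} (hs : IsMarked (m + p) c s) :
    ∃ c' ≤ m, IsMarked m c' (H.dual.plug p φ i s) := by
  have e : ∀ {x : A × A}, x.2 = 0 → ((H.dual.α ^ p) x).2 = 0 := fun h => by
    rw [dual_α_pow, h, map_zero]
  have e' : ∀ {x : A × A}, x.1 = 0 → ((H.dual.α ^ p) x).1 = 0 := fun h => by
    rw [dual_α_pow, h, map_zero]
  by_cases h1 : c < i
  · refine ⟨c, by omega, ⟨?_, fun j hj hjc => ?_⟩⟩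
    · rw [HomAssocAlgebra.plug, if_pos h1, e' hs.fst_eq_zero]
    · rw [HomAssocAlgebra.plug]
      split_ifs
      · exact e (hs.snd_eq_zero j (by omega) hjc)
      · exact hφ.snd_eq_zero _ fun l hl => hs.snd_eq_zero _ (by omega) (by omega)
      · exact e (hs.snd_eq_zero _ (by omega) (by omega))
  · by_cases h2 : c ≤ i + p
    · refine ⟨i, hi, ⟨?_, fun j hj hjc => ?_⟩⟩
      · rw [HomAssocAlgebra.plug, if_neg (lt_irrefl i), if_pos rfl]
        refine hφ.fst_eq_zero _ (c - i) (by omega) ⟨?_, fun l hl hlc =>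
          hs.snd_eq_zero _ (by omega) (by omega)⟩
        rw [show i + (c - i) = c by omega, hs.fst_eq_zero]
      · rw [HomAssocAlgebra.plug]
        split_ifs
        · exact e (hs.snd_eq_zero j (by omega) (by omega))
        · exact e (hs.snd_eq_zero _ (by omega) (by omega))
    · refine ⟨c - p, by omega, ⟨?_, fun j hj hjc => ?_⟩⟩
      · rw [HomAssocAlgebra.plug, if_neg (by omega), if_neg (by omega),
          show c - p + p = c by omega, e' hs.fst_eq_zero]
      · rw [HomAssocAlgebra.plug]
        split_ifs
        · exact e (hs.snd_eq_zero j (by omega) (by omega))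
        · exact hφ.snd_eq_zero _ fun l hl => hs.snd_eq_zero _ (by omega) (by omega)
        · exact e (hs.snd_eq_zero _ (by omega) (by omega))

theorem PreservesMarks.markedProj_circOp (h : m + p = n) (hφ : PreservesMarks p φ)
    (hφ' : IsForm k (p + 1) φ) (x : Chains k A n) :
    markedProj k A m (H.dual.circOp h hφ' (spreadOp k A n x)) =
      H.dual.circOp h hφ' (spreadOp k A n x) := by
  have key : ∀ c : Fin (n + 1), markedProj k A m ∘ₗ H.dual.circOp h hφ' ∘ₗ markOp k A n c =
      H.dual.circOp h hφ' ∘ₗ markOp k A n c := by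
    intro c
    refine linearMap_ext_chain fun s => ?_
    simp only [LinearMap.comp_apply, markOp_chain, circOp, LinearMap.sum_apply,
      LinearMap.smul_apply, map_sum, map_smul, insertOp_chain]
    refine Finset.sum_congr rfl fun i _ => ?_
    subst h
    obtain ⟨c', hc', hs⟩ := hφ.plug (H := H) (Nat.lt_succ_iff.1 i.2) (Nat.lt_succ_iff.1 c.2)
      (isMarked_mark _ c.1 s)
    rw [hs.markedProj_chain hc']
  simp only [spreadOp, LinearMap.sum_apply, LinearMap.smul_apply, LinearMap.comp_apply, map_sum,
    map_smul]
  refine Finset.sum_congr rfl fun c _ => ?_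
  have := LinearMap.congr_fun (key c) ((cyc k A n ^ c.1) x)
  simp only [LinearMap.comp_apply] at this
  rw [this]

variable (H) in
/-- The action on chains of a cochain of the dual numbers. -/
noncomputable def markedOp (h : m + p = n) (hφ : IsForm k (p + 1) φ) :
    Chains k A n →ₗ[k] Chains k A m :=
  mixOp k A m 0 ∘ₗ H.dual.circOp h hφ ∘ₗ spreadOp k A n

/-- Insertion leaves the spread chain invariant and marked, so `spreadOp_mixOp` applies. As a
result, composites of `markedOp` reduce to composites of plain insertions over the dual numbers. -/
theorem PreservesMarks.spreadOp_markedOp (h : m + p = n) (hφ : PreservesMarks p φ)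
    (hφ' : IsForm k (p + 1) φ) (x : Chains k A n) :
    spreadOp k A m (H.markedOp h hφ' x) = H.dual.circOp h hφ' (spreadOp k A n x) :=
  spreadOp_mixOp (H.dual.cyc_circOp h hφ' (cyc_spreadOp n x)) (hφ.markedProj_circOp h hφ' x)

theorem markedOp_bracketSeq {n' n₁ n₂ : ℕ} (h : m + (p + q) = n') (h₁ : m + p = n₁)
    (h₁' : n₁ + q = n') (h₂ : m + q = n₂) (h₂' : n₂ + p = n') (hφ : H.dual.IsCoch p φ)
    (hψ : H.dual.IsCoch q ψ) (hφ' : PreservesMarks p φ) (hψ' : PreservesMarks q ψ)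
    (x : Chains k A n') :
    H.markedOp h (hφ.bracketSeq hψ).1 x =
      H.markedOp h₁ hφ.1 (H.markedOp h₁' hψ.1 x) -
        (-1 : k) ^ (p * q) • H.markedOp h₂ hψ.1 (H.markedOp h₂' hφ.1 x) := by
  have e : ∀ {m n p : ℕ} {χ : (ℕ → A × A) → A × A} (h : m + p = n) (hχ : IsForm k (p + 1) χ)
      (y : Chains k A n), H.markedOp h hχ y =
        mixOp k A m 0 (H.dual.circOp h hχ (spreadOp k A n y)) := fun _ _ _ => rfl
  rw [e h, e h₁, e h₂, hφ'.spreadOp_markedOp, hψ'.spreadOp_markedOp,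
    circOp_bracketSeq h h₁ h₁' h₂ h₂' hφ hψ]
  simp

end HomAssocAlgebra

namespace HomAssocAlgebra

variable {k A E : Type*} [CommRing k] [AddCommGroup A] [Module k A] [AddCommGroup E] [Module k E]

/-! ### Cochains of the dual numbers that preserve marks -/

theorem IsForm.eq_zero {M j : ℕ} {F : (ℕ → A) → E} (hF : IsForm k M F) (hj : j < M)
    {s : ℕ → A} (h : s j = 0) : F s = 0 := by
  obtain ⟨L, hL⟩ := hF.exists_linearMap hj s
  rw [← Function.update_eq_self j s, hL, h, map_zero]

theorem preservesMarks_dualExt {p : ℕ} {φ : (ℕ → A) → A} (hφ : IsForm k (p + 1) φ) :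
    PreservesMarks p (dualExt (p + 1) φ) where
  snd_eq_zero s hs := by
    simp only [dualExt]
    refine Finset.sum_eq_zero fun m hm => ?_
    rw [Finset.mem_range] at hm
    exact hφ.eq_zero hm (by rw [mix, if_pos rfl, hs m (by omega)])
  fst_eq_zero s c hc hs := hφ.eq_zero (Nat.lt_succ_of_le hc) hs.fst_eq_zero

theorem dualExt_mark_snd {p c : ℕ} {φ : (ℕ → A) → A} (hφ : IsForm k (p + 1) φ) (s : ℕ → A) :
    (dualExt (p + 1) φ (mark c s)).2 = if c ≤ p then φ s else 0 := by
  have h : ∀ l ∈ Finset.range (p + 1), l ≠ c → φ (mix l (mark c s)) = 0 := fun l hl hlc =>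
    hφ.eq_zero (Finset.mem_range.1 hl) (by rw [mix, if_pos rfl, mark, if_neg hlc])
  simp only [dualExt]
  split_ifs with hc
  · rw [Finset.sum_eq_single c h (fun h' => absurd (Finset.mem_range.2 (by omega)) h'), mix_mark]
  · exact Finset.sum_eq_zero fun l hl => h l hl (by rw [Finset.mem_range] at hl; omega)

theorem preservesMarks_eulerSeq : PreservesMarks 0 (eulerSeq A) :=
  ⟨fun _ hs => hs 0 le_rfl, fun _ _ _ _ => rfl⟩

variable {H : HomAssocAlgebra k A} {n m p q r : ℕ} {φ ψ χ : (ℕ → A × A) → A × A}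

namespace PreservesMarks

theorem comp_plug (hφ : PreservesMarks p φ) (hψ : PreservesMarks q ψ) {i : ℕ} (hi : i ≤ p) :
    PreservesMarks (p + q) fun s => φ (H.dual.plug q ψ i s) where
  snd_eq_zero s hs := by
    refine hφ.snd_eq_zero _ fun j hj => ?_
    rw [HomAssocAlgebra.plug]
    split_ifs
    · rw [dual_α_pow, hs j (by omega), map_zero]
    · exact hψ.snd_eq_zero _ fun l hl => hs _ (by omega)
    · rw [dual_α_pow, hs _ (by omega), map_zero]
  fst_eq_zero s c hc hs := by
    obtain ⟨c', hc', h⟩ := hψ.plug (H := H) hi hc hs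
    exact hφ.fst_eq_zero _ c' hc' h

theorem zsmul (c : ℤ) (hφ : PreservesMarks p φ) : PreservesMarks p (c • φ) where
  snd_eq_zero s hs := by simp [hφ.snd_eq_zero s hs]
  fst_eq_zero s d hd hs := by simp [hφ.fst_eq_zero s d hd hs]

theorem sum {ι : Type*} {t : Finset ι} {F : ι → (ℕ → A × A) → A × A}
    (hF : ∀ i ∈ t, PreservesMarks p (F i)) : PreservesMarks p (∑ i ∈ t, F i) where
  snd_eq_zero s hs := by
    rw [Finset.sum_apply, Prod.snd_sum]
    exact Finset.sum_eq_zero fun i hi => (hF i hi).snd_eq_zero s hs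
  fst_eq_zero s d hd hs := by
    rw [Finset.sum_apply, Prod.fst_sum]
    exact Finset.sum_eq_zero fun i hi => (hF i hi).fst_eq_zero s d hd hs

theorem brace (hχ : PreservesMarks r χ) (hφ : PreservesMarks p φ) (hψ : PreservesMarks q ψ) :
    PreservesMarks (r + p + q) (H.dual.brace (r + 1) χ p φ q ψ) := by
  unfold HomAssocAlgebra.brace
  rw [sum_fun_apply]
  refine PreservesMarks.sum fun i hi => ?_
  rw [sum_fun_apply]
  refine PreservesMarks.sum fun j hj => ?_
  rw [Finset.mem_range] at hi hj
  rw [Nat.add_right_comm]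
  exact ((hχ.comp_plug hψ (show i ≤ r by omega)).comp_plug hφ (by omega)).zsmul _

theorem cupSeq (hφ : PreservesMarks p φ) (hψ : PreservesMarks q ψ) :
    PreservesMarks (p + q + 1) (H.dual.cupSeq p φ q ψ) := by
  have hμ : PreservesMarks 1 H.dual.mulSeq := by
    rw [dual_mulSeq]
    exact preservesMarks_dualExt H.mulSeq_isCoch.1
  have := (hμ.comp_plug (H := H) hφ le_rfl).comp_plug (H := H) hψ (Nat.zero_le _)
  rwa [show 1 + p + q = p + q + 1 by omega] at this

end PreservesMarks

/-! ### Boundary, cap product and Lie derivative as operators on marked chains -/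

/-- `mixOp` at 0 retains only results marked at factor 0. An insertion at a positive position
touches factor 0 only by a power of α, so it requires the unrotated chain; an insertion at 0 may use
every rotation. -/
theorem markedOp_chain (h : m + p = n) (hφ : IsForm k (p + 1) φ) (s : ℕ → A) :
    H.markedOp h hφ (chain k n s) =
      ∑ i ∈ Finset.range m, (-1 : k) ^ (p * (i + 1)) •
          chain k m (mix 0 (H.dual.plug p φ (i + 1) (mark 0 s))) +
        ∑ c ∈ Finset.range (n + 1), (-1 : k) ^ (n * c) •
          chain k m (mix 0 (H.dual.plug p φ 0 (mark c ((rot n)^[c] s)))) := by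
  simp only [markedOp, circOp, spreadOp, LinearMap.comp_apply, LinearMap.sum_apply,
    LinearMap.smul_apply, map_sum, map_smul, cyc_pow_chain, markOp_chain, insertOp_chain,
    mixOp_chain, Finset.sum_range, Finset.smul_sum]
  rw [Finset.sum_comm, Fin.sum_univ_succ, add_comm]
  congr 1
  · refine Finset.sum_congr rfl fun i _ => ?_
    rw [Finset.sum_eq_single 0]
    · simp
    · intro c _ hc
      rw [chain_eq_zero (Nat.zero_le m), smul_zero, smul_zero]
      have hc' : (0 : ℕ) ≠ c := fun h => hc (Fin.ext h.symm)
      rw [mix, if_pos rfl, plug, if_pos (by simp), dual_α_pow, mark, if_neg hc', map_zero]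
    · simp
  · simp

theorem act_chain (h : m + (p + 1) = n + 1) (f : Multi k A (p + 1)) (i : Fin (m + 1))
    (s : ℕ → A) : H.act h f i (chain k n s) = chain k m (H.plug p (unc f) i s) := by
  rw [act, chain, unc, PiTensorProduct.lift.tprod]
  exact congrFun (unc_compAt _ _ i f) s

/-- For insertions at 0 the mark has to be among the p + 1 arguments of f. This cuts the sum over
all rotations down to c ≤ p, which gives the cyclic terms of the Lie derivative. -/
theorem lieDerivative_eq (h : m + (p + 1) = n + 1) (f : Multi k A (p + 1)) :
    H.lieDerivative h f = (-1 : k) ^ p • H.markedOp (Nat.succ_injective h)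
      (IsForm.dualExt ⟨f, rfl⟩ : IsForm k (p + 1) (dualExt (p + 1) (unc f))) := by
  have hf : IsForm k (p + 1) (unc f) := ⟨f, rfl⟩
  refine linearMap_ext_chain fun s => ?_
  rw [LinearMap.smul_apply, markedOp_chain, smul_add, Finset.smul_sum, Finset.smul_sum]
  simp only [lieDerivative, LinearMap.add_apply, LinearMap.sum_apply, LinearMap.smul_apply,
    LinearMap.comp_apply, cyc_pow_chain, act_chain, Nat.add_sub_cancel]
  congr 1
  · rw [Finset.sum_range]
    refine Finset.sum_congr rfl fun i _ => ?_
    rw [smul_smul, ← pow_add]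
    congr 1
    · rw [neg_one_pow_congr]
      simp only [Nat.even_add, Nat.even_mul, Nat.not_even_one, iff_false]
      tauto
    · congr 1
      funext j
      rcases lt_trichotomy j (i + 1) with hj | hj | hj
      · simp only [mix, plug, Fin.val_succ, hj, if_true, dual_α_pow, mark]
        split_ifs <;> rfl
      · subst hj
        simp [mix, plug, dualExt, mark]
      · simp [mix, plug, hj.not_gt, hj.ne', dual_α_pow, mark, show j ≠ 0 by omega]
  · rw [← Finset.sum_subset (Finset.range_subset_range.2 (show p + 1 ≤ n + 1 by omega)),
      Finset.sum_range]
    · refine Finset.sum_congr rfl fun c _ => ?_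
      rw [smul_smul, ← pow_add, add_comm p (n * c.1)]
      congr 2
      funext j
      rcases Nat.eq_zero_or_pos j with rfl | hj
      · rw [mix, if_pos rfl, plug, plug]
        simp [dualExt_mark_snd hf, Nat.lt_succ_iff.1 c.2]
      · simp [mix, plug, hj.ne', dual_α_pow, mark, show j + p ≠ c by omega]
    · intro c _ hc
      rw [Finset.mem_range] at hc
      rw [chain_eq_zero (Nat.zero_le m), smul_zero, smul_zero]
      rw [mix, if_pos rfl, plug]
      simp [dualExt_mark_snd hf, show ¬ c ≤ p by omega]

/-- The boundary is minus the Lie derivative along the product, and this sign cancels the one in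
`lieDerivative_eq`. -/
theorem boundary_eq (n : ℕ) :
    H.boundary n = H.markedOp rfl H.dual.mulSeq_isCoch.1 := by
  have h := H.lieDerivative_eq (show n + (1 + 1) = n + 1 + 1 by omega) H.mulMulti
  have e : H.boundary n =
      (-1 : k) • H.lieDerivative (show n + (1 + 1) = n + 1 + 1 by omega) H.mulMulti := by
    rw [boundary, lieDerivative, Fin.sum_univ_succ, Fin.sum_univ_two, smul_add, smul_add,
      Finset.smul_sum, ← add_assoc, add_comm (_ • _) (Finset.sum _ _)]
    refine congr_arg₂ _ (congr_arg₂ _ ?_ ?_) ?_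
    · refine Finset.sum_congr rfl fun i _ => ?_
      rw [smul_smul]
      congr 1
      simp [pow_succ]
    · rw [smul_smul]
      simp
      rfl
    · rw [smul_smul]
      congr 1
      simp [pow_succ]
  rw [e, h, smul_smul, pow_one, neg_one_mul, neg_neg, one_smul]
  congr 1
  exact dual_mulSeq.symm

theorem cupSeq_eulerSeq_apply (p : ℕ) (φ : (ℕ → A) → A) (s : ℕ → A × A) :
    H.dual.cupSeq p (dualExt (p + 1) φ) 0 (eulerSeq A) s =
      (0, H.μ ((H.α ^ p) (s 0).2) (φ fun l => (s (1 + l)).1)) := by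
  rw [cupSeq_apply, dual_α_pow]
  simp [eulerSeq, dualExt, dual]

/-- The Euler factor forces the mark onto the first argument of the inserted cochain, so only the
insertion at 0 into the unrotated chain survives. -/
theorem cap_eq (h : m + (p + 1) = n) {f : Multi k A (p + 1)} (hf : H.IsCoch p (unc f)) :
    H.cap h f = H.markedOp h (hf.dualExt.cupSeq H.eulerSeq_isCoch).1 := by
  refine linearMap_ext_chain fun s => ?_
  rw [markedOp_chain, cap, act_chain, Finset.sum_eq_zero, zero_add, Finset.sum_eq_single 0]
  · rw [mul_zero, pow_zero, one_smul]
    congr 1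
    funext j
    rcases Nat.eq_zero_or_pos j with rfl | hj
    · simp only [mix, if_true, plug, lt_irrefl, if_false, zero_add, unc_compAt,
        cupSeq_eulerSeq_apply, mark, Function.iterate_zero, id]
      simp [unc, mulMulti, plug]
    · simp [mix, plug, hj.ne', dual_α_pow, mark]
  · intro c _ hc
    rw [chain_eq_zero (Nat.zero_le m), smul_zero]
    simp [mix, plug, cupSeq_eulerSeq_apply, mark, hc.symm]
  · simp
  · intro i hi
    rw [Finset.mem_range] at hi
    rw [chain_eq_zero (show i + 1 ≤ m by omega), smul_zero]
    simp [mix, plug, cupSeq_eulerSeq_apply, mark]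

end HomAssocAlgebra

namespace HomAssocAlgebra

variable {k A : Type*} [CommRing k] [AddCommGroup A] [Module k A]
variable {H : HomAssocAlgebra k A} {n m p q r : ℕ}

/-! ### The operations on cochains as functions of sequences -/

theorem unc_cup (h : p + 1 + (q + 1) = r) (f : Multi k A (p + 1)) (g : Multi k A (q + 1)) :
    unc (H.cup h f g) = H.cupSeq p (unc f) q (unc g) := by
  rw [cup, unc_compAt, unc_compAt]
  rfl

theorem unc_delta (f : Multi k A (p + 1)) :
    unc (H.delta (p + 1) f) = H.deltaSeq p (unc f) := by
  funext s
  simp only [delta, LinearMap.coe_mk, AddHom.coe_mk, unc_add, unc_zsmul, unc_sum, unc_compAt,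
    deltaSeq, circ, Pi.add_apply, Pi.sub_apply, Pi.smul_apply, Finset.sum_apply,
    Finset.sum_range, Fin.sum_univ_two, Fin.val_zero, Fin.val_one, smul_add,
    neg_one_pow_smul_eq_zsmul]
  rw [sub_eq_add_neg, ← Finset.sum_neg_distrib]
  congr 1
  · rw [add_comm]
    congr 1
    · simp [mulSeq, pow_succ]
    · simp [mulSeq, smul_smul, ← mul_pow]
  · refine Finset.sum_congr rfl fun i _ => ?_
    simp [mulSeq, pow_succ]

theorem unc_bracket (h : p + 1 + (q + 1) = r + 1) (f : Multi k A (p + 1))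
    (g : Multi k A (q + 1)) :
    unc (H.bracket h f g) = H.bracketSeq p (unc f) q (unc g) := by
  funext s
  simp only [bracket, unc_sub, unc_zsmul, unc_sum, unc_compAt, bracketSeq, circ, Pi.sub_apply,
    Pi.smul_apply, Finset.sum_apply, Finset.sum_range, neg_one_pow_smul_eq_zsmul,
    Nat.add_sub_cancel]

/-! ### Operators on chains -/

section

variable {φ ψ χ : (ℕ → A × A) → A × A}

theorem circOp_add_zsmul {φ ψ χ : (ℕ → A) → A} (h : m + p = n) (hφ : IsForm k (p + 1) φ)
    (hψ : IsForm k (p + 1) ψ) (hχ : IsForm k (p + 1) χ) {a : ℕ} (e : χ = φ + (-1 : ℤ) ^ a • ψ) :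
    H.circOp h hχ = H.circOp h hφ + (-1 : k) ^ a • H.circOp h hψ := by
  refine linearMap_ext_chain fun s => ?_
  rw [LinearMap.add_apply, LinearMap.smul_apply, circOp_chain, circOp_chain, circOp_chain, e,
    (isForm_chain m).circ_add, (isForm_chain m).circ_zsmul, neg_one_pow_smul_eq_zsmul (k := k)]
  rfl

theorem circOp_zero (h : m + p = n) (hφ : IsForm k (p + 1) (0 : (ℕ → A) → A)) :
    H.circOp h hφ = 0 := by
  refine linearMap_ext_chain fun s => ?_
  rw [circOp_chain, (isForm_chain m).circ_zero]
  rfl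

/-- Chain lengths determine the degree, so the two degrees may be syntactically different
expressions. -/
theorem markedOp_congr (h : m + p = n) (hφ : IsForm k (p + 1) φ) (h' : m + q = n)
    (hψ : IsForm k (q + 1) ψ) (e : φ = ψ) : H.markedOp h hφ = H.markedOp h' hψ := by
  obtain rfl : p = q := by omega
  subst e
  rfl

theorem markedOp_add_zsmul (h : m + p = n) (hφ : IsForm k (p + 1) φ) (h' : m + q = n)
    (hψ : IsForm k (q + 1) ψ) (h'' : m + r = n) (hχ : IsForm k (r + 1) χ) {a : ℕ}
    (e : χ = φ + (-1 : ℤ) ^ a • ψ) (x : Chains k A n) :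
    H.markedOp h'' hχ x = H.markedOp h hφ x + (-1 : k) ^ a • H.markedOp h' hψ x := by
  obtain rfl : p = q := by omega
  obtain rfl : p = r := by omega
  simp only [markedOp, LinearMap.comp_apply, circOp_add_zsmul h hφ hψ hχ e, LinearMap.add_apply,
    LinearMap.smul_apply, map_add, map_smul]

theorem markedOp_zsmul (h : m + p = n) (hφ : IsForm k (p + 1) φ) (h' : m + q = n)
    (hψ : IsForm k (q + 1) ψ) {a : ℕ} (e : ψ = (-1 : ℤ) ^ a • φ) (x : Chains k A n) :
    H.markedOp h' hψ x = (-1 : k) ^ a • H.markedOp h hφ x := by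
  rw [markedOp_add_zsmul h IsForm.zero h hφ h' hψ (e.trans (zero_add _).symm)]
  simp only [markedOp, LinearMap.comp_apply, circOp_zero, LinearMap.zero_apply, map_zero, zero_add]

/-- After spreading, this is a double insertion of the dual product into a tensor, which vanishes by
`circ_circ_mulSeq`. -/
theorem boundary_boundary (n : ℕ) (x : Chains k A (n + 2)) :
    H.boundary n (H.boundary (n + 1) x) = 0 := by
  have hμ : PreservesMarks 1 H.dual.mulSeq := by
    rw [dual_mulSeq]
    exact preservesMarks_dualExt H.mulSeq_isCoch.1
  have e : H.dual.circOp (rfl : n + 1 = n + 1) H.dual.mulSeq_isCoch.1 ∘ₗ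
      H.dual.circOp (rfl : n + 1 + 1 = n + 1 + 1) H.dual.mulSeq_isCoch.1 = 0 := by
    refine linearMap_ext_chain fun s => ?_
    rw [LinearMap.comp_apply, circOp_circOp, circ_circ_mulSeq (isForm_chain n)]
    rfl
  rw [boundary_eq, boundary_eq]
  change mixOp k A n 0 (H.dual.circOp _ _ (spreadOp k A (n + 1) (H.markedOp _ _ x))) = 0
  rw [hμ.spreadOp_markedOp]
  have := LinearMap.congr_fun e (spreadOp k A (n + 2) x)
  rw [LinearMap.comp_apply] at this
  rw [this, LinearMap.zero_apply, map_zero]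

/-- The action of a coboundary is a graded commutator with the boundary. -/
theorem boundary_markedOp (h : m + p = n) (h₁ : m + 1 + p = n + 1) (h₂ : m + (p + 1) = n + 1)
    (hφ : H.dual.IsCoch p φ) (hφ' : PreservesMarks p φ) (x : Chains k A (n + 1)) :
    (-1 : k) ^ p • H.boundary m (H.markedOp h₁ hφ.1 x) =
      H.markedOp h₂ hφ.deltaSeq.1 x + H.markedOp h hφ.1 (H.boundary n x) := by
  have hμ : PreservesMarks 1 H.dual.mulSeq := by
    rw [dual_mulSeq]
    exact preservesMarks_dualExt H.mulSeq_isCoch.1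
  have aux : ∀ {E : Type _} [AddCommGroup E] [Module k E] (x y z : E),
      x = (-1 : k) ^ 1 • (y - (-1 : k) ^ (p * 1) • z) → (-1 : k) ^ p • z = x + y := by
    intro E _ _ x y z h
    rw [h, pow_one, neg_one_smul, mul_one]
    abel
  have e := markedOp_zsmul (H := H) h₂ (hφ.bracketSeq H.dual.mulSeq_isCoch).1 h₂ hφ.deltaSeq.1
    (a := 1) (by rw [deltaSeq_eq_neg_bracketSeq, pow_one, neg_one_zsmul]) x
  rw [markedOp_bracketSeq h₂ h rfl rfl h₁ hφ H.dual.mulSeq_isCoch hφ' hμ, ← boundary_eq,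
    ← boundary_eq] at e
  exact aux _ _ _ e

end

end HomAssocAlgebra

namespace HomAssocAlgebra

variable {k A : Type*} [CommRing k] [AddCommGroup A] [Module k A]
variable {H : HomAssocAlgebra k A} {n m p q r : ℕ}

/-! ### Identities between the operators of cochains -/

theorem deltaSeq_eulerSeq : H.dual.deltaSeq 0 (eulerSeq A) = 0 := by
  rw [deltaSeq_eq_neg_bracketSeq, bracketSeq_skew, dual_mulSeq, bracketSeq_eulerSeq H.mulSeq_isCoch]
  simp

theorem deltaSeq_cupSeq_eulerSeq {φ : (ℕ → A) → A} (hφ : H.IsCoch p φ) :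
    H.dual.deltaSeq (p + 1) (H.dual.cupSeq p (dualExt (p + 1) φ) 0 (eulerSeq A)) =
      (-1 : ℤ) ^ 1 • H.dual.cupSeq (p + 1) (dualExt (p + 2) (H.deltaSeq p φ)) 0 (eulerSeq A) := by
  have h := deltaSeq_cupSeq hφ.dualExt H.eulerSeq_isCoch
  have h0 : H.dual.cupSeq p (dualExt (p + 1) φ) (0 + 1) 0 = 0 := by
    simpa using cupSeq_zsmul_right (H := H.dual) (p := p) (q := 0 + 1) 0 (dualExt (p + 1) φ) 0
  rw [deltaSeq_eulerSeq, h0, zero_add] at h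
  rw [dualExt_deltaSeq hφ]
  exact h

theorem delta_mem_cochains {f : Multi k A p} (hf : f ∈ H.cochains p) :
    H.delta p f ∈ H.cochains (p + 1) := by
  cases p with
  | zero => rw [hf.2 rfl, map_zero]; exact zero_mem _
  | succ p =>
    rw [← isCoch_unc_iff, unc_delta]
    exact (isCoch_unc_iff.2 hf).deltaSeq

theorem delta_delta {f : Multi k A p} (hf : f ∈ H.cochains p) :
    H.delta (p + 1) (H.delta p f) = 0 := by
  cases p with
  | zero => rw [hf.2 rfl, map_zero, map_zero]
  | succ p =>
    refine unc_injective ?_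
    rw [unc_delta, unc_delta, deltaSeq_deltaSeq (isCoch_unc_iff.2 hf)]
    rfl

/-- `boundary_markedOp` for f ∪ e, with e the Euler derivation: since e is a cocycle, the coboundary
of f ∪ e is -(δf ∪ e). -/
theorem boundary_cap (h : m + (p + 1) = n) (h₁ : m + 1 + (p + 1) = n + 1)
    (h₂ : m + (p + 1 + 1) = n + 1) {f : Multi k A (p + 1)} (hf : f ∈ H.cochains (p + 1))
    (x : Chains k A (n + 1)) :
    (-1 : k) ^ (p + 1) • H.boundary m (H.cap h₁ f x) + H.cap h₂ (H.delta (p + 1) f) x =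
      H.cap h f (H.boundary n x) := by
  have hφ := isCoch_unc_iff.2 hf
  have hδ : H.IsCoch (p + 1) (unc (H.delta (p + 1) f)) :=
    isCoch_unc_iff.2 (delta_mem_cochains hf)
  have e := boundary_markedOp h h₁ h₂ (hφ.dualExt.cupSeq H.eulerSeq_isCoch)
    ((preservesMarks_dualExt hφ.1).cupSeq preservesMarks_eulerSeq) x
  rw [markedOp_zsmul (H := H) h₂ (hδ.dualExt.cupSeq H.eulerSeq_isCoch).1 h₂
    (hφ.dualExt.cupSeq H.eulerSeq_isCoch).deltaSeq.1 (a := 1)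
    (by rw [unc_delta]; exact deltaSeq_cupSeq_eulerSeq hφ)] at e
  rw [cap_eq h hφ, cap_eq h₁ hφ, cap_eq h₂ hδ]
  have aux : ∀ {E : Type _} [AddCommGroup E] [Module k E] (x y z : E),
      x = (-1 : k) ^ 1 • y + z → x + y = z := by
    intro E _ _ x y z h
    rw [h, pow_one, neg_one_smul]
    abel
  exact aux _ _ _ e

theorem boundary_lieDerivative (h : m + (p + 1) = n + 1) (h₁ : m + 1 + (p + 1) = n + 1 + 1)
    (h₂ : m + (p + 1 + 1) = n + 1 + 1) {f : Multi k A (p + 1)} (hf : f ∈ H.cochains (p + 1))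
    (x : Chains k A (n + 1)) :
    H.boundary m (H.lieDerivative h₁ f x) +
        (-1 : k) ^ p • H.lieDerivative h₂ (H.delta (p + 1) f) x =
      (-1 : k) ^ p • H.lieDerivative h f (H.boundary n x) := by
  have hφ := isCoch_unc_iff.2 hf
  have hδ : H.IsCoch (p + 1) (unc (H.delta (p + 1) f)) :=
    isCoch_unc_iff.2 (delta_mem_cochains hf)
  have e := boundary_markedOp (Nat.succ_injective h) (Nat.succ_injective h₁)
    (Nat.succ_injective h₂) hφ.dualExt (preservesMarks_dualExt hφ.1) x
  rw [markedOp_congr _ hφ.dualExt.deltaSeq.1 (Nat.succ_injective h₂) hδ.dualExt.1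
    (by rw [unc_delta]; exact (dualExt_deltaSeq hφ).symm)] at e
  rw [lieDerivative_eq, lieDerivative_eq, lieDerivative_eq, LinearMap.smul_apply,
    LinearMap.smul_apply, LinearMap.smul_apply, map_smul]
  have aux : ∀ {E : Type _} [AddCommGroup E] [Module k E] (x y z : E),
      (-1 : k) ^ p • x = y + z →
      (-1 : k) ^ p • x + (-1 : k) ^ p • (-1 : k) ^ (p + 1) • y = (-1 : k) ^ p • (-1 : k) ^ p • z := by
    intro E _ _ x y z h
    rw [h, smul_smul, smul_smul, ← pow_add, ← pow_add, ← add_assoc, pow_succ,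
      Even.neg_one_pow ⟨p, rfl⟩]
    simp
  exact aux _ _ _ e

theorem lieDerivative_bracket {n' n₁ n₂ : ℕ} (h : m + (p + q + 1) = n' + 1)
    (h₁ : m + (p + 1) = n₁ + 1) (h₁' : n₁ + (q + 1) = n' + 1) (h₂ : m + (q + 1) = n₂ + 1)
    (h₂' : n₂ + (p + 1) = n' + 1) (hb : p + 1 + (q + 1) = p + q + 1 + 1)
    {f : Multi k A (p + 1)} (hf : f ∈ H.cochains (p + 1))
    {g : Multi k A (q + 1)} (hg : g ∈ H.cochains (q + 1)) (x : Chains k A n') :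
    H.lieDerivative h (H.bracket hb f g) x =
      H.lieDerivative h₁ f (H.lieDerivative h₁' g x) -
        (-1 : k) ^ (p * q) • H.lieDerivative h₂ g (H.lieDerivative h₂' f x) := by
  have hφ := isCoch_unc_iff.2 hf
  have hψ := isCoch_unc_iff.2 hg
  have e := markedOp_bracketSeq (show m + (p + q) = n' by omega) (Nat.succ_injective h₁)
    (Nat.succ_injective h₁') (Nat.succ_injective h₂) (Nat.succ_injective h₂') hφ.dualExt
    hψ.dualExt (preservesMarks_dualExt hφ.1) (preservesMarks_dualExt hψ.1) x
  rw [markedOp_congr _ (hφ.dualExt.bracketSeq hψ.dualExt).1 (Nat.succ_injective h)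
    (IsForm.dualExt ⟨H.bracket hb f g, rfl⟩)
    (by rw [unc_bracket]; exact (dualExt_bracketSeq hφ hψ).symm)] at e
  simp only [lieDerivative_eq, LinearMap.smul_apply, map_smul, e]
  have aux : ∀ {E : Type _} [AddCommGroup E] [Module k E] (y z : E),
      (-1 : k) ^ (p + q) • (y - (-1 : k) ^ (p * q) • z) = (-1 : k) ^ q • (-1 : k) ^ p • y -
        (-1 : k) ^ (p * q) • (-1 : k) ^ p • (-1 : k) ^ q • z := by
    intro E _ _ y z
    rw [smul_sub, smul_smul, smul_smul, smul_smul, smul_smul, ← pow_add, ← pow_add, mul_assoc,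
      ← pow_add, ← pow_add, add_comm (p + q), add_comm q]
  exact aux (E := Chains k A m) _ _

theorem cap_chain (h : m + (p + 1) = n) (f : Multi k A (p + 1)) (s : ℕ → A) :
    H.cap h f (chain k n s) = chain k m fun j =>
      if j = 0 then H.μ ((H.α ^ p) (s 0)) (unc f fun l => s (1 + l))
      else (H.α ^ (p + 1)) (s (j + (p + 1))) := by
  rw [cap, act_chain]
  congr 1
  funext j
  rcases Nat.eq_zero_or_pos j with rfl | hj
  · simp only [plug, Fin.val_zero, lt_irrefl, if_false, if_true, zero_add, unc_compAt]
    rfl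
  · simp [plug, hj.ne']

theorem α_pow_mul (n : ℕ) (x y : A) :
    (H.α ^ n) (H.μ x y) = H.μ ((H.α ^ n) x) ((H.α ^ n) y) := by
  induction n with
  | zero => simp
  | succ n ih => simp only [pow_succ', Module.End.mul_apply, ih, H.multiplicative]

/-- At factor 0 this is hom-associativity, after equivariance of f exposes an α; elsewhere exponents
of α add. It holds for chains, without passing to homology. -/
theorem cap_cup {n₁ : ℕ} (hc : p + 1 + (q + 1) = r + 1) (h : m + (r + 1) = n) (h₁ : m + (p + 1) = n₁)
    (h₂ : n₁ + (q + 1) = n) {f : Multi k A (p + 1)} (hf : f ∈ H.cochains (p + 1))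
    (g : Multi k A (q + 1)) (x : Chains k A n) :
    H.cap h (H.cup hc f g) x = H.cap h₁ f (H.cap h₂ g x) := by
  obtain rfl : p + q + 1 = r := by omega
  have hφ := isCoch_unc_iff.2 hf
  have key : H.cap h (H.cup hc f g) = H.cap h₁ f ∘ₗ H.cap h₂ g := by
    refine linearMap_ext_chain fun s => ?_
    rw [LinearMap.comp_apply, cap_chain, cap_chain, cap_chain]
    congr 1
    funext j
    rcases Nat.eq_zero_or_pos j with rfl | hj
    · have e : (H.α ^ (p + q + 1)) (s 0) = H.α ((H.α ^ p) ((H.α ^ q) (s 0))) := by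
        rw [← Module.End.mul_apply, ← Module.End.mul_apply, mul_assoc, ← pow_add, ← pow_succ']
      have e' : ∀ l, (H.α ^ (q + 1)) (s (1 + l + (q + 1))) =
          H.α ((H.α ^ q) (s (1 + (1 + l + q)))) := fun l => by
        rw [pow_succ', Module.End.mul_apply]
        congr 3
        omega
      simp only [if_true, unc_cup hc, cupSeq_apply,
        show ∀ l, 1 + l ≠ 0 from fun l => by omega, if_false, α_pow_mul, e, e', ← hφ.2,
        H.hom_assoc]
    · simp only [hj.ne', if_false, show j + (p + 1) ≠ 0 by omega]
      rw [← Module.End.mul_apply, ← pow_add]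
      congr 2
      · omega
      · omega
  exact LinearMap.congr_fun key x

/-- Over the dual numbers, let e be the Euler derivation. The bracket of g with f ∪ e acts as the
commutator of L_g and i_f up to sign. By the Leibniz rule it differs from [g, f] ∪ e by the
coboundary of g{e, f}, since [g, e] = 0, and that coboundary takes the cycle x to a boundary. -/
theorem cap_bracket {n' n₁ n₂ : ℕ} (h : m + (p + q + 1) = n' + 1)
    (h₁ : m + (p + 1) = n₁) (h₁' : n₁ + (q + 1) = n' + 1 + 1) (h₂ : m + (q + 1) = n₂ + 1)
    (h₂' : n₂ + (p + 1) = n' + 1) (hb : p + 1 + (q + 1) = p + q + 1 + 1)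
    {f : Multi k A (p + 1)} (hf : f ∈ H.cocycles (p + 1))
    {g : Multi k A (q + 1)} (hg : g ∈ H.cocycles (q + 1)) {x : Chains k A (n' + 1)}
    (hx : H.boundary n' x = 0) :
    ∃ y, H.cap h (H.bracket hb f g) x =
      H.cap h₁ f (H.lieDerivative h₁' g x) -
        (-1 : k) ^ ((p + 1) * q) • H.lieDerivative h₂ g (H.cap h₂' f x) + H.boundary m y := by
  have hφ := isCoch_unc_iff.2 hf.1
  have hψ := isCoch_unc_iff.2 hg.1
  have hβ : H.IsCoch (p + q) (unc (H.bracket hb f g)) := by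
    rw [unc_bracket]
    exact hφ.bracketSeq hψ
  have hφ0 : H.dual.deltaSeq p (dualExt (p + 1) (unc f)) = 0 := by
    rw [← dualExt_deltaSeq hφ, ← unc_delta, show H.delta (p + 1) f = 0 from hf.2]
    funext s
    ext <;> simp [dualExt, unc_zero]
  have hψ0 : H.dual.deltaSeq q (dualExt (q + 1) (unc g)) = 0 := by
    rw [← dualExt_deltaSeq hψ, ← unc_delta, show H.delta (q + 1) g = 0 from hg.2]
    funext s
    ext <;> simp [dualExt, unc_zero]
  have e := bracketSeq_cupSeq H.eulerSeq_isCoch hφ.dualExt hψ.dualExt deltaSeq_eulerSeq hφ0 hψ0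
  have h0 : H.dual.cupSeq p (dualExt (p + 1) (unc f)) (q + 0) 0 = 0 := by
    simpa using cupSeq_zsmul_right (H := H.dual) (p := p) (q := q + 0) 0
      (dualExt (p + 1) (unc f)) 0
  have hβ' : H.dual.bracketSeq q (dualExt (q + 1) (unc g)) p (dualExt (p + 1) (unc f)) =
      (-1 : ℤ) ^ (q * p + 1) • dualExt (p + q + 1) (unc (H.bracket hb f g)) := by
    rw [bracketSeq_skew, unc_bracket, dualExt_bracketSeq hφ hψ, pow_succ, mul_neg_one, neg_smul]
  rw [bracketSeq_eulerSeq hψ, h0, smul_zero, add_zero (HomAssocAlgebra.cupSeq _ _ _ _ _), pow_zero, one_smul, hβ',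
    cupSeq_zsmul_left] at e
  have hB := hψ.dualExt.brace H.eulerSeq_isCoch hφ.dualExt
  have hcup := hφ.dualExt.cupSeq H.eulerSeq_isCoch
  have e₁ := markedOp_add_zsmul (H := H) (show m + (q + 0 + p + 1) = n' + 1 by omega)
    hB.deltaSeq.1 (show m + (p + q + 0 + 1) = n' + 1 by omega)
    (hβ.dualExt.cupSeq H.eulerSeq_isCoch).1 (show m + (q + (p + 0 + 1)) = n' + 1 by omega)
    (hψ.dualExt.bracketSeq hcup).1 (a := q * p + 1)
    (e.trans ((add_comm _ _).trans (by rw [add_comm q p]))) x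
  have e₂ := boundary_markedOp (show m + (q + 0 + p) = n' by omega)
    (show m + 1 + (q + 0 + p) = n' + 1 by omega)
    (show m + (q + 0 + p + 1) = n' + 1 by omega) hB
    ((preservesMarks_dualExt hψ.1).brace preservesMarks_eulerSeq (preservesMarks_dualExt hφ.1)) x
  rw [hx, map_zero] at e₂
  replace e₂ := e₂.trans (add_zero _)
  rw [markedOp_bracketSeq _ (Nat.succ_injective h₂) (show n₂ + (p + 0 + 1) = n' + 1 from h₂') h₁
    (Nat.succ_injective h₁') hψ.dualExt hcup (preservesMarks_dualExt hψ.1)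
    ((preservesMarks_dualExt hφ.1).cupSeq preservesMarks_eulerSeq), ← e₂] at e₁
  -- The witness is, up to sign, the action on x of the homotopy g{e, f}.
  refine ⟨(-1 : k) ^ (q * p) • (-1 : k) ^ (q + 0 + p) •
    H.markedOp (show m + 1 + (q + 0 + p) = n' + 1 by omega) hB.1 x, ?_⟩
  rw [cap_eq h hβ, cap_eq h₁ hφ, cap_eq h₂' hφ, lieDerivative_eq, lieDerivative_eq,
    LinearMap.smul_apply, LinearMap.smul_apply, map_smul, map_smul, map_smul]
  have aux : ∀ {E : Type _} [AddCommGroup E] [Module k E] (a b c d : E),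
      a - (-1 : k) ^ (q * (p + 0 + 1)) • b = d + (-1 : k) ^ (q * p + 1) • c →
      c = (-1 : k) ^ q • b - (-1 : k) ^ ((p + 1) * q) • (-1 : k) ^ q • a +
        (-1 : k) ^ (q * p) • d := by
    intro E _ _ a b c d h
    rcases Nat.even_or_odd p with hp | hp <;> rcases Nat.even_or_odd q with hq | hq <;>
      simp [pow_add, pow_mul, mul_add, add_mul, hp.neg_one_pow, hq.neg_one_pow] at h ⊢ <;>
      first
      | linear_combination (norm := module) (-1 : k) • h
      | linear_combination (norm := module) (1 : k) • h
  exact aux (E := Chains k A m) _ _ _ _ e₁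

end HomAssocAlgebra

namespace HomAssocAlgebra

variable {k A : Type*} [CommRing k] [AddCommGroup A] [Module k A]
variable {H : HomAssocAlgebra k A} {n m p q r : ℕ} {φ φ' ψ : (ℕ → A) → A}

/-! ### Cocycles and coboundaries as functions of sequences -/

variable (H) in
/-- `φ` is a Hochschild cocycle of arity `p + 1`. -/
structure IsCocycle (p : ℕ) (φ : (ℕ → A) → A) : Prop where
  isCoch : H.IsCoch p φ
  deltaSeq_eq_zero : H.deltaSeq p φ = 0

variable (H) in
/-- `φ` is a Hochschild coboundary of arity `p + 1`. -/
def IsCoboundary (p : ℕ) (φ : (ℕ → A) → A) : Prop :=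
  -- The alternative φ = 0 serves p = 0, where no cochain has smaller positive arity.
  φ = 0 ∨ ∃ s β, s + 1 = p ∧ H.IsCoch s β ∧ φ = H.deltaSeq s β

theorem isCocycle_unc_iff {f : Multi k A (p + 1)} :
    H.IsCocycle p (unc f) ↔ f ∈ H.cocycles (p + 1) := by
  constructor
  · rintro ⟨h1, h2⟩
    exact ⟨isCoch_unc_iff.1 h1, unc_injective (by rw [unc_delta, h2]; rfl)⟩
  · rintro ⟨h1, h2⟩
    exact ⟨isCoch_unc_iff.2 h1, by
      rw [← unc_delta, show H.delta (p + 1) f = 0 from h2, unc_zero]⟩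

theorem isCoboundary_unc_iff {f : Multi k A (p + 1)} :
    H.IsCoboundary p (unc f) ↔ f ∈ H.coboundaries (p + 1) := by
  constructor
  · rintro (h | ⟨s, β, rfl, hβ, h⟩)
    · rw [unc_injective (h.trans unc_zero.symm)]
      exact zero_mem _
    · obtain ⟨b, rfl⟩ := hβ.1
      exact ⟨b, isCoch_unc_iff.1 hβ, unc_injective (by rw [unc_delta, h])⟩
  · rintro ⟨g, hg, rfl⟩
    cases p with
    | zero => exact Or.inl (by rw [hg.2 rfl, map_zero, unc_zero])
    | succ p => exact Or.inr ⟨p, unc g, rfl, isCoch_unc_iff.2 hg, unc_delta g⟩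

theorem deltaSeq_zsmul (c : ℤ) (φ : (ℕ → A) → A) :
    H.deltaSeq p (c • φ) = c • H.deltaSeq p φ := by
  rw [deltaSeq, deltaSeq, H.mulSeq_isCoch.1.circ_zsmul, circ_zsmul_left, smul_sub, smul_comm c]

theorem deltaSeq_add (φ ψ : (ℕ → A) → A) :
    H.deltaSeq p (φ + ψ) = H.deltaSeq p φ + H.deltaSeq p ψ := by
  rw [deltaSeq, deltaSeq, deltaSeq, H.mulSeq_isCoch.1.circ_add, circ_add_left, smul_add]
  abel

theorem cupSeq_zero_left : H.cupSeq p 0 q ψ = 0 := by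
  simpa using cupSeq_zsmul_left (H := H) (p := p) (q := q) 0 0 ψ

theorem cupSeq_zero_right : H.cupSeq p φ q 0 = 0 := by
  simpa using cupSeq_zsmul_right (H := H) (p := p) (q := q) 0 φ 0

theorem bracketSeq_zero_right (hφ : H.IsCoch p φ) : H.bracketSeq p φ q 0 = 0 := by
  rw [bracketSeq, hφ.1.circ_zero, circ_zero_left, smul_zero, sub_zero]

theorem bracketSeq_zero_left (hψ : H.IsCoch q ψ) : H.bracketSeq p 0 q ψ = 0 := by
  rw [bracketSeq_skew, bracketSeq_zero_right hψ, smul_zero, neg_zero]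

theorem IsCoboundary.zsmul (c : ℤ) (hφ : H.IsCoboundary p φ) : H.IsCoboundary p (c • φ) := by
  obtain rfl | ⟨s, β, h, hβ, rfl⟩ := hφ
  · exact Or.inl (smul_zero c)
  · exact Or.inr ⟨s, c • β, h, hβ.zsmul c, (deltaSeq_zsmul c β).symm⟩

theorem IsCoboundary.of_deltaSeq (hφ : H.IsCoch p φ) :
    H.IsCoboundary (p + 1) (H.deltaSeq p φ) :=
  Or.inr ⟨p, φ, rfl, hφ, rfl⟩

namespace IsCocycle

theorem zsmul (c : ℤ) (hφ : H.IsCocycle p φ) : H.IsCocycle p (c • φ) :=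
  ⟨hφ.1.zsmul c, by rw [deltaSeq_zsmul, hφ.2, smul_zero]⟩

theorem add (hφ : H.IsCocycle p φ) (hψ : H.IsCocycle p ψ) : H.IsCocycle p (φ + ψ) :=
  ⟨hφ.1.add hψ.1, by rw [deltaSeq_add, hφ.2, hψ.2, add_zero]⟩

theorem cupSeq (hφ : H.IsCocycle p φ) (hψ : H.IsCocycle q ψ) :
    H.IsCocycle (p + q + 1) (H.cupSeq p φ q ψ) :=
  ⟨hφ.1.cupSeq hψ.1, by
    rw [deltaSeq_cupSeq hφ.1 hψ.1, hφ.2, hψ.2, cupSeq_zero_left, cupSeq_zero_right, smul_zero,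
      add_zero]⟩

theorem bracketSeq (hφ : H.IsCocycle p φ) (hψ : H.IsCocycle q ψ) :
    H.IsCocycle (p + q) (H.bracketSeq p φ q ψ) :=
  ⟨hφ.1.bracketSeq hψ.1, by
    rw [deltaSeq_bracketSeq hφ.1 hψ.1, hφ.2, hψ.2, bracketSeq_zero_left hψ.1,
      bracketSeq_zero_right hφ.1, smul_zero, add_zero]⟩

end IsCocycle

theorem neg_one_pow_smul_cancel {E : Type*} [AddCommGroup E] (a : ℕ) (x : E) :
    (-1 : ℤ) ^ a • (-1 : ℤ) ^ a • x = x := by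
  rw [smul_smul, ← pow_add, Even.neg_one_pow ⟨a, rfl⟩, one_smul]

/-- If φ = δβ, then β ∪ ψ is a primitive up to sign, by the derivation rule and δψ = 0. -/
theorem IsCoboundary.cupSeq_left (hφ : H.IsCoboundary p φ) (hψ : H.IsCocycle q ψ) :
    H.IsCoboundary (p + q + 1) (H.cupSeq p φ q ψ) := by
  obtain rfl | ⟨s, β, rfl, hβ, rfl⟩ := hφ
  · exact Or.inl cupSeq_zero_left
  · have h := deltaSeq_cupSeq hβ hψ.1
    rw [hψ.2, cupSeq_zero_right, zero_add] at h
    have := (IsCoboundary.of_deltaSeq (hβ.cupSeq hψ.1)).zsmul ((-1) ^ (q + 1))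
    rwa [h, neg_one_pow_smul_cancel, show s + q + 1 + 1 = s + 1 + q + 1 by omega] at this

theorem IsCoboundary.cupSeq_right (hφ : H.IsCocycle p φ) (hψ : H.IsCoboundary q ψ) :
    H.IsCoboundary (p + q + 1) (H.cupSeq p φ q ψ) := by
  obtain rfl | ⟨s, β, rfl, hβ, rfl⟩ := hψ
  · exact Or.inl cupSeq_zero_right
  · have h := deltaSeq_cupSeq hφ.1 hβ
    rw [hφ.2, cupSeq_zero_left, smul_zero, add_zero] at h
    rw [← h]
    exact IsCoboundary.of_deltaSeq (hφ.1.cupSeq hβ)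

theorem IsCoboundary.bracketSeq_left (hφ : H.IsCoboundary p φ) (hψ : H.IsCocycle q ψ) :
    H.IsCoboundary (p + q) (H.bracketSeq p φ q ψ) := by
  obtain rfl | ⟨s, β, rfl, hβ, rfl⟩ := hφ
  · exact Or.inl (bracketSeq_zero_left hψ.1)
  · have h := deltaSeq_bracketSeq hβ hψ.1
    rw [hψ.2, bracketSeq_zero_right hβ, zero_add] at h
    have := (IsCoboundary.of_deltaSeq (hβ.bracketSeq hψ.1)).zsmul ((-1) ^ q)
    rwa [h, neg_one_pow_smul_cancel, show s + q + 1 = s + 1 + q by omega] at this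

theorem IsCoboundary.bracketSeq_right (hφ : H.IsCocycle p φ) (hψ : H.IsCoboundary q ψ) :
    H.IsCoboundary (p + q) (H.bracketSeq p φ q ψ) := by
  obtain rfl | ⟨s, β, rfl, hβ, rfl⟩ := hψ
  · exact Or.inl (bracketSeq_zero_right hφ.1)
  · have h := deltaSeq_bracketSeq hφ.1 hβ
    rw [hφ.2, bracketSeq_zero_left hβ, smul_zero, add_zero] at h
    rw [← h]
    exact IsCoboundary.of_deltaSeq (hφ.1.bracketSeq hβ)

/-! ### The operations as bilinear maps -/

section bilinear

variable (H)

/-- The cup product of multilinear maps as a bilinear map. -/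
def cupMap (h : p + q = r) : Multi k A p →ₗ[k] Multi k A q →ₗ[k] Multi k A r :=
  LinearMap.mk₂ k (H.cup h)
    (fun f f' g => by rw [cup, compAt_add_right]; rfl)
    (fun c f g => by rw [cup, compAt_smul_right]; rfl)
    (fun f g g' => by rw [cup, compAt_add_right]; rfl)
    (fun c f g => by rw [cup, compAt_smul_right]; rfl)

/-- The Gerstenhaber bracket of multilinear maps as a bilinear map. -/
def bracketMap (h : p + q = r + 1) : Multi k A p →ₗ[k] Multi k A q →ₗ[k] Multi k A r :=
  have e : ∀ {p q : ℕ} (h : r + 1 = p + q) (f f' : Multi k A p) (i : Fin p) (g : Multi k A q),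
      H.compAt h (f + f') i g = H.compAt h f i g + H.compAt h f' i g := fun _ _ _ _ _ => rfl
  have e' : ∀ {p q : ℕ} (h : r + 1 = p + q) (c : k) (f : Multi k A p) (i : Fin p)
      (g : Multi k A q), H.compAt h (c • f) i g = c • H.compAt h f i g := fun _ _ _ _ _ => rfl
  LinearMap.mk₂ k (H.bracket h)
    (fun f f' g => by
      simp only [bracket, compAt_add_right, e, smul_add, Finset.sum_add_distrib]
      abel)
    (fun c f g => by
      simp only [bracket, compAt_smul_right, e', smul_sub, Finset.smul_sum, smul_comm _ c])
    (fun f g g' => by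
      simp only [bracket, compAt_add_right, e, smul_add, Finset.sum_add_distrib]
      abel)
    (fun c f g => by
      simp only [bracket, compAt_smul_right, e', smul_sub, Finset.smul_sum, smul_comm _ c])

theorem act_add (h : m + p = n + 1) (f g : Multi k A p) (i : Fin (m + 1)) :
    H.act h (f + g) i = H.act h f i + H.act h g i := by
  rw [act, compAt_add_right, map_add]
  rfl

theorem act_smul (h : m + p = n + 1) (c : k) (f : Multi k A p) (i : Fin (m + 1)) :
    H.act h (c • f) i = c • H.act h f i := by
  rw [act, compAt_smul_right, map_smul]
  rfl

/-- The cap product as a bilinear map. -/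
noncomputable def capMap (h : m + p = n) : Multi k A p →ₗ[k] Chains k A n →ₗ[k] Chains k A m where
  toFun := H.cap h
  map_add' f g := by rw [cap, compAt_add_right, act_add]; rfl
  map_smul' c f := by rw [cap, compAt_smul_right, act_smul]; rfl

/-- The Lie derivative as a bilinear map. -/
noncomputable def lieMap (h : m + p = n + 1) :
    Multi k A p →ₗ[k] Chains k A n →ₗ[k] Chains k A m where
  toFun := H.lieDerivative h
  map_add' f g := by
    simp only [lieDerivative, act_add, smul_add, LinearMap.add_comp, Finset.sum_add_distrib]
    exact add_add_add_comm _ _ _ _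
  map_smul' c f := by
    simp only [lieDerivative, act_smul, smul_add, LinearMap.smul_comp, Finset.smul_sum,
      smul_comm _ c, RingHom.id_apply]

theorem cap_zero (h : m + p = n) (x : Chains k A n) : H.cap h 0 x = 0 :=
  LinearMap.map_zero₂ (H.capMap h) x

theorem lieDerivative_zero (h : m + p = n + 1) (x : Chains k A n) :
    H.lieDerivative h 0 x = 0 :=
  LinearMap.map_zero₂ (H.lieMap h) x

end bilinear

/-! ### The operations preserve cocycles and coboundaries -/

/-- There are no nonzero cochains of arity 0, so bilinearity disposes of that case and the sequence
calculus covers positive arities. -/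
theorem cup_mem_cocycles (h : p + q = r) {f : Multi k A p} (hf : f ∈ H.cocycles p)
    {g : Multi k A q} (hg : g ∈ H.cocycles q) : H.cup h f g ∈ H.cocycles r := by
  change H.cupMap h f g ∈ _
  obtain _ | p := p
  · rw [hf.1.2 rfl, LinearMap.map_zero₂]
    exact zero_mem _
  obtain _ | q := q
  · rw [hg.1.2 rfl, map_zero]
    exact zero_mem _
  obtain rfl : p + q + 1 + 1 = r := by omega
  rw [← isCocycle_unc_iff]
  change H.IsCocycle _ (unc (H.cup h f g))
  rw [unc_cup]
  exact (isCocycle_unc_iff.2 hf).cupSeq (isCocycle_unc_iff.2 hg)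

theorem cup_mem_coboundaries_left (h : p + q = r) {f : Multi k A p} (hf : f ∈ H.coboundaries p)
    {g : Multi k A q} (hg : g ∈ H.cocycles q) : H.cup h f g ∈ H.coboundaries r := by
  change H.cupMap h f g ∈ _
  obtain _ | p := p
  · rw [show f = 0 from hf, LinearMap.map_zero₂]
    exact zero_mem _
  obtain _ | q := q
  · rw [hg.1.2 rfl, map_zero]
    exact zero_mem _
  obtain rfl : p + q + 1 + 1 = r := by omega
  rw [← isCoboundary_unc_iff]
  change H.IsCoboundary _ (unc (H.cup h f g))
  rw [unc_cup]
  exact (isCoboundary_unc_iff.2 hf).cupSeq_left (isCocycle_unc_iff.2 hg)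

theorem cup_mem_coboundaries_right (h : p + q = r) {f : Multi k A p} (hf : f ∈ H.cocycles p)
    {g : Multi k A q} (hg : g ∈ H.coboundaries q) : H.cup h f g ∈ H.coboundaries r := by
  change H.cupMap h f g ∈ _
  obtain _ | p := p
  · rw [hf.1.2 rfl, LinearMap.map_zero₂]
    exact zero_mem _
  obtain _ | q := q
  · rw [show g = 0 from hg, map_zero]
    exact zero_mem _
  obtain rfl : p + q + 1 + 1 = r := by omega
  rw [← isCoboundary_unc_iff]
  change H.IsCoboundary _ (unc (H.cup h f g))
  rw [unc_cup]
  exact IsCoboundary.cupSeq_right (isCocycle_unc_iff.2 hf) (isCoboundary_unc_iff.2 hg)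

theorem bracket_mem_cocycles (h : p + q = r + 1) {f : Multi k A p} (hf : f ∈ H.cocycles p)
    {g : Multi k A q} (hg : g ∈ H.cocycles q) : H.bracket h f g ∈ H.cocycles r := by
  change H.bracketMap h f g ∈ _
  obtain _ | p := p
  · rw [hf.1.2 rfl, LinearMap.map_zero₂]
    exact zero_mem _
  obtain _ | q := q
  · rw [hg.1.2 rfl, map_zero]
    exact zero_mem _
  obtain rfl : p + q + 1 = r := by omega
  rw [← isCocycle_unc_iff]
  change H.IsCocycle _ (unc (H.bracket h f g))
  rw [unc_bracket]
  exact (isCocycle_unc_iff.2 hf).bracketSeq (isCocycle_unc_iff.2 hg)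

theorem bracket_mem_coboundaries_left (h : p + q = r + 1) {f : Multi k A p}
    (hf : f ∈ H.coboundaries p) {g : Multi k A q} (hg : g ∈ H.cocycles q) :
    H.bracket h f g ∈ H.coboundaries r := by
  change H.bracketMap h f g ∈ _
  obtain _ | p := p
  · rw [show f = 0 from hf, LinearMap.map_zero₂]
    exact zero_mem _
  obtain _ | q := q
  · rw [hg.1.2 rfl, map_zero]
    exact zero_mem _
  obtain rfl : p + q + 1 = r := by omega
  rw [← isCoboundary_unc_iff]
  change H.IsCoboundary _ (unc (H.bracket h f g))
  rw [unc_bracket]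
  exact (isCoboundary_unc_iff.2 hf).bracketSeq_left (isCocycle_unc_iff.2 hg)

theorem bracket_mem_coboundaries_right (h : p + q = r + 1) {f : Multi k A p}
    (hf : f ∈ H.cocycles p) {g : Multi k A q} (hg : g ∈ H.coboundaries q) :
    H.bracket h f g ∈ H.coboundaries r := by
  change H.bracketMap h f g ∈ _
  obtain _ | p := p
  · rw [hf.1.2 rfl, LinearMap.map_zero₂]
    exact zero_mem _
  obtain _ | q := q
  · rw [show g = 0 from hg, map_zero]
    exact zero_mem _
  obtain rfl : p + q + 1 = r := by omega
  rw [← isCoboundary_unc_iff]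
  change H.IsCoboundary _ (unc (H.bracket h f g))
  rw [unc_bracket]
  exact IsCoboundary.bracketSeq_right (isCocycle_unc_iff.2 hf) (isCoboundary_unc_iff.2 hg)

/-! ### The operations preserve cycles and boundaries -/

theorem eq_zero_of_neg_one_pow_smul {E : Type*} [AddCommGroup E] [Module k E] {a : ℕ} {x : E}
    (h : (-1 : k) ^ a • x = 0) : x = 0 := by
  rw [neg_one_pow_smul_eq_zsmul] at h
  rw [← neg_one_pow_smul_cancel a x, h, smul_zero]

theorem cap_mem_cycles (h : m + p = n) {f : Multi k A p} (hf : f ∈ H.cocycles p)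
    {x : Chains k A n} (hx : x ∈ H.cycles n) : H.cap h f x ∈ H.cycles m := by
  obtain _ | p := p
  · rw [hf.1.2 rfl, cap_zero]
    exact zero_mem _
  obtain _ | m := m
  · exact Submodule.mem_top
  obtain ⟨n, rfl⟩ : ∃ n', n = n' + 1 := ⟨m + (p + 1), by omega⟩
  have e := boundary_cap (show m + (p + 1) = n by omega) h (by omega) hf.1 x
  rw [show H.delta (p + 1) f = 0 from hf.2, show H.boundary n x = 0 from hx, map_zero, cap_zero] at e
  exact eq_zero_of_neg_one_pow_smul ((add_zero _).symm.trans e)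

/-- For f = δg, `boundary_cap` on a cycle x exhibits i_f x as the boundary of i_g x up to sign. -/
theorem cap_mem_boundaries_left (h : m + p = n) {f : Multi k A p} (hf : f ∈ H.coboundaries p)
    {x : Chains k A n} (hx : x ∈ H.cycles n) : H.cap h f x ∈ H.boundaries m := by
  obtain _ | p := p
  · rw [show f = 0 from hf, cap_zero]
    exact zero_mem _
  obtain ⟨g, hg, rfl⟩ := hf
  obtain _ | p := p
  · rw [hg.2 rfl, map_zero, cap_zero]
    exact zero_mem _
  obtain ⟨n, rfl⟩ : ∃ n', n = n' + 1 := ⟨m + (p + 1), by omega⟩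
  have e := boundary_cap (show m + (p + 1) = n by omega) (show m + 1 + (p + 1) = n + 1 by omega)
    h hg x
  rw [show H.boundary n x = 0 from hx, map_zero] at e
  rw [eq_neg_of_add_eq_zero_right e]
  exact neg_mem (Submodule.smul_mem _ _ ⟨_, rfl⟩)

theorem cap_mem_boundaries_right (h : m + p = n) {f : Multi k A p} (hf : f ∈ H.cocycles p)
    {x : Chains k A n} (hx : x ∈ H.boundaries n) : H.cap h f x ∈ H.boundaries m := by
  obtain _ | p := p
  · rw [hf.1.2 rfl, cap_zero]
    exact zero_mem _
  obtain ⟨y, rfl⟩ := hx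
  rw [← boundary_cap h (show m + 1 + (p + 1) = n + 1 by omega)
    (show m + (p + 1 + 1) = n + 1 by omega) hf.1 y,
    show H.delta (p + 1) f = 0 from hf.2, cap_zero]
  exact add_mem (Submodule.smul_mem _ _ ⟨_, rfl⟩) (zero_mem _)

theorem lieDerivative_mem_cycles (h : m + p = n + 1) {f : Multi k A p} (hf : f ∈ H.cocycles p)
    {x : Chains k A n} (hx : x ∈ H.cycles n) : H.lieDerivative h f x ∈ H.cycles m := by
  obtain _ | p := p
  · rw [hf.1.2 rfl, lieDerivative_zero]
    exact zero_mem _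
  obtain _ | m := m
  · exact Submodule.mem_top
  obtain ⟨n, rfl⟩ : ∃ n', n = n' + 1 := ⟨m + p, by omega⟩
  have e := boundary_lieDerivative (show m + (p + 1) = n + 1 by omega) h (by omega) hf.1 x
  rw [show H.delta (p + 1) f = 0 from hf.2, show H.boundary n x = 0 from hx, map_zero,
    lieDerivative_zero, smul_zero] at e
  exact (add_zero _).symm.trans e

theorem lieDerivative_mem_boundaries_left (h : m + p = n + 1) {f : Multi k A p}
    (hf : f ∈ H.coboundaries p) {x : Chains k A n} (hx : x ∈ H.cycles n) :
    H.lieDerivative h f x ∈ H.boundaries m := by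
  obtain _ | p := p
  · rw [show f = 0 from hf, lieDerivative_zero]
    exact zero_mem _
  obtain ⟨g, hg, rfl⟩ := hf
  obtain _ | p := p
  · rw [hg.2 rfl, map_zero, lieDerivative_zero]
    exact zero_mem _
  obtain ⟨n, rfl⟩ : ∃ n', n = n' + 1 := ⟨m + p, by omega⟩
  have e := boundary_lieDerivative (show m + (p + 1) = n + 1 by omega)
    (show m + 1 + (p + 1) = n + 1 + 1 by omega) h hg x
  rw [show H.boundary n x = 0 from hx, map_zero, smul_zero] at e
  have e' := eq_neg_of_add_eq_zero_right e
  rw [← one_smul k (H.lieDerivative h _ x), ← Even.neg_one_pow (α := k) ⟨p, rfl⟩, pow_add,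
    mul_smul, e']
  exact Submodule.smul_mem _ _ (neg_mem ⟨_, rfl⟩)

theorem lieDerivative_mem_boundaries_right (h : m + p = n + 1) {f : Multi k A p}
    (hf : f ∈ H.cocycles p) {x : Chains k A n} (hx : x ∈ H.boundaries n) :
    H.lieDerivative h f x ∈ H.boundaries m := by
  obtain _ | p := p
  · rw [hf.1.2 rfl, lieDerivative_zero]
    exact zero_mem _
  obtain ⟨y, rfl⟩ := hx
  have e := boundary_lieDerivative h (show m + 1 + (p + 1) = n + 1 + 1 by omega) (by omega) hf.1 y
  rw [show H.delta (p + 1) f = 0 from hf.2] at e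
  rw [← one_smul k (H.lieDerivative h f _), ← Even.neg_one_pow (α := k) ⟨p, rfl⟩, pow_add,
    mul_smul, ← e]
  refine Submodule.smul_mem _ _ (add_mem ⟨_, rfl⟩ (Submodule.smul_mem _ _ ?_))
  rw [lieDerivative_zero]
  exact zero_mem _

end HomAssocAlgebra

/-! ### Bilinear maps of subquotients and of direct sums -/

section bilinear

variable {k X Y Z : Type*} [CommRing k] [AddCommGroup X] [Module k X] [AddCommGroup Y]
  [Module k Y] [AddCommGroup Z] [Module k Z]

/-- The bilinear map of subquotients that is induced by a bilinear map. -/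
def LinearMap.subquotient₂ {Z₁ B₁ : Submodule k X} {Z₂ B₂ : Submodule k Y} {Z₃ B₃ : Submodule k Z}
    (T : X →ₗ[k] Y →ₗ[k] Z) (hZ : ∀ x ∈ Z₁, ∀ y ∈ Z₂, T x y ∈ Z₃)
    (hB₁ : ∀ x ∈ B₁, ∀ y ∈ Z₂, T x y ∈ B₃) (hB₂ : ∀ x ∈ Z₁, ∀ y ∈ B₂, T x y ∈ B₃) :
    (Z₁ ⧸ B₁.submoduleOf Z₁) →ₗ[k] (Z₂ ⧸ B₂.submoduleOf Z₂) →ₗ[k] (Z₃ ⧸ B₃.submoduleOf Z₃) :=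
  (B₁.submoduleOf Z₁).liftQ
    (LinearMap.mk₂ k (fun (x : Z₁) (y : Z₂ ⧸ B₂.submoduleOf Z₂) =>
      (B₂.submoduleOf Z₂).mapQ (B₃.submoduleOf Z₃)
        ((T x ∘ₗ Z₂.subtype).codRestrict Z₃ fun y => hZ x x.2 y y.2)
        (fun y hy => hB₂ x x.2 y hy) y)
      (fun x x' y => by
        obtain ⟨y, rfl⟩ := Submodule.Quotient.mk_surjective _ y
        exact congrArg Submodule.Quotient.mk (Subtype.ext (LinearMap.map_add₂ T x x' y)))
      (fun c x y => by
        obtain ⟨y, rfl⟩ := Submodule.Quotient.mk_surjective _ y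
        exact congrArg Submodule.Quotient.mk (Subtype.ext (LinearMap.map_smul₂ T c x y)))
      (fun x y y' => map_add _ y y')
      (fun c x y => map_smul _ c y))
    (fun x hx => by
      rw [LinearMap.mem_ker]
      ext y
      exact (Submodule.Quotient.mk_eq_zero _).2 (hB₁ x hx y y.2))

/-- The bilinear map of direct sums with given components. -/
noncomputable def DirectSum.bilinear {V W : ℕ → Type*} [∀ n, AddCommGroup (V n)]
    [∀ n, Module k (V n)] [∀ n, AddCommGroup (W n)] [∀ n, Module k (W n)]
    (T : ∀ p q, V p →ₗ[k] W q →ₗ[k] Z) : (⨁ n, V n) →ₗ[k] (⨁ n, W n) →ₗ[k] Z :=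
  DirectSum.toModule k ℕ _ fun p => (DirectSum.toModule k ℕ _ fun q => (T p q).flip).flip

theorem DirectSum.bilinear_lof {V W : ℕ → Type*} [∀ n, AddCommGroup (V n)]
    [∀ n, Module k (V n)] [∀ n, AddCommGroup (W n)] [∀ n, Module k (W n)]
    (T : ∀ p q, V p →ₗ[k] W q →ₗ[k] Z) {p q : ℕ} (x : V p) (y : W q) :
    DirectSum.bilinear T (DirectSum.lof k ℕ V p x) (DirectSum.lof k ℕ W q y) = T p q x y := by
  simp [DirectSum.bilinear]

end bilinear

section grading

variable {k : Type*} [CommRing k] {X : ℕ → Type*} [∀ n, AddCommGroup (X n)] [∀ n, Module k (X n)]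

theorem isInternal_intGrading : DirectSum.IsInternal (intGrading k X) := by
  classical
  let D : (⨁ n, X n) →ₗ[k] ⨁ z, intGrading k X z := DirectSum.toModule k ℕ _ fun n =>
    DirectSum.lof k ℤ (fun z => intGrading k X z) (Int.ofNat n) ∘ₗ
      (DirectSum.lof k ℕ X n).rangeRestrict
  have h : DirectSum.Decomposition (intGrading k X) := DirectSum.Decomposition.ofLinearMap _ D
    (by
      refine DirectSum.linearMap_ext k fun n => LinearMap.ext fun x => ?_
      rw [LinearMap.comp_apply, LinearMap.comp_apply, DirectSum.toModule_lof]
      exact DirectSum.coeLinearMap_lof (intGrading k X) (i := Int.ofNat n) _)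
    (by
      refine DirectSum.linearMap_ext k fun z => LinearMap.ext fun ⟨x, hx⟩ => ?_
      rw [LinearMap.comp_apply, LinearMap.comp_apply, DirectSum.coeLinearMap_lof]
      rcases z with n | n
      · obtain ⟨x, rfl⟩ := hx
        exact DirectSum.toModule_lof k n x
      · obtain rfl : x = 0 := hx
        exact (map_zero D).trans
          (map_zero (DirectSum.lof k ℤ (fun z => intGrading k X z) (Int.negSucc n))).symm)
  exact h.isInternal

end grading

namespace HomAssocAlgebra

variable {k A : Type*} [CommRing k] [AddCommGroup A] [Module k A]

/-! ### The operations on cohomology and homology -/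

variable (H : HomAssocAlgebra k A) {n m p q r : ℕ} {φ ψ : (ℕ → A) → A}

/-- The cup product on classes of given degrees. -/
noncomputable def cohomologyCupOf {p q r : ℕ} (h : p + q = r) :
    H.Cohomology p →ₗ[k] H.Cohomology q →ₗ[k] H.Cohomology r :=
  (H.cupMap h).subquotient₂ (fun _ hf _ hx => cup_mem_cocycles h hf hx)
    (fun _ hf _ hx => cup_mem_coboundaries_left h hf hx)
    (fun _ hf _ hx => cup_mem_coboundaries_right h hf hx)

/-- The cup product. -/
noncomputable def cohomologyCup :
    (⨁ n, H.Cohomology n) →ₗ[k] (⨁ n, H.Cohomology n) →ₗ[k] ⨁ n, H.Cohomology n :=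
  DirectSum.bilinear fun p q =>
    (H.cohomologyCupOf rfl).compr₂ (DirectSum.lof k ℕ H.Cohomology (p + q))

/-- The Gerstenhaber bracket on classes of given degrees. -/
noncomputable def cohomologyBracketOf {p q r : ℕ} (h : p + q = r + 1) :
    H.Cohomology p →ₗ[k] H.Cohomology q →ₗ[k] H.Cohomology r :=
  (H.bracketMap h).subquotient₂ (fun _ hf _ hx => bracket_mem_cocycles h hf hx)
    (fun _ hf _ hx => bracket_mem_coboundaries_left h hf hx)
    (fun _ hf _ hx => bracket_mem_coboundaries_right h hf hx)

/-- The Gerstenhaber bracket. -/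
noncomputable def cohomologyBracket :
    (⨁ n, H.Cohomology n) →ₗ[k] (⨁ n, H.Cohomology n) →ₗ[k] ⨁ n, H.Cohomology n :=
  DirectSum.bilinear fun p q =>
    -- With truncated subtraction this fails only for p = q = 0, where the cohomology is zero.
    if h : p + q = p + q - 1 + 1 then
      (H.cohomologyBracketOf h).compr₂ (DirectSum.lof k ℕ H.Cohomology (p + q - 1))
    else 0

/-- The cap product on classes of given degrees. -/
noncomputable def homologyCapOf {p q r : ℕ} (h : r + p = q) :
    H.Cohomology p →ₗ[k] H.Homology q →ₗ[k] H.Homology r :=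
  (H.capMap h).subquotient₂ (fun _ hf _ hx => cap_mem_cycles h hf hx)
    (fun _ hf _ hx => cap_mem_boundaries_left h hf hx)
    (fun _ hf _ hx => cap_mem_boundaries_right h hf hx)

/-- The cap product. -/
noncomputable def homologyCap :
    (⨁ n, H.Cohomology n) →ₗ[k] (⨁ n, H.Homology n) →ₗ[k] ⨁ n, H.Homology n :=
  DirectSum.bilinear fun p n =>
    -- Equivalent to p ≤ n; otherwise the cap product is zero by definition.
    if h : n - p + p = n then
      (H.homologyCapOf h).compr₂ (DirectSum.lof k ℕ H.Homology (n - p))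
    else 0

/-- The Lie derivative on classes of given degrees. -/
noncomputable def homologyLieOf {p q r : ℕ} (h : r + p = q + 1) :
    H.Cohomology p →ₗ[k] H.Homology q →ₗ[k] H.Homology r :=
  (H.lieMap h).subquotient₂ (fun _ hf _ hx => lieDerivative_mem_cycles h hf hx)
    (fun _ hf _ hx => lieDerivative_mem_boundaries_left h hf hx)
    (fun _ hf _ hx => lieDerivative_mem_boundaries_right h hf hx)

/-- The Lie derivative. -/
noncomputable def homologyLie :
    (⨁ n, H.Cohomology n) →ₗ[k] (⨁ n, H.Homology n) →ₗ[k] ⨁ n, H.Homology n :=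
  DirectSum.bilinear fun p n =>
    -- Equivalent to p ≤ n + 1, the range in which the Lie derivative is not set to zero.
    if h : n + 1 - p + p = n + 1 then
      (H.homologyLieOf h).compr₂ (DirectSum.lof k ℕ H.Homology (n + 1 - p))
    else 0

variable {H}

section

variable {f : Multi k A p} {hf : f ∈ H.cocycles p} {g : Multi k A q} {hg : g ∈ H.cocycles q}
  {x : Chains k A n} {hx : x ∈ H.cycles n}

theorem cohomologyCup_class (h : p + q = r) :
    H.cohomologyCup (H.cohomologyClass f hf) (H.cohomologyClass g hg) =
      H.cohomologyClass (H.cup h f g) (cup_mem_cocycles h hf hg) := by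
  subst h
  exact DirectSum.bilinear_lof _ _ _

theorem cohomologyBracket_class (h : p + q = r + 1) :
    H.cohomologyBracket (H.cohomologyClass f hf) (H.cohomologyClass g hg) =
      H.cohomologyClass (H.bracket h f g) (bracket_mem_cocycles h hf hg) := by
  obtain rfl : p + q - 1 = r := by omega
  exact (DirectSum.bilinear_lof _ _ _).trans (LinearMap.congr_fun₂ (dif_pos h) _ _)

theorem homologyCap_class (h : m + p = n) :
    H.homologyCap (H.cohomologyClass f hf) (H.homologyClass x hx) =
      H.homologyClass (H.cap h f x) (cap_mem_cycles h hf hx) := by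
  obtain rfl : n - p = m := by omega
  exact (DirectSum.bilinear_lof _ _ _).trans (LinearMap.congr_fun₂ (dif_pos h) _ _)

theorem homologyCap_class_eq_zero (h : n < p) :
    H.homologyCap (H.cohomologyClass f hf) (H.homologyClass x hx) = 0 := by
  exact (DirectSum.bilinear_lof _ _ _).trans (LinearMap.congr_fun₂ (dif_neg (by omega)) _ _)

theorem homologyLie_class (h : m + p = n + 1) :
    H.homologyLie (H.cohomologyClass f hf) (H.homologyClass x hx) =
      H.homologyClass (H.lieDerivative h f x) (lieDerivative_mem_cycles h hf hx) := by
  obtain rfl : n + 1 - p = m := by omega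
  exact (DirectSum.bilinear_lof _ _ _).trans (LinearMap.congr_fun₂ (dif_pos h) _ _)

theorem homologyLie_class_eq_zero (h : n + 1 < p) :
    H.homologyLie (H.cohomologyClass f hf) (H.homologyClass x hx) = 0 := by
  exact (DirectSum.bilinear_lof _ _ _).trans (LinearMap.congr_fun₂ (dif_neg (by omega)) _ _)

end

/-! ### Homogeneous classes -/

theorem cohomologyClass_mem {f : Multi k A p} (hf : f ∈ H.cocycles p) {z : ℤ} (hz : z = p) :
    H.cohomologyClass f hf ∈ H.cohomologyGrading z := by
  subst hz
  exact ⟨_, rfl⟩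

theorem homologyClass_mem {x : Chains k A n} (hx : x ∈ H.cycles n) {z : ℤ} (hz : z = n) :
    H.homologyClass x hx ∈ H.homologyGrading z := by
  subst hz
  exact ⟨_, rfl⟩

/-- Since C^0 = 0, a nonzero homogeneous class has positive arity. -/
theorem eq_zero_or_cohomologyClass {z : ℤ} {v : ⨁ n, H.Cohomology n}
    (hv : v ∈ H.cohomologyGrading z) :
    v = 0 ∨ ∃ (p : ℕ) (f : Multi k A (p + 1)) (hf : f ∈ H.cocycles (p + 1)),
      z = p + 1 ∧ v = H.cohomologyClass f hf := by
  rcases z with (_ | p) | p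
  · obtain ⟨v, rfl⟩ := hv
    obtain ⟨⟨f, hf⟩, rfl⟩ := Submodule.Quotient.mk_surjective _ v
    left
    have : (⟨f, hf⟩ : H.cocycles 0) = 0 := Subtype.ext (hf.1.2 rfl)
    rw [this]
    exact map_zero (DirectSum.lof k ℕ H.Cohomology 0)
  · obtain ⟨v, rfl⟩ := hv
    obtain ⟨⟨f, hf⟩, rfl⟩ := Submodule.Quotient.mk_surjective _ v
    exact Or.inr ⟨p, f, hf, rfl, rfl⟩
  · exact Or.inl hv

theorem eq_zero_or_homologyClass {z : ℤ} {v : ⨁ n, H.Homology n}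
    (hv : v ∈ H.homologyGrading z) :
    v = 0 ∨ ∃ (n : ℕ) (x : Chains k A n) (hx : x ∈ H.cycles n),
      z = n ∧ v = H.homologyClass x hx := by
  rcases z with n | n
  · obtain ⟨v, rfl⟩ := hv
    obtain ⟨⟨x, hx⟩, rfl⟩ := Submodule.Quotient.mk_surjective _ v
    exact Or.inr ⟨n, x, hx, rfl, rfl⟩
  · exact Or.inl hv

theorem cohomology_induction {motive : (⨁ n, H.Cohomology n) → Prop} (zero : motive 0)
    (add : ∀ v w, motive v → motive w → motive (v + w))
    (cls : ∀ (p : ℕ) (f : Multi k A (p + 1)) (hf : f ∈ H.cocycles (p + 1)),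
      motive (H.cohomologyClass f hf)) (v : ⨁ n, H.Cohomology n) : motive v := by
  induction v using DirectSum.induction_on with
  | zero => exact zero
  | add v w hv hw => exact add v w hv hw
  | of n v =>
    obtain h | ⟨p, f, hf, -, h⟩ := H.eq_zero_or_cohomologyClass (z := Int.ofNat n) ⟨v, rfl⟩
    · exact h ▸ zero
    · exact h ▸ cls p f hf

theorem homology_induction {motive : (⨁ n, H.Homology n) → Prop} (zero : motive 0)
    (add : ∀ v w, motive v → motive w → motive (v + w))
    (cls : ∀ (n : ℕ) (x : Chains k A n) (hx : x ∈ H.cycles n), motive (H.homologyClass x hx))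
    (v : ⨁ n, H.Homology n) : motive v := by
  induction v using DirectSum.induction_on with
  | zero => exact zero
  | add v w hv hw => exact add v w hv hw
  | of n v =>
    obtain ⟨⟨x, hx⟩, rfl⟩ := Submodule.Quotient.mk_surjective _ v
    exact cls n x hx

/-! ### Cohomology classes of functions of sequences -/

variable (H) in
open Classical in
/-- The cohomology class of a function of sequences that is a cocycle. -/
noncomputable def seqClass (p : ℕ) (φ : (ℕ → A) → A) : ⨁ n, H.Cohomology n :=
  if h : ∃ f : Multi k A (p + 1), f ∈ H.cocycles (p + 1) ∧ unc f = φ then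
    H.cohomologyClass h.choose h.choose_spec.1
  else 0

/-- `seqClass` takes no cocycle proof, and the type of its function does not mention the arity.
Degrees that agree only propositionally can therefore be rewritten. -/
theorem cohomologyClass_eq_seqClass {f : Multi k A (p + 1)} (hf : f ∈ H.cocycles (p + 1)) :
    H.cohomologyClass f hf = H.seqClass p (unc f) := by
  have h : ∃ g : Multi k A (p + 1), g ∈ H.cocycles (p + 1) ∧ unc g = unc f := ⟨f, hf, rfl⟩
  rw [seqClass, dif_pos h]
  congr 1
  exact (unc_injective h.choose_spec.2).symm

theorem IsCocycle.exists_eq (hφ : H.IsCocycle p φ) :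
    ∃ (f : Multi k A (p + 1)) (hf : f ∈ H.cocycles (p + 1)),
      unc f = φ ∧ H.seqClass p φ = H.cohomologyClass f hf := by
  obtain ⟨f, rfl⟩ := hφ.1.1
  exact ⟨f, isCocycle_unc_iff.1 hφ, rfl, (cohomologyClass_eq_seqClass _).symm⟩

theorem cohomologyCup_seqClass (hφ : H.IsCocycle p φ) (hψ : H.IsCocycle q ψ) :
    H.cohomologyCup (H.seqClass p φ) (H.seqClass q ψ) =
      H.seqClass (p + q + 1) (H.cupSeq p φ q ψ) := by
  obtain ⟨f, hf, rfl, e⟩ := hφ.exists_eq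
  obtain ⟨g, hg, rfl, e'⟩ := hψ.exists_eq
  have h : p + 1 + (q + 1) = p + q + 1 + 1 := by omega
  rw [e, e', cohomologyCup_class h, cohomologyClass_eq_seqClass, unc_cup]

theorem cohomologyBracket_seqClass (hφ : H.IsCocycle p φ) (hψ : H.IsCocycle q ψ) :
    H.cohomologyBracket (H.seqClass p φ) (H.seqClass q ψ) =
      H.seqClass (p + q) (H.bracketSeq p φ q ψ) := by
  obtain ⟨f, hf, rfl, e⟩ := hφ.exists_eq
  obtain ⟨g, hg, rfl, e'⟩ := hψ.exists_eq
  have h : p + 1 + (q + 1) = p + q + 1 + 1 := by omega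
  rw [e, e', cohomologyBracket_class h, cohomologyClass_eq_seqClass, unc_bracket]

theorem seqClass_add (hφ : H.IsCocycle p φ) (hψ : H.IsCocycle p ψ) :
    H.seqClass p (φ + ψ) = H.seqClass p φ + H.seqClass p ψ := by
  obtain ⟨f, hf, rfl, e⟩ := hφ.exists_eq
  obtain ⟨g, hg, rfl, e'⟩ := hψ.exists_eq
  rw [e, e', ← unc_add, ← cohomologyClass_eq_seqClass (add_mem hf hg)]
  exact map_add (DirectSum.lof k ℕ H.Cohomology (p + 1))
    (((H.coboundaries (p + 1)).submoduleOf (H.cocycles (p + 1))).mkQ ⟨f, hf⟩)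
    (((H.coboundaries (p + 1)).submoduleOf (H.cocycles (p + 1))).mkQ ⟨g, hg⟩)

theorem seqClass_zsmul (hφ : H.IsCocycle p φ) (c : ℤ) :
    H.seqClass p (c • φ) = c • H.seqClass p φ := by
  obtain ⟨f, hf, rfl, e⟩ := hφ.exists_eq
  rw [e, ← unc_zsmul, ← cohomologyClass_eq_seqClass (zsmul_mem hf c)]
  exact map_zsmul (DirectSum.lof k ℕ H.Cohomology (p + 1)) c
    (((H.coboundaries (p + 1)).submoduleOf (H.cocycles (p + 1))).mkQ ⟨f, hf⟩)

theorem seqClass_deltaSeq (hφ : H.IsCoch p φ) :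
    H.seqClass (p + 1) (H.deltaSeq p φ) = 0 := by
  have h : H.IsCocycle (p + 1) (H.deltaSeq p φ) := ⟨hφ.deltaSeq, deltaSeq_deltaSeq hφ⟩
  obtain ⟨f, hf, e, e'⟩ := h.exists_eq
  have h' : f ∈ H.coboundaries (p + 1 + 1) := by
    rw [← isCoboundary_unc_iff, e]
    exact IsCoboundary.of_deltaSeq hφ
  have h₀ : ((H.coboundaries (p + 1 + 1)).submoduleOf (H.cocycles (p + 1 + 1))).mkQ ⟨f, hf⟩ = 0 :=
    (Submodule.Quotient.mk_eq_zero _).2 h'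
  exact e'.trans ((congrArg (DirectSum.lof k ℕ H.Cohomology (p + 1 + 1)) h₀).trans
    (map_zero (DirectSum.lof k ℕ H.Cohomology (p + 1 + 1))))

end HomAssocAlgebra

namespace HomAssocAlgebra

variable {k A : Type*} [CommRing k] [AddCommGroup A] [Module k A]

/-! ### The precalculus of cohomology and homology -/

theorem negOnePow_smul {E : Type*} [AddCommGroup E] {z : ℤ} {a : ℕ} (h : z = a) (v : E) :
    z.negOnePow • v = (-1 : ℤ) ^ a • v := by
  subst h
  rw [Units.smul_def, Int.negOnePow_def]
  simp

variable {H : HomAssocAlgebra k A} {n m p q r : ℕ} {φ ψ χ : (ℕ → A) → A}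

theorem homologyClass_eq_sub {x y z : Chains k A m} (hx : x ∈ H.cycles m) (hy : y ∈ H.cycles m)
    (hz : z ∈ H.cycles m) {a : ℕ} {w : Chains k A (m + 1)}
    (e : z = x - (-1 : k) ^ a • y + H.boundary m w) :
    H.homologyClass z hz = H.homologyClass x hx - (-1 : ℤ) ^ a • H.homologyClass y hy := by
  have h : ((H.boundaries m).submoduleOf (H.cycles m)).mkQ ⟨z, hz⟩ =
      ((H.boundaries m).submoduleOf (H.cycles m)).mkQ (⟨x, hx⟩ - (-1 : k) ^ a • ⟨y, hy⟩) := by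
    refine (Submodule.Quotient.eq _).2 ?_
    refine ⟨w, ?_⟩
    change H.boundary m w = z - (x - (-1 : k) ^ a • y)
    rw [e, add_sub_cancel_left]
  rw [map_sub, map_smul] at h
  rw [← neg_one_pow_smul_eq_zsmul (k := k)]
  refine (congrArg (DirectSum.lof k ℕ H.Homology m) h).trans ?_
  refine (map_sub (DirectSum.lof k ℕ H.Homology m) _ _).trans ?_
  exact congrArg _ (map_smul (DirectSum.lof k ℕ H.Homology m) _ _)

theorem homologyClass_congr {x y : Chains k A m} (hx : x ∈ H.cycles m) (e : x = y) :
    H.homologyClass x hx = H.homologyClass y (e ▸ hx) := by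
  subst e
  rfl

/-- The coboundary of φ{ψ} has class zero and is, up to sign, the difference of the two cup products
by `deltaSeq_circ`. -/
theorem seqClass_cup_comm (hφ : H.IsCocycle p φ) (hψ : H.IsCocycle q ψ) :
    H.cohomologyCup (H.seqClass p φ) (H.seqClass q ψ) =
      (-1 : ℤ) ^ ((p + 1) * (q + 1)) • H.cohomologyCup (H.seqClass q ψ) (H.seqClass p φ) := by
  have h := deltaSeq_circ hφ.1 hψ.1 hφ.2 hψ.2
  have h0 := seqClass_deltaSeq (hφ.1.circ hψ.1)
  have h1 := (hφ.cupSeq hψ)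
  have h2 := (hψ.cupSeq hφ).zsmul ((-1 : ℤ) ^ ((p + 1) * (q + 1)) * -1)
  rw [add_comm q p] at h2
  have e : H.deltaSeq (p + q) (H.circ (p + 1) φ q ψ) = ((-1 : ℤ) * (-1 : ℤ) ^ q) •
      (H.cupSeq p φ q ψ + ((-1 : ℤ) ^ ((p + 1) * (q + 1)) * -1) • H.cupSeq q ψ p φ) := by
    rw [h, mul_smul, neg_one_zsmul, mul_neg_one, neg_smul, ← sub_eq_add_neg]
  rw [e, seqClass_zsmul (h1.add h2)] at h0
  have h3 : H.seqClass (p + q + 1)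
      (H.cupSeq p φ q ψ + ((-1 : ℤ) ^ ((p + 1) * (q + 1)) * -1) • H.cupSeq q ψ p φ) = 0 := by
    rcases neg_one_pow_eq_or ℤ q with hq | hq <;> rw [hq] at h0 <;> simpa using h0
  have h4 := hψ.cupSeq hφ
  rw [add_comm q p] at h4
  rw [seqClass_add h1 h2, seqClass_zsmul h4, mul_neg_one, neg_smul, ← sub_eq_add_neg,
    sub_eq_zero] at h3
  rw [cohomologyCup_seqClass hφ hψ, cohomologyCup_seqClass hψ hφ, h3, add_comm q p]

theorem seqClass_bracket_skew (hφ : H.IsCocycle p φ) (hψ : H.IsCocycle q ψ) :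
    H.cohomologyBracket (H.seqClass p φ) (H.seqClass q ψ) =
      -((-1 : ℤ) ^ (p * q) • H.cohomologyBracket (H.seqClass q ψ) (H.seqClass p φ)) := by
  have e : H.bracketSeq p φ q ψ = (-1 * (-1 : ℤ) ^ (p * q)) • H.bracketSeq q ψ p φ := by
    rw [bracketSeq_skew, mul_smul, neg_one_zsmul]
  rw [cohomologyBracket_seqClass hφ hψ, cohomologyBracket_seqClass hψ hφ, e, add_comm p q,
    seqClass_zsmul (hψ.bracketSeq hφ), mul_smul, neg_one_zsmul]

theorem seqClass_jacobi (hφ : H.IsCocycle p φ) (hψ : H.IsCocycle q ψ) (hχ : H.IsCocycle r χ) :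
    H.cohomologyBracket (H.seqClass p φ) (H.cohomologyBracket (H.seqClass q ψ) (H.seqClass r χ)) =
      H.cohomologyBracket (H.cohomologyBracket (H.seqClass p φ) (H.seqClass q ψ))
          (H.seqClass r χ) +
        (-1 : ℤ) ^ (p * q) • H.cohomologyBracket (H.seqClass q ψ)
          (H.cohomologyBracket (H.seqClass p φ) (H.seqClass r χ)) := by
  have h₁ := (hφ.bracketSeq hψ).bracketSeq hχ
  have h₂ := hψ.bracketSeq (hφ.bracketSeq hχ)
  rw [cohomologyBracket_seqClass hψ hχ, cohomologyBracket_seqClass hφ (hψ.bracketSeq hχ),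
    cohomologyBracket_seqClass hφ hψ, cohomologyBracket_seqClass (hφ.bracketSeq hψ) hχ,
    cohomologyBracket_seqClass hφ hχ, cohomologyBracket_seqClass hψ (hφ.bracketSeq hχ),
    bracketSeq_jacobi hφ.1 hψ.1 hχ.1, ← seqClass_zsmul h₂]
  rw [show q + (p + r) = p + q + r by omega] at h₂ ⊢
  rw [← seqClass_add h₁ (h₂.zsmul _), add_assoc]

theorem seqClass_leibniz (hφ : H.IsCocycle p φ) (hψ : H.IsCocycle q ψ) (hχ : H.IsCocycle r χ) :
    H.cohomologyBracket (H.seqClass p φ) (H.cohomologyCup (H.seqClass q ψ) (H.seqClass r χ)) =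
      H.cohomologyCup (H.cohomologyBracket (H.seqClass p φ) (H.seqClass q ψ)) (H.seqClass r χ) +
        (-1 : ℤ) ^ (p * (q + 1)) • H.cohomologyCup (H.seqClass q ψ)
          (H.cohomologyBracket (H.seqClass p φ) (H.seqClass r χ)) := by
  have h₁ := (hφ.bracketSeq hψ).cupSeq hχ
  have h₂ := hψ.cupSeq (hφ.bracketSeq hχ)
  have hB := hφ.1.brace hχ.1 hψ.1
  have h₃ := seqClass_deltaSeq hB
  have h₄ : H.IsCocycle _ _ := ⟨hB.deltaSeq, deltaSeq_deltaSeq hB⟩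
  rw [cohomologyCup_seqClass hψ hχ, cohomologyBracket_seqClass hφ (hψ.cupSeq hχ),
    cohomologyBracket_seqClass hφ hψ, cohomologyCup_seqClass (hφ.bracketSeq hψ) hχ,
    cohomologyBracket_seqClass hφ hχ, cohomologyCup_seqClass hψ (hφ.bracketSeq hχ),
    bracketSeq_cupSeq hχ.1 hψ.1 hφ.1 hχ.2 hψ.2 hφ.2, ← seqClass_zsmul h₂]
  rw [show q + (p + r) = p + q + r by omega] at h₂ ⊢
  rw [show p + r + q = p + q + r by omega] at h₃ h₄ ⊢
  rw [show p + (q + r + 1) = p + q + r + 1 by omega, seqClass_add (h₁.add (h₂.zsmul _)) (h₄.zsmul _),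
    seqClass_add h₁ (h₂.zsmul _), seqClass_zsmul h₄, h₃, smul_zero, add_zero]

theorem seqClass_cup_assoc (hφ : H.IsCocycle p φ) (hψ : H.IsCocycle q ψ) (hχ : H.IsCocycle r χ) :
    H.cohomologyCup (H.cohomologyCup (H.seqClass p φ) (H.seqClass q ψ)) (H.seqClass r χ) =
      H.cohomologyCup (H.seqClass p φ) (H.cohomologyCup (H.seqClass q ψ) (H.seqClass r χ)) := by
  rw [cohomologyCup_seqClass hφ hψ, cohomologyCup_seqClass (hφ.cupSeq hψ) hχ,
    cohomologyCup_seqClass hψ hχ, cohomologyCup_seqClass hφ (hψ.cupSeq hχ),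
    cupSeq_assoc hφ.1 hψ.1, show p + q + 1 + r = p + (q + r + 1) by omega]

section

variable {f : Multi k A (p + 1)} (hf : f ∈ H.cocycles (p + 1)) {g : Multi k A (q + 1)}
  (hg : g ∈ H.cocycles (q + 1)) {x : Chains k A n} (hx : x ∈ H.cycles n)

theorem homologyCap_cup_class :
    H.homologyCap (H.cohomologyCup (H.cohomologyClass f hf) (H.cohomologyClass g hg))
        (H.homologyClass x hx) =
      H.homologyCap (H.cohomologyClass f hf)
        (H.homologyCap (H.cohomologyClass g hg) (H.homologyClass x hx)) := by
  have hc : p + 1 + (q + 1) = p + q + 1 + 1 := by omega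
  rw [cohomologyCup_class hc]
  by_cases h₁ : q + 1 ≤ n
  · obtain ⟨n₁, h₂⟩ : ∃ n₁, n₁ + (q + 1) = n := ⟨n - (q + 1), by omega⟩
    rw [homologyCap_class h₂]
    by_cases h₃ : p + 1 ≤ n₁
    · obtain ⟨m, h₄⟩ : ∃ m, m + (p + 1) = n₁ := ⟨n₁ - (p + 1), by omega⟩
      have h : m + (p + q + 1 + 1) = n := by omega
      rw [homologyCap_class h₄, homologyCap_class h]
      exact homologyClass_congr _ (cap_cup hc h h₄ h₂ hf.1 g x)
    · rw [homologyCap_class_eq_zero (by omega), homologyCap_class_eq_zero (by omega)]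
  · rw [homologyCap_class_eq_zero (by omega), homologyCap_class_eq_zero (by omega), map_zero]

theorem homologyLie_bracket_class :
    H.homologyLie (H.cohomologyBracket (H.cohomologyClass f hf) (H.cohomologyClass g hg))
        (H.homologyClass x hx) =
      H.homologyLie (H.cohomologyClass f hf)
          (H.homologyLie (H.cohomologyClass g hg) (H.homologyClass x hx)) -
        (-1 : ℤ) ^ (p * q) • H.homologyLie (H.cohomologyClass g hg)
          (H.homologyLie (H.cohomologyClass f hf) (H.homologyClass x hx)) := by
  have hb : p + 1 + (q + 1) = p + q + 1 + 1 := by omega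
  rw [cohomologyBracket_class hb]
  by_cases h : p + q ≤ n
  · obtain ⟨m, h⟩ : ∃ m, m + (p + q + 1) = n + 1 := ⟨n - (p + q), by omega⟩
    have h₁ : m + (p + 1) = m + p + 1 := by omega
    have h₁' : m + p + (q + 1) = n + 1 := by omega
    have h₂ : m + (q + 1) = m + q + 1 := by omega
    have h₂' : m + q + (p + 1) = n + 1 := by omega
    rw [homologyLie_class h, homologyLie_class h₁', homologyLie_class h₁, homologyLie_class h₂',
      homologyLie_class h₂]
    refine homologyClass_eq_sub _ _ _ (w := 0) ?_
    rw [map_zero, add_zero]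
    exact lieDerivative_bracket h h₁ h₁' h₂ h₂' hb hf.1 hg.1 x
  -- The total degree exceeds n, so in either order one of the two operators runs out of factors and
  -- each composite vanishes.
  · have e : ∀ {p q : ℕ} {f : Multi k A (p + 1)} (hf : f ∈ H.cocycles (p + 1))
        {g : Multi k A (q + 1)} (hg : g ∈ H.cocycles (q + 1)), ¬ p + q ≤ n →
        H.homologyLie (H.cohomologyClass f hf)
          (H.homologyLie (H.cohomologyClass g hg) (H.homologyClass x hx)) = 0 := by
      intro p q f hf g hg h
      by_cases hq : q ≤ n
      · obtain ⟨n₁, h₂⟩ : ∃ n₁, n₁ + (q + 1) = n + 1 := ⟨n - q, by omega⟩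
        rw [homologyLie_class h₂, homologyLie_class_eq_zero (by omega)]
      · rw [homologyLie_class_eq_zero (x := x) (by omega), map_zero]
    rw [e hf hg h, e hg hf (by omega), homologyLie_class_eq_zero (by omega), smul_zero, sub_zero]

theorem homologyCap_bracket_class :
    H.homologyCap (H.cohomologyBracket (H.cohomologyClass f hf) (H.cohomologyClass g hg))
        (H.homologyClass x hx) =
      H.homologyCap (H.cohomologyClass f hf)
          (H.homologyLie (H.cohomologyClass g hg) (H.homologyClass x hx)) -
        (-1 : ℤ) ^ ((p + 1) * q) • H.homologyLie (H.cohomologyClass g hg)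
          (H.homologyCap (H.cohomologyClass f hf) (H.homologyClass x hx)) := by
  have hb : p + 1 + (q + 1) = p + q + 1 + 1 := by omega
  rw [cohomologyBracket_class hb]
  by_cases h : p + q + 1 ≤ n
  · obtain ⟨n, rfl⟩ : ∃ n', n = n' + 1 := ⟨n - 1, by omega⟩
    obtain ⟨m, h⟩ : ∃ m, m + (p + q + 1) = n + 1 := ⟨n - (p + q), by omega⟩
    have h₁ : m + (p + 1) = m + (p + 1) := rfl
    have h₁' : m + (p + 1) + (q + 1) = n + 1 + 1 := by omega
    have h₂ : m + (q + 1) = m + q + 1 := by omega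
    have h₂' : m + q + (p + 1) = n + 1 := by omega
    rw [homologyCap_class h, homologyLie_class h₁', homologyCap_class h₁, homologyCap_class h₂',
      homologyLie_class h₂]
    obtain ⟨y, e⟩ := cap_bracket h h₁ h₁' h₂ h₂' hb hf hg hx
    exact homologyClass_eq_sub _ _ _ e
  · have e₁ : H.homologyCap (H.cohomologyClass f hf)
          (H.homologyLie (H.cohomologyClass g hg) (H.homologyClass x hx)) = 0 := by
      by_cases hq : q ≤ n
      · obtain ⟨n₁, h₂⟩ : ∃ n₁, n₁ + (q + 1) = n + 1 := ⟨n - q, by omega⟩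
        rw [homologyLie_class h₂, homologyCap_class_eq_zero (by omega)]
      · rw [homologyLie_class_eq_zero (x := x) (by omega), map_zero]
    have e₂ : H.homologyLie (H.cohomologyClass g hg)
          (H.homologyCap (H.cohomologyClass f hf) (H.homologyClass x hx)) = 0 := by
      by_cases hp : p + 1 ≤ n
      · obtain ⟨n₁, h₂⟩ : ∃ n₁, n₁ + (p + 1) = n := ⟨n - (p + 1), by omega⟩
        rw [homologyCap_class h₂, homologyLie_class_eq_zero (by omega)]
      · rw [homologyCap_class_eq_zero (x := x) (by omega), map_zero]
    rw [e₁, e₂, homologyCap_class_eq_zero (by omega), smul_zero, sub_zero]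

end

variable (H) in
/-- The Gerstenhaber algebra structure on cohomology. -/
noncomputable def gerstenhaberAlgebra : GerstenhaberAlgebra k H.cohomologyGrading where
  isInternal := isInternal_intGrading
  cup := H.cohomologyCup
  bracket := H.cohomologyBracket
  cup_mem z w v hv u hu := by
    obtain rfl | ⟨p, f, hf, rfl, rfl⟩ := eq_zero_or_cohomologyClass hv
    · rw [LinearMap.map_zero₂]; exact zero_mem _
    obtain rfl | ⟨q, g, hg, rfl, rfl⟩ := eq_zero_or_cohomologyClass hu
    · rw [map_zero]; exact zero_mem _
    rw [cohomologyCup_class rfl]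
    exact cohomologyClass_mem _ (by push_cast; ring)
  cup_comm z w v hv u hu := by
    obtain rfl | ⟨p, f, hf, rfl, rfl⟩ := eq_zero_or_cohomologyClass hv
    · rw [LinearMap.map_zero₂, map_zero, smul_zero]
    obtain rfl | ⟨q, g, hg, rfl, rfl⟩ := eq_zero_or_cohomologyClass hu
    · rw [LinearMap.map_zero₂, map_zero, smul_zero]
    rw [negOnePow_smul (a := (p + 1) * (q + 1)) (by push_cast; ring),
      cohomologyClass_eq_seqClass, cohomologyClass_eq_seqClass]
    exact seqClass_cup_comm (isCocycle_unc_iff.2 hf) (isCocycle_unc_iff.2 hg)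
  cup_assoc v u w := by
    induction v using cohomology_induction with
    | zero => simp only [map_zero, LinearMap.zero_apply]
    | add v v' hv hv' => simp only [map_add, LinearMap.add_apply, hv, hv']
    | cls p f hf =>
      induction u using cohomology_induction with
      | zero => simp only [map_zero, LinearMap.zero_apply]
      | add v v' hv hv' => simp only [map_add, LinearMap.add_apply, hv, hv']
      | cls q g hg =>
        induction w using cohomology_induction with
        | zero => simp only [map_zero]
        | add v v' hv hv' => simp only [map_add, hv, hv']
        | cls r h hh =>
          simp only [cohomologyClass_eq_seqClass]
          exact seqClass_cup_assoc (isCocycle_unc_iff.2 hf) (isCocycle_unc_iff.2 hg)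
            (isCocycle_unc_iff.2 hh)
  bracket_mem z w v hv u hu := by
    obtain rfl | ⟨p, f, hf, rfl, rfl⟩ := eq_zero_or_cohomologyClass hv
    · rw [LinearMap.map_zero₂]; exact zero_mem _
    obtain rfl | ⟨q, g, hg, rfl, rfl⟩ := eq_zero_or_cohomologyClass hu
    · rw [map_zero]; exact zero_mem _
    rw [cohomologyBracket_class (show p + 1 + (q + 1) = p + q + 1 + 1 by omega)]
    exact cohomologyClass_mem _ (by push_cast; ring)
  bracket_skew z w v hv u hu := by
    obtain rfl | ⟨p, f, hf, rfl, rfl⟩ := eq_zero_or_cohomologyClass hv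
    · rw [LinearMap.map_zero₂, map_zero, smul_zero, neg_zero]
    obtain rfl | ⟨q, g, hg, rfl, rfl⟩ := eq_zero_or_cohomologyClass hu
    · rw [LinearMap.map_zero₂, map_zero, smul_zero, neg_zero]
    rw [negOnePow_smul (a := p * q) (by push_cast; ring),
      cohomologyClass_eq_seqClass, cohomologyClass_eq_seqClass]
    exact seqClass_bracket_skew (isCocycle_unc_iff.2 hf) (isCocycle_unc_iff.2 hg)
  jacobi z w v hv u hu x := by
    obtain rfl | ⟨p, f, hf, rfl, rfl⟩ := eq_zero_or_cohomologyClass hv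
    · simp only [map_zero, LinearMap.zero_apply, smul_zero, add_zero]
    obtain rfl | ⟨q, g, hg, rfl, rfl⟩ := eq_zero_or_cohomologyClass hu
    · simp only [map_zero, LinearMap.zero_apply, smul_zero, add_zero]
    rw [negOnePow_smul (a := p * q) (by push_cast; ring)]
    induction x using cohomology_induction with
    | zero => simp only [map_zero, smul_zero, add_zero]
    | add v v' hv hv' =>
      simp only [map_add, hv, hv', smul_add]
      exact add_add_add_comm _ _ _ _
    | cls r h hh =>
      simp only [cohomologyClass_eq_seqClass]
      exact seqClass_jacobi (isCocycle_unc_iff.2 hf) (isCocycle_unc_iff.2 hg)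
        (isCocycle_unc_iff.2 hh)
  leibniz z w v hv u hu x := by
    obtain rfl | ⟨p, f, hf, rfl, rfl⟩ := eq_zero_or_cohomologyClass hv
    · simp only [map_zero, LinearMap.zero_apply, smul_zero, add_zero]
    obtain rfl | ⟨q, g, hg, rfl, rfl⟩ := eq_zero_or_cohomologyClass hu
    · simp only [map_zero, LinearMap.zero_apply, smul_zero, add_zero]
    rw [negOnePow_smul (a := p * (q + 1)) (by push_cast; ring)]
    induction x using cohomology_induction with
    | zero => simp only [map_zero, smul_zero, add_zero]
    | add v v' hv hv' =>
      simp only [map_add, hv, hv', smul_add]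
      exact add_add_add_comm _ _ _ _
    | cls r h hh =>
      simp only [cohomologyClass_eq_seqClass]
      exact seqClass_leibniz (isCocycle_unc_iff.2 hf) (isCocycle_unc_iff.2 hg)
        (isCocycle_unc_iff.2 hh)

variable (H) in
/-- The precalculus structure on cohomology and homology. -/
noncomputable def precalculus : Precalculus k H.cohomologyGrading H.homologyGrading where
  toGerstenhaberAlgebra := H.gerstenhaberAlgebra
  isInternal_module := isInternal_intGrading
  i := H.homologyCap
  L := H.homologyLie
  i_mem z w v hv x hx := by
    obtain rfl | ⟨p, f, hf, rfl, rfl⟩ := eq_zero_or_cohomologyClass hv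
    · rw [LinearMap.map_zero₂]; exact zero_mem _
    obtain rfl | ⟨n, x, hx, rfl, rfl⟩ := eq_zero_or_homologyClass hx
    · rw [map_zero]; exact zero_mem _
    by_cases h : p + 1 ≤ n
    · obtain ⟨m, rfl⟩ : ∃ m, n = m + (p + 1) := ⟨n - (p + 1), by omega⟩
      rw [homologyCap_class rfl]
      exact homologyClass_mem _ (by push_cast; ring)
    · rw [homologyCap_class_eq_zero (by omega)]
      exact zero_mem _
  i_cup v u x := by
    change H.homologyCap (H.cohomologyCup v u) x = _
    induction v using cohomology_induction with
    | zero => simp only [map_zero, LinearMap.zero_apply]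
    | add v v' hv hv' => simp only [map_add, LinearMap.add_apply, hv, hv']
    | cls p f hf =>
      induction u using cohomology_induction with
      | zero => simp only [map_zero, LinearMap.zero_apply]
      | add v v' hv hv' => simp only [map_add, LinearMap.add_apply, hv, hv']
      | cls q g hg =>
        induction x using homology_induction with
        | zero => simp only [map_zero]
        | add v v' hv hv' => simp only [map_add, hv, hv']
        | cls n x hx => exact homologyCap_cup_class hf hg hx
  L_mem z w v hv x hx := by
    obtain rfl | ⟨p, f, hf, rfl, rfl⟩ := eq_zero_or_cohomologyClass hv
    · rw [LinearMap.map_zero₂]; exact zero_mem _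
    obtain rfl | ⟨n, x, hx, rfl, rfl⟩ := eq_zero_or_homologyClass hx
    · rw [map_zero]; exact zero_mem _
    by_cases h : p ≤ n
    · obtain ⟨m, rfl⟩ : ∃ m, n = m + p := ⟨n - p, by omega⟩
      rw [homologyLie_class (show m + (p + 1) = m + p + 1 from rfl)]
      exact homologyClass_mem _ (by push_cast; ring)
    · rw [homologyLie_class_eq_zero (by omega)]
      exact zero_mem _
  L_bracket z w v hv u hu x := by
    change H.homologyLie (H.cohomologyBracket v u) x = _
    obtain rfl | ⟨p, f, hf, rfl, rfl⟩ := eq_zero_or_cohomologyClass hv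
    · simp only [map_zero, LinearMap.zero_apply, smul_zero, sub_zero]
    obtain rfl | ⟨q, g, hg, rfl, rfl⟩ := eq_zero_or_cohomologyClass hu
    · simp only [map_zero, LinearMap.zero_apply, smul_zero, sub_zero]
    rw [negOnePow_smul (a := p * q) (by push_cast; ring)]
    induction x using homology_induction with
    | zero => simp only [map_zero, smul_zero, sub_zero]
    | add v v' hv hv' =>
      simp only [map_add, hv, hv', smul_add]
      exact sub_add_sub_comm _ _ _ _
    | cls n x hx => exact homologyLie_bracket_class hf hg hx
  i_bracket z w v hv u hu x := by
    change H.homologyCap (H.cohomologyBracket v u) x = _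
    obtain rfl | ⟨p, f, hf, rfl, rfl⟩ := eq_zero_or_cohomologyClass hv
    · simp only [map_zero, LinearMap.zero_apply, smul_zero, sub_zero]
    obtain rfl | ⟨q, g, hg, rfl, rfl⟩ := eq_zero_or_cohomologyClass hu
    · simp only [map_zero, LinearMap.zero_apply, smul_zero, sub_zero]
    -- The exponents (p + 1)(q + 2) and (p + 1)q have the same parity.
    have e : ∀ y : ⨁ n, H.Homology n, (((p : ℤ) + 1) * ((q : ℤ) + 1 + 1)).negOnePow • y =
        (-1 : ℤ) ^ ((p + 1) * q) • y := by
      intro y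
      rw [show ((p : ℤ) + 1) * ((q : ℤ) + 1 + 1) = ((p + 1) * q : ℕ) + 2 * (p + 1) by
        push_cast; ring, Int.negOnePow_add, Int.negOnePow_two_mul, mul_one, negOnePow_smul rfl]
    rw [e]
    induction x using homology_induction with
    | zero => simp only [map_zero, smul_zero, sub_zero]
    | add v v' hv hv' =>
      simp only [map_add, hv, hv', smul_add]
      exact sub_add_sub_comm _ _ _ _
    | cls n x hx => exact homologyCap_bracket_class hf hg hx

end HomAssocAlgebra

theorem mainTheorem3 {k A : Type*} [CommRing k] [CharZero k] [AddCommGroup A] [Module k A]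
    (H : HomAssocAlgebra k A) :
    -- the Hochschild cochains and the Hochschild chains form complexes
    (∀ (n : ℕ), ∀ f ∈ H.cochains n,
      H.delta n f ∈ H.cochains (n + 1) ∧ H.delta (n + 1) (H.delta n f) = 0) ∧
    (∀ (n : ℕ) (x : HomAssocAlgebra.Chains k A (n + 2)),
      H.boundary n (H.boundary (n + 1) x) = 0) ∧
    -- the pair of cohomology and homology is a precalculus, under the operations that are induced
    -- by the cup product, the bracket, the cap product and the Lie derivative
    ∃ P : Precalculus k H.cohomologyGrading H.homologyGrading,
      (∀ (p q r : ℕ) (h : p + q = r) (f : HomAssocAlgebra.Multi k A p) (hf : f ∈ H.cocycles p)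
        (g : HomAssocAlgebra.Multi k A q) (hg : g ∈ H.cocycles q),
        ∃ hr : H.cup h f g ∈ H.cocycles r,
          P.cup (H.cohomologyClass f hf) (H.cohomologyClass g hg) =
            H.cohomologyClass (H.cup h f g) hr) ∧
      (∀ (p q r : ℕ) (h : p + q = r + 1) (f : HomAssocAlgebra.Multi k A p)
        (hf : f ∈ H.cocycles p) (g : HomAssocAlgebra.Multi k A q) (hg : g ∈ H.cocycles q),
        ∃ hr : H.bracket h f g ∈ H.cocycles r,
          P.bracket (H.cohomologyClass f hf) (H.cohomologyClass g hg) =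
            H.cohomologyClass (H.bracket h f g) hr) ∧
      (∀ (p n m : ℕ) (h : m + p = n) (f : HomAssocAlgebra.Multi k A p) (hf : f ∈ H.cocycles p)
        (x : HomAssocAlgebra.Chains k A n) (hx : x ∈ H.cycles n),
        ∃ hm : H.cap h f x ∈ H.cycles m,
          P.i (H.cohomologyClass f hf) (H.homologyClass x hx) =
            H.homologyClass (H.cap h f x) hm) ∧
      (∀ (p n m : ℕ) (h : m + p = n + 1) (f : HomAssocAlgebra.Multi k A p)
        (hf : f ∈ H.cocycles p) (x : HomAssocAlgebra.Chains k A n) (hx : x ∈ H.cycles n),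
        ∃ hm : H.lieDerivative h f x ∈ H.cycles m,
          P.L (H.cohomologyClass f hf) (H.homologyClass x hx) =
            H.homologyClass (H.lieDerivative h f x) hm) :=
  ⟨fun _ _ hf => ⟨HomAssocAlgebra.delta_mem_cochains hf, HomAssocAlgebra.delta_delta hf⟩,
    HomAssocAlgebra.boundary_boundary, H.precalculus,
    fun _ _ _ h _ hf _ hg =>
      ⟨HomAssocAlgebra.cup_mem_cocycles h hf hg, HomAssocAlgebra.cohomologyCup_class h⟩,
    fun _ _ _ h _ hf _ hg =>
      ⟨HomAssocAlgebra.bracket_mem_cocycles h hf hg, HomAssocAlgebra.cohomologyBracket_class h⟩,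
    fun _ _ _ h _ hf _ hx =>
      ⟨HomAssocAlgebra.cap_mem_cycles h hf hx, HomAssocAlgebra.homologyCap_class h⟩,
    fun _ _ _ h _ hf _ hx =>
      ⟨HomAssocAlgebra.lieDerivative_mem_cycles h hf hx, HomAssocAlgebra.homologyLie_class h⟩⟩
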